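/- **Conventions.** All complexes are abstract simplicial complexes; the distance between two vertices is the number of edges of a shortest path in the $1$-skeleton. A *loop* in $X$ is a subcomplex isomorphic to a triangulation of the circle. A *filling diagram* for a loop $\gamma$ in $X$ is a simplicial map $f:D\to X$, where $D$ is a (finite) triangulated $2$-disc and $f$ maps $\partial D$ isomorphically onto $\gamma$; it is *minimal* if $D$ has the least possible number of triangles among all filling diagrams for $\gamma$. A *$k$-vertex* of $D$ is an interior vertex of $D$ with exactly $k$ neighbours. A flag, simply connected complex $X$ is *$(s,t)$-uniform* ($s,t\ge 4$) if for every loop $\gamma$ in $X$ and every minimal filling diagram $(D,f)$ for $\gamma$ the following holds: if $s=t$, every interior vertex of $D$ is a $t$-vertex; if $s\ne t$, every interior vertex of $D$ is an $s$-vertex or a $t$-vertex, all neighbours of an $s$-vertex are $t$-vertices or boundary vertices, and the neighbours of a $t$-vertex form a full cycle $(v_1,\dots,v_t)$ such that each $v_i$ with $i$ odd is a $t$-vertex or a boundary vertex and each $v_i$ with $i$ even is an $s$-vertex or a boundary vertex. For an interior vertex $v$ of such a disc $D$, the *sphere* $S_n$ of radius $n$ about $v$ is the set of edges of $D$ both of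 whose endpoints are at distance $n$ from $v$; its *length* $|S_n|$ is the number of these edges, and its *area* $A_n$ is the number of triangles of $D$ inside it, i.e. all of whose vertices are at distance at most $n$ from $v$. We consider the spheres that are not cut off by the boundary of $D$, i.e. such that all vertices at distance less than $n$ from $v$ are interior vertices of $D$. **Theorem.** Let $s,t\ge 6$ be integers with $t$ even and $(s,t)\ne(6,6)$, and put $T=t-4$, $S=s-4$. For the spheres in minimal filling diagrams of loops in $(s,t)$-uniform complexes, $$\lim_{n\to\infty}\frac{A_n}{|S_n|}=\sqrt{\frac{T+8+\sqrt{T^2+8ST}}{T-8+\sqrt{T^2+8ST}}},$$ and this limit can also be expressed as $$\lim_{n\to\infty}\frac{A_n}{|S_n|}=\sqrt{\frac{P+2}{P-2}},\qquad P=\frac{T+\sqrt{T^2+8ST}}{4}.$$ Here the limit means: for every $\varepsilon>0$ there is $N$, depending only on $s$, $t$ and $\varepsilon$, such that for all $n\ge N$, every $(s,t)$-uniform complex $X$, every loop $\gamma$ in $X$, every minimal filling diagram $(D,f)$ for $\gamma$ and every interior vertex $v$ of $D$ such that all vertices at distance less than $n$ from $v$ are interior, the ratio $A_n/|S_n|$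 differs from the stated value by less than $\varepsilon$. -/

import Mathlib

universe u

noncomputable section

namespace SimplicialDisc

/-! ### Simplicial complexes

A simplicial complex with vertex set `V` is Mathlib's `AbstractSimplicialComplex V`
(all singletons are faces); subcomplexes may omit vertices and are
`PreAbstractSimplicialComplex V`. -/

open scoped Classical in
/-- The `1`-skeleton. The metric on the vertices is `(skeleton X).dist`. -/
def skeleton {V : Type*} (X : AbstractSimplicialComplex V) : SimpleGraph V where
  Adj a b := a ≠ b ∧ ({a, b} : Finset V) ∈ X.faces
  symm := ⟨fun a b h => ⟨h.1.symm, by rw [Finset.pair_comm]; exact h.2⟩⟩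
  loopless := ⟨fun _ h => h.1 rfl⟩

/-- Flag: every nonempty finite set of pairwise adjacent vertices spans a simplex. -/
def IsFlag {V : Type*} (X : AbstractSimplicialComplex V) : Prop :=
  ∀ s : Finset V, s.Nonempty → (∀ a ∈ s, ∀ b ∈ s, a ≠ b → (skeleton X).Adj a b) → s ∈ X.faces

open scoped Classical in
/-- Homotopy of edge paths relative to their endpoints: the congruence generated by deleting a
backtrack `a, b, a` and by replacing two sides `a, b, c` of a `2`-simplex by the third one. -/
inductive Homotopic {V : Type*} (X : AbstractSimplicialComplex V) :
    {a b : V} → (skeleton X).Walk a b → (skeleton X).Walk a b → Prop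
  | refl {a b : V} (p : (skeleton X).Walk a b) : Homotopic X p p
  | symm {a b : V} {p q : (skeleton X).Walk a b} : Homotopic X p q → Homotopic X q p
  | trans {a b : V} {p q r : (skeleton X).Walk a b} :
      Homotopic X p q → Homotopic X q r → Homotopic X p r
  | cons {a b c : V} (h : (skeleton X).Adj a b) {p q : (skeleton X).Walk b c} :
      Homotopic X p q → Homotopic X (.cons h p) (.cons h q)
  | backtrack {a b c : V} (h : (skeleton X).Adj a b) (h' : (skeleton X).Adj b a)
      (p : (skeleton X).Walk a c) : Homotopic X (.cons h (.cons h' p)) p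
  | triangle {a b c d : V} (hab : (skeleton X).Adj a b) (hbc : (skeleton X).Adj b c)
      (hac : (skeleton X).Adj a c) (hface : ({a, b, c} : Finset V) ∈ X.faces)
      (p : (skeleton X).Walk c d) : Homotopic X (.cons hab (.cons hbc p)) (.cons hac p)

/-- Simply connected: nonempty, connected, and every closed edge path is null-homotopic
(the edge-path group is trivial). -/
structure IsSimplyConnected {V : Type*} (X : AbstractSimplicialComplex V) : Prop where
  connected : (skeleton X).Connected
  null_homotopic : ∀ (a : V) (p : (skeleton X).Walk a a), Homotopic X p .nil

/-! ### Triangulated discs -/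

/-- The `2`-simplices. -/
def triangles {W : Type*} (D : AbstractSimplicialComplex W) : Set (Finset W) :=
  {τ | τ ∈ D.faces ∧ τ.card = 3}

/-- The number of `2`-simplices. -/
def area {W : Type*} (D : AbstractSimplicialComplex W) : ℕ := (triangles D).ncard

open scoped Classical in
/-- The link of a vertex, as a graph on the neighbours of that vertex. (For a complex of dimension
at most `2` this is the whole link.) -/
def linkGraph {W : Type*} (D : AbstractSimplicialComplex W) (v : W) :
    SimpleGraph ((skeleton D).neighborSet v) where
  Adj a b := a ≠ b ∧ ({v, a.1, b.1} : Finset W) ∈ D.faces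
  symm := ⟨fun a b h => ⟨h.1.symm, by rw [Finset.pair_comm]; exact h.2⟩⟩
  loopless := ⟨fun _ h => h.1 rfl⟩

/-- A boundary edge is an edge that lies in exactly one triangle. -/
def IsBoundaryEdge {W : Type*} (D : AbstractSimplicialComplex W) (e : Finset W) : Prop :=
  e ∈ D.faces ∧ e.card = 2 ∧ ∃! τ, τ ∈ triangles D ∧ e ⊆ τ

/-- A boundary vertex is an endpoint of a boundary edge. -/
def IsBoundaryVertex {W : Type*} (D : AbstractSimplicialComplex W) (v : W) : Prop :=
  ∃ e, IsBoundaryEdge D e ∧ v ∈ e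

/-- An interior vertex is a vertex that is not on the boundary. -/
def IsInteriorVertex {W : Type*} (D : AbstractSimplicialComplex W) (v : W) : Prop :=
  ¬ IsBoundaryVertex D v

/-- The boundary `∂D`: the boundary edges and their endpoints. -/
def boundary {W : Type*} (D : AbstractSimplicialComplex W) : PreAbstractSimplicialComplex W where
  faces := {σ | σ.Nonempty ∧ ∃ e, IsBoundaryEdge D e ∧ σ ⊆ e}
  isRelLowerSet_faces := fun {_} h =>
    ⟨h.1, fun _ hts ht => ⟨ht, h.2.imp fun _ he => ⟨he.1, hts.trans he.2⟩⟩⟩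

/-- A triangulated `2`-disc: a finite triangulated surface (the link of each vertex is a circle or
an arc) that is simply connected and has nonempty boundary. By the classification of compact
surfaces the disc is the only such surface. -/
structure IsDisc {W : Type*} (D : AbstractSimplicialComplex W) : Prop where
  finite : Finite W
  card_le : ∀ σ ∈ D.faces, σ.card ≤ 3
  link : ∀ v : W,
    (∃ n : ℕ, 3 ≤ n ∧ Nonempty (linkGraph D v ≃g SimpleGraph.cycleGraph n)) ∨
    (∃ n : ℕ, 2 ≤ n ∧ Nonempty (linkGraph D v ≃g SimpleGraph.pathGraph n))
  simplyConnected : IsSimplyConnected D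
  boundary_nonempty : ∃ v, IsBoundaryVertex D v

/-! ### Loops and filling diagrams -/

open scoped Classical in
/-- A loop (cycle) in `X`: a subcomplex isomorphic to a triangulation of the circle, that is, with
distinct vertices `c 0, …, c (n - 1)`, `n ≥ 3`, and edges `{c i, c (i + 1)}`, indices mod `n`. -/
def IsLoop {V : Type*} (X : AbstractSimplicialComplex V) (γ : PreAbstractSimplicialComplex V) :
    Prop :=
  γ ≤ X.toPreAbstractSimplicialComplex ∧
    ∃ n : ℕ, 3 ≤ n ∧ ∃ c : ZMod n → V, Function.Injective c ∧
      ∀ σ : Finset V, σ ∈ γ.faces ↔ σ.Nonempty ∧ ∃ i : ZMod n, σ ⊆ {c i, c (i + 1)}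

open scoped Classical in
/-- A filling diagram `(D, f)` for `γ`: `D` is a triangulated disc, `f` is a simplicial map, and
`f` maps `∂D` isomorphically onto `γ`. -/
structure IsFillingDiagram {V W : Type*} (X : AbstractSimplicialComplex V)
    (γ : PreAbstractSimplicialComplex V) (D : AbstractSimplicialComplex W) (f : W → V) :
    Prop where
  disc : IsDisc D
  simplicial : ∀ σ ∈ D.faces, σ.image f ∈ X.faces
  boundary_injOn : Set.InjOn f {v | IsBoundaryVertex D v}
  boundary_map : (boundary D).map f = γ

/-- A minimal filling diagram: no filling diagram for `γ` has fewer triangles. Discs are finite, so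
it is enough to let their vertex sets range over `Type`. -/
structure IsMinimalFillingDiagram {V : Type*} {W : Type} (X : AbstractSimplicialComplex V)
    (γ : PreAbstractSimplicialComplex V) (D : AbstractSimplicialComplex W) (f : W → V) :
    Prop where
  filling : IsFillingDiagram X γ D f
  minimal : ∀ (W' : Type) (D' : AbstractSimplicialComplex W') (f' : W' → V),
    IsFillingDiagram X γ D' f' → area D ≤ area D'

/-! ### `(s,t)`-uniform complexes -/

/-- A `k`-vertex of a disc: an interior vertex with exactly `k` neighbours. -/
def IsKVertex {W : Type*} (D : AbstractSimplicialComplex W) (k : ℕ) (v : W) : Prop :=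
  IsInteriorVertex D v ∧ ((skeleton D).neighborSet v).ncard = k

/-- The neighbours of `v` form a full cycle `(v₁, …, vₜ)` in `D` such that the `vᵢ` with `i` odd
are `t`-vertices or boundary vertices and the `vᵢ` with `i` even are `s`-vertices or boundary
vertices. Here `vᵢ` is `c (i - 1)`. -/
def HasAlternatingNeighbours {W : Type*} (D : AbstractSimplicialComplex W) (s t : ℕ) (v : W) :
    Prop :=
  ∃ c : Fin t → W, Function.Injective c ∧ Set.range c = (skeleton D).neighborSet v ∧
    (∀ i j, (skeleton D).Adj (c i) (c j) ↔ (SimpleGraph.cycleGraph t).Adj i j) ∧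
    (∀ i : Fin t, Odd (i.val + 1) → IsKVertex D t (c i) ∨ IsBoundaryVertex D (c i)) ∧
    (∀ i : Fin t, Even (i.val + 1) → IsKVertex D s (c i) ∨ IsBoundaryVertex D (c i))

/-- The condition that `(s,t)`-uniformity puts on the disc of a minimal filling diagram. -/
def IsUniformDisc {W : Type*} (D : AbstractSimplicialComplex W) (s t : ℕ) : Prop :=
  (s = t → ∀ v, IsInteriorVertex D v → IsKVertex D t v) ∧
  (s ≠ t → ∀ v, IsInteriorVertex D v →
    (IsKVertex D s v ∨ IsKVertex D t v) ∧
    (IsKVertex D s v → ∀ w, (skeleton D).Adj v w → IsKVertex D t w ∨ IsBoundaryVertex D w) ∧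
    (IsKVertex D t v → HasAlternatingNeighbours D s t v))

/-- `(s,t)`-uniform complexes, `s, t ≥ 4`. -/
structure IsUniform {V : Type*} (X : AbstractSimplicialComplex V) (s t : ℕ) : Prop where
  four_le_left : 4 ≤ s
  four_le_right : 4 ≤ t
  flag : IsFlag X
  simplyConnected : IsSimplyConnected X
  uniform : ∀ γ : PreAbstractSimplicialComplex V, IsLoop X γ →
    ∀ (W : Type) (D : AbstractSimplicialComplex W) (f : W → V),
      IsMinimalFillingDiagram X γ D f → IsUniformDisc D s t

/-! ### Spheres -/

/-- The sphere of radius `n` about `v`: the edges spanned by the vertices at distance `n`. -/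
def sphere {W : Type*} (D : AbstractSimplicialComplex W) (v : W) (n : ℕ) : Set (Finset W) :=
  {e | e ∈ D.faces ∧ e.card = 2 ∧ ∀ w ∈ e, (skeleton D).dist v w = n}

/-- The length of a sphere: its number of edges. -/
def sphereLength {W : Type*} (D : AbstractSimplicialComplex W) (v : W) (n : ℕ) : ℕ :=
  (sphere D v n).ncard

/-- The area of a sphere: the number of triangles inside it, all of whose vertices are at distance
at most `n` from the centre. -/
def sphereArea {W : Type*} (D : AbstractSimplicialComplex W) (v : W) (n : ℕ) : ℕ :=
  {τ | τ ∈ triangles D ∧ ∀ w ∈ τ, (skeleton D).dist v w ≤ n}.ncard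

/-- `lim Aₙ / |Sₙ| = L` for the spheres in minimal filling diagrams of loops in `(s,t)`-uniform
complexes. A disc is finite, so for each `n` one takes all the discs and all the centres `v` for
which the sphere of radius `n` about `v` is not cut off by the boundary of the disc (all vertices at
distance less than `n` from `v` are interior); the limit is uniform in all of these. -/
def SphereRatioTendsto (s t : ℕ) (L : ℝ) : Prop :=
  ∀ ε : ℝ, 0 < ε → ∃ N : ℕ, ∀ n : ℕ, N ≤ n →
    ∀ (V : Type u) (X : AbstractSimplicialComplex V), IsUniform X s t →
    ∀ γ : PreAbstractSimplicialComplex V, IsLoop X γ →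
    ∀ (W : Type) (D : AbstractSimplicialComplex W) (f : W → V), IsMinimalFillingDiagram X γ D f →
    ∀ v : W, IsInteriorVertex D v →
      (∀ w : W, (skeleton D).dist v w < n → IsInteriorVertex D w) →
      |(sphereArea D v n : ℝ) / (sphereLength D v n : ℝ) - L| < ε

end SimplicialDisc

end

noncomputable section

namespace SimplicialDisc

open Finset
open scoped Classical

set_option linter.unusedSectionVars false

/-! ### Stars and links of vertices in a disc -/

section Local

variable {W : Type*} {D : AbstractSimplicialComplex W}

/-! Minimality and the complex `X` enter only through the degree conditions: the argument takes
place in a triangulated disc whose interior vertices have degree at least `6`, so that the disc is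
nonpositively curved.

The geometric engine is a combinatorial Gauss–Bonnet inequality (`IsFilledCycle.gaussBonnet`): for a
simple closed path with filling `C`, the sum over its vertices of `3` minus the number of triangles
of `C` there is at least `6`. It follows from an Euler inequality for `C`, which is rank–nullity
over `ZMod 2` once every cycle in `C` bounds inside `C`; simple connectivity supplies this. Applied
to bigons formed by two geodesics from `v` with as few triangles between them as possible, it shows
that an edge of a sphere has a common neighbour one level closer to `v` (`exists_common_lower`), and
that two neighbours of `x` one level closer span a triangle with `x` (`lower_triangle`).

Consequently no triangle of the ball is flat, every edge of an interior sphere is the base of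
exactly one triangle pointing inwards and one pointing outwards, and every vertex of such a sphere
has two neighbours on it. So the triangles between radii `k` and `k + 1` number `|S_k| + |S_{k+1}|`,
and the area is the sum of these numbers.

Summing degrees over a sphere then gives linear recurrences. For `s ≠ t` and `t` even, every
triangle with interior vertices has exactly one `s`-vertex, so a second count, weighted by the
indicator of the `s`-vertices, closes the system for the length `x` of a sphere and the number `y`
of its `s`-vertices. For `s = t` the choice `y = x / 3` satisfies the same system. The matrix of the
system has eigenvalues `P` and `-r` with `0 < r < P`. The component for `P` satisfies `f (k + 2) = P
* f (k + 1) - f k` and grows like `l ^ n` with `l + l⁻¹ = P`; the other component is `o(l ^ n)`.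
Telescoping gives the limit `(2 * l - P) / (P - 2) = √((P + 2) / (P - 2))`. Only three pairs of
initial values occur, so the convergence is uniform over all discs and centres. -/

lemma faces_of_subset {σ τ : Finset W} (hτ : τ ∈ D.faces) (h : σ ⊆ τ) (hσ : σ.Nonempty) :
    σ ∈ D.faces :=
  (D.isRelLowerSet_faces hτ).2 h hσ

lemma adj_of_mem_face {τ : Finset W} (hτ : τ ∈ D.faces) {a b : W} (ha : a ∈ τ) (hb : b ∈ τ)
    (hab : a ≠ b) : (skeleton D).Adj a b :=
  ⟨hab, faces_of_subset hτ (by simp [insert_subset_iff, ha, hb]) (by simp)⟩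

lemma exists_eq_triple {τ : Finset W} (hτ : τ.card = 3) {x y : W} (hx : x ∈ τ) (hy : y ∈ τ)
    (hxy : x ≠ y) : ∃ z, z ≠ x ∧ z ≠ y ∧ τ = {x, y, z} := by
  obtain ⟨a, b, c, hab, hac, hbc, rfl⟩ := card_eq_three.1 hτ
  simp only [mem_insert, mem_singleton] at hx hy
  rcases hx with rfl | rfl | rfl <;> rcases hy with rfl | rfl | rfl
  · exact absurd rfl hxy
  · exact ⟨c, hac.symm, hbc.symm, rfl⟩
  · exact ⟨b, hab.symm, hbc, by grind⟩
  · exact ⟨c, hbc.symm, hac.symm, by grind⟩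
  · exact absurd rfl hxy
  · exact ⟨a, hab, hac, by grind⟩
  · exact ⟨b, hbc, hab.symm, by grind⟩
  · exact ⟨a, hac, hab, by grind⟩
  · exact absurd rfl hxy

lemma card_triple {x y z : W} (hxy : x ≠ y) (hxz : x ≠ z) (hyz : y ≠ z) :
    ({x, y, z} : Finset W).card = 3 :=
  card_eq_three.2 ⟨x, y, z, hxy, hxz, hyz, rfl⟩

/-- The link of a vertex has no isolated vertices. -/
lemma IsDisc.link_exists (hD : IsDisc D) (x : W) (y : (skeleton D).neighborSet x) :
    ∃ z, (linkGraph D x).Adj y z := by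
  have path : ∀ n : ℕ, 2 ≤ n → ∀ i : Fin n, ∃ j, (SimpleGraph.pathGraph n).Adj i j := by
    intro n hn i
    by_cases h : i.val + 1 < n
    · exact ⟨⟨i.val + 1, h⟩, by simp [SimpleGraph.pathGraph_adj]⟩
    · exact ⟨⟨i.val - 1, by omega⟩, by simp [SimpleGraph.pathGraph_adj]; omega⟩
  rcases hD.link x with ⟨n, hn, ⟨φ⟩⟩ | ⟨n, hn, ⟨φ⟩⟩
  · obtain ⟨j, hj⟩ := path n (by omega) (φ y)
    exact ⟨φ.symm j, by
      rw [← φ.map_adj_iff]; simpa using SimpleGraph.pathGraph_le_cycleGraph hj⟩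
  · obtain ⟨j, hj⟩ := path n hn (φ y)
    exact ⟨φ.symm j, by rw [← φ.map_adj_iff]; simpa using hj⟩

/-- Vertices of a cycle or an arc have degree at most two; this is what limits an edge of the disc
to two triangles. -/
lemma IsDisc.link_le_two (hD : IsDisc D) (x : W) {y a b c : (skeleton D).neighborSet x}
    (ha : (linkGraph D x).Adj y a) (hb : (linkGraph D x).Adj y b)
    (hc : (linkGraph D x).Adj y c) : a = b ∨ a = c ∨ b = c := by
  rcases hD.link x with ⟨n, hn, ⟨φ⟩⟩ | ⟨n, hn, ⟨φ⟩⟩ <;>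
  rw [← φ.map_adj_iff] at ha hb hc
  · have key : ∀ u v w : Fin n, (u - v).val = 1 → (u - w).val = 1 → v = w := by
      intro u v w h1 h2
      have : NeZero n := ⟨by omega⟩
      exact sub_right_injective (Fin.ext (h1.trans h2.symm))
    have key' : ∀ u v w : Fin n, (v - u).val = 1 → (w - u).val = 1 → v = w := by
      intro u v w h1 h2
      have : NeZero n := ⟨by omega⟩
      exact sub_left_injective (Fin.ext (h1.trans h2.symm))
    rw [SimpleGraph.cycleGraph_adj'] at ha hb hc
    simp only [← φ.injective.eq_iff]
    rcases ha with ha | ha <;> rcases hb with hb | hb <;> rcases hc with hc | hc <;>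
      first
        | exact Or.inl (key _ _ _ ha hb)
        | exact Or.inl (key' _ _ _ ha hb)
        | exact Or.inr (Or.inl (key _ _ _ ha hc))
        | exact Or.inr (Or.inl (key' _ _ _ ha hc))
        | exact Or.inr (Or.inr (key _ _ _ hb hc))
        | exact Or.inr (Or.inr (key' _ _ _ hb hc))
  · rw [SimpleGraph.pathGraph_adj] at ha hb hc
    simp only [← φ.injective.eq_iff, Fin.ext_iff]
    omega

lemma IsDisc.link_preconnected (hD : IsDisc D) (x : W) : (linkGraph D x).Preconnected := by
  rcases hD.link x with ⟨n, hn, ⟨φ⟩⟩ | ⟨n, hn, ⟨φ⟩⟩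
  · exact φ.preconnected_iff.2 SimpleGraph.cycleGraph_preconnected
  · exact φ.preconnected_iff.2 (SimpleGraph.pathGraph_preconnected n)

/-- The triangles of `C` that contain the vertices `x` and `y`. -/
def edgeTris (C : Finset (Finset W)) (x y : W) : Finset (Finset W) :=
  C.filter fun τ => x ∈ τ ∧ y ∈ τ

/-- The triangles of `C` that contain the vertex `x`. -/
def vertTris (C : Finset (Finset W)) (x : W) : Finset (Finset W) := C.filter fun τ => x ∈ τ

lemma mem_edgeTris {C : Finset (Finset W)} {x y : W} {τ : Finset W} :
    τ ∈ edgeTris C x y ↔ τ ∈ C ∧ x ∈ τ ∧ y ∈ τ := by simp [edgeTris]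

lemma mem_vertTris {C : Finset (Finset W)} {x : W} {τ : Finset W} :
    τ ∈ vertTris C x ↔ τ ∈ C ∧ x ∈ τ := by simp [vertTris]

lemma edgeTris_mono {C C' : Finset (Finset W)} (h : C ⊆ C') (x y : W) :
    edgeTris C x y ⊆ edgeTris C' x y := filter_subset_filter _ h

variable [Fintype W]

/-- The finite set of `2`-simplices. -/
def tris (D : AbstractSimplicialComplex W) : Finset (Finset W) := univ.filter (· ∈ triangles D)

lemma mem_tris {τ : Finset W} : τ ∈ tris D ↔ τ ∈ D.faces ∧ τ.card = 3 := by
  rw [tris, mem_filter]; exact ⟨fun h => h.2, fun h => ⟨mem_univ _, h⟩⟩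

lemma IsDisc.one_le_card_edgeTris (hD : IsDisc D) {x y : W} (h : (skeleton D).Adj x y) :
    1 ≤ #(edgeTris (tris D) x y) := by
  obtain ⟨z, hz⟩ := hD.link_exists x ⟨y, h⟩
  refine card_pos.2 ⟨{x, y, z.1}, ?_⟩
  rw [mem_edgeTris, mem_tris]
  exact ⟨⟨hz.2, card_triple h.1 z.2.1 (fun e => hz.1 (Subtype.ext e))⟩, by simp, by simp⟩

lemma IsDisc.card_edgeTris_le_two (hD : IsDisc D) {x y : W} (h : x ≠ y) :
    #(edgeTris (tris D) x y) ≤ 2 := by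
  by_contra! hlt
  obtain ⟨a, ha, b, hb, c, hc, hab, hac, hbc⟩ := two_lt_card.1 hlt
  have key : ∀ τ ∈ edgeTris (tris D) x y, ∃ (hy : (skeleton D).Adj x y)
      (z : (skeleton D).neighborSet x), (linkGraph D x).Adj ⟨y, hy⟩ z ∧ τ = {x, y, z.1} := by
    intro τ hτ
    rw [mem_edgeTris, mem_tris] at hτ
    obtain ⟨⟨hτ, h3⟩, hx, hy⟩ := hτ
    obtain ⟨z, hzx, hzy, rfl⟩ := exists_eq_triple h3 hx hy h
    exact ⟨adj_of_mem_face hτ hx hy h, ⟨z, adj_of_mem_face hτ hx (by simp) hzx.symm⟩,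
      ⟨fun e => hzy (congrArg Subtype.val e).symm, hτ⟩, rfl⟩
  obtain ⟨hy, a', ha', rfl⟩ := key a ha
  obtain ⟨_, b', hb', rfl⟩ := key b hb
  obtain ⟨_, c', hc', rfl⟩ := key c hc
  rcases hD.link_le_two x ha' hb' hc' with rfl | rfl | rfl
  · exact hab rfl
  · exact hac rfl
  · exact hbc rfl

lemma isBoundaryVertex_of_card_edgeTris {x y : W} (h : (skeleton D).Adj x y)
    (h1 : #(edgeTris (tris D) x y) = 1) : IsBoundaryVertex D x := by
  by_contra hx
  obtain ⟨τ, hτ⟩ := card_eq_one.1 h1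
  refine hx ⟨{x, y}, ⟨h.2, card_pair h.1, τ, ?_, ?_⟩, by simp⟩
  · have : τ ∈ edgeTris (tris D) x y := by simp [hτ]
    rw [mem_edgeTris, mem_tris] at this
    exact ⟨this.1, by simp [insert_subset_iff, this.2]⟩
  · rintro σ ⟨hσ, hs⟩
    have : σ ∈ edgeTris (tris D) x y := by
      rw [mem_edgeTris, mem_tris]
      exact ⟨hσ, hs (by simp), hs (by simp)⟩
    simpa [hτ] using this

lemma IsDisc.card_edgeTris_interior (hD : IsDisc D) {x y : W} (h : (skeleton D).Adj x y)
    (hx : IsInteriorVertex D x) : #(edgeTris (tris D) x y) = 2 := by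
  have h1 := hD.one_le_card_edgeTris h
  have h2 := hD.card_edgeTris_le_two h.1
  have h3 : #(edgeTris (tris D) x y) ≠ 1 := fun h1 =>
    hx (isBoundaryVertex_of_card_edgeTris h h1)
  omega

/-- The triangles at a vertex are connected through their common edges. -/
lemma IsDisc.vertTris_closure (hD : IsDisc D) (x : W) (Q : Finset W → Prop)
    (hQ : ∀ y σ τ, y ≠ x → σ ∈ edgeTris (tris D) x y → τ ∈ edgeTris (tris D) x y → Q σ → Q τ)
    {σ τ : Finset W} (hσ : σ ∈ vertTris (tris D) x) (hτ : τ ∈ vertTris (tris D) x)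
    (h : Q σ) : Q τ := by
  have key : ∀ ρ ∈ vertTris (tris D) x, ∃ y : (skeleton D).neighborSet x, y.1 ∈ ρ := by
    intro ρ hρ
    rw [mem_vertTris, mem_tris] at hρ
    obtain ⟨y, hy, hyx⟩ := exists_mem_ne (show 1 < #ρ by omega) x
    exact ⟨⟨y, adj_of_mem_face hρ.1.1 hρ.2 hy hyx.symm⟩, hy⟩
  obtain ⟨a, ha⟩ := key σ hσ
  obtain ⟨b, hb⟩ := key τ hτ
  rw [mem_vertTris] at hσ hτ
  have walk : ∀ {a b : (skeleton D).neighborSet x}, (linkGraph D x).Walk a b →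
      (∀ σ ∈ edgeTris (tris D) x a.1, Q σ) → ∀ τ ∈ edgeTris (tris D) x b.1, Q τ := by
    intro a b p
    induction p with
    | nil => exact id
    | @cons a c b h p ih =>
      intro hyp
      refine ih fun τ hτ => ?_
      have hac : ({x, a.1, c.1} : Finset W) ∈ tris D :=
        mem_tris.2 ⟨h.2, card_triple a.2.1 c.2.1 (fun e => h.1 (Subtype.ext e))⟩
      exact hQ c.1 _ _ c.2.1.symm (mem_edgeTris.2 ⟨hac, by simp, by simp⟩) hτ
        (hyp _ (mem_edgeTris.2 ⟨hac, by simp, by simp⟩))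
  obtain ⟨p⟩ := hD.link_preconnected x a b
  exact walk p (fun ρ hρ => hQ a.1 σ ρ a.2.1.symm (mem_edgeTris.2 ⟨hσ.1, hσ.2, ha⟩) hρ h) τ
    (mem_edgeTris.2 ⟨hτ.1, hτ.2, hb⟩)

/-- Counting pairs of a triangle of `C` at `x` and another vertex of it. -/
lemma sum_card_edgeTris {C : Finset (Finset W)} (hC : C ⊆ tris D) (x : W) :
    ∑ y ∈ univ.erase x, #(edgeTris C x y) = 2 * #(vertTris C x) := by
  have h : ∀ y, edgeTris C x y = (vertTris C x).filter fun τ => y ∈ τ := by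
    intro y; ext τ; simp [mem_edgeTris, mem_vertTris, and_assoc]
  simp_rw [h]
  have := sum_card_bipartiteAbove_eq_sum_card_bipartiteBelow (s := univ.erase x)
    (t := vertTris C x) (fun (y : W) (τ : Finset W) => y ∈ τ)
  simp only [bipartiteAbove, bipartiteBelow] at this
  rw [this, mul_comm]
  refine sum_const_nat fun τ hτ => ?_
  rw [mem_vertTris] at hτ
  have h3 := (mem_tris.1 (hC hτ.1)).2
  have : (univ.erase x).filter (fun y => y ∈ τ) = τ.erase x := by ext; simp
  rw [this, card_erase_of_mem hτ.2, h3]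

/-- Double counting: each edge at an interior vertex lies in two triangles, and each triangle at `x`
has two edges at `x`. -/
lemma IsDisc.card_vertTris_interior (hD : IsDisc D) {x : W} (hx : IsInteriorVertex D x) :
    #(vertTris (tris D) x) = ((skeleton D).neighborSet x).ncard := by
  have h := sum_card_edgeTris (subset_refl (tris D)) x
  have h2 : ∑ y ∈ univ.erase x, #(edgeTris (tris D) x y) =
      ∑ y ∈ univ.erase x, if (skeleton D).Adj x y then 2 else 0 := by
    refine sum_congr rfl fun y hy => ?_
    split_ifs with hxy
    · exact hD.card_edgeTris_interior hxy hx
    · rw [card_eq_zero, eq_empty_iff_forall_notMem]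
      intro τ hτ
      rw [mem_edgeTris, mem_tris] at hτ
      exact hxy (adj_of_mem_face hτ.1.1 hτ.2.1 hτ.2.2 (ne_of_mem_erase hy).symm)
  rw [h2, ← sum_filter, sum_const, smul_eq_mul] at h
  rw [← Nat.mul_left_cancel_iff (show 0 < 2 by norm_num), ← h, mul_comm]
  congr 1
  rw [← Set.ncard_coe_finset]
  congr 1
  ext y
  simp only [coe_filter, mem_erase, mem_univ, and_true, SimpleGraph.mem_neighborSet, Set.mem_ofPred_eq]
  exact ⟨fun h => h.2, fun h => ⟨h.1.symm, h⟩⟩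

/-- The link of an interior vertex of degree at least `4` has no triangles. -/
lemma IsDisc.no_link_triangle (hD : IsDisc D) {x a b c : W} (hx : IsInteriorVertex D x)
    (hdeg : 4 ≤ ((skeleton D).neighborSet x).ncard)
    (hab : {x, a, b} ∈ tris D) (hac : {x, a, c} ∈ tris D) (hbc : {x, b, c} ∈ tris D) :
    False := by
  have dist : ∀ {p q r : W}, ({p, q, r} : Finset W) ∈ tris D → p ≠ q ∧ p ≠ r ∧ q ≠ r := by
    intro p q r h
    have h3 := (mem_tris.1 h).2
    refine ⟨?_, ?_, ?_⟩ <;> rintro rfl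
    · have := card_le_two (a := p) (b := r); simp at h3; omega
    · have := card_le_two (a := p) (b := q)
      rw [show ({p, q, p} : Finset W) = {p, q} by grind] at h3; omega
    · have := card_le_two (a := p) (b := q); simp at h3; omega
  obtain ⟨hxa, hxb, nab⟩ := dist hab
  obtain ⟨-, hxc, nac⟩ := dist hac
  obtain ⟨-, -, nbc⟩ := dist hbc
  have two : ∀ {p q r : W}, x ≠ p → q ≠ r → p ≠ q → x ≠ q →
      {x, p, q} ∈ tris D → {x, p, r} ∈ tris D →
      ∀ ρ ∈ edgeTris (tris D) x p, ρ = {x, p, q} ∨ ρ = {x, p, r} := by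
    intro p q r hp hqr hpq hq h1 h2 ρ hρ
    by_contra! hne
    refine absurd (hD.card_edgeTris_le_two hp) (not_le.2 (two_lt_card.2 ⟨ρ, hρ, {x, p, q},
      mem_edgeTris.2 ⟨h1, by simp, by simp⟩, {x, p, r}, mem_edgeTris.2 ⟨h2, by simp, by simp⟩,
      hne.1, hne.2, fun h => ?_⟩))
    have : q ∈ ({x, p, r} : Finset W) := h ▸ (by simp)
    simp only [mem_insert, mem_singleton] at this
    rcases this with h | h | h
    · exact hq h.symm
    · exact hpq h.symm
    · exact hqr h
  have ea := two hxa nbc nab hxb hab hac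
  have eb := two hxb nac nab.symm hxa (by rwa [pair_comm b a]) hbc
  have ec := two hxc nab nac.symm hxa (by rwa [pair_comm c a]) (by rwa [pair_comm c b])
  rw [pair_comm b a] at eb
  rw [pair_comm c a, pair_comm c b] at ec
  -- The three triangles are closed under crossing an edge at `x`, and the star of `x` is connected
  -- through such edges, so they are the whole star and `x` has degree at most `3`.
  have all : vertTris (tris D) x ⊆ {{x, a, b}, {x, a, c}, {x, b, c}} := by
    intro τ hτ
    rw [mem_insert, mem_insert, mem_singleton]
    refine hD.vertTris_closure x (fun ρ => ρ = {x, a, b} ∨ ρ = {x, a, c} ∨ ρ = {x, b, c}) ?_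
      (mem_vertTris.2 ⟨hab, by simp⟩) hτ (Or.inl rfl)
    intro y σ ρ hy hσ hρ hmem
    have hyσ := (mem_edgeTris.1 hσ).2.2
    have : y = a ∨ y = b ∨ y = c := by
      rcases hmem with h | h | h <;> rw [h] at hyσ <;>
        simp only [mem_insert, mem_singleton, hy, false_or] at hyσ
      · exact hyσ.imp_right Or.inl
      · exact hyσ.imp_right Or.inr
      · exact Or.inr hyσ
    rcases this with h | h | h <;> rw [h] at hρ
    · exact (ea _ hρ).imp_right Or.inl
    · exact (eb _ hρ).imp_right Or.inr
    · exact Or.inr (ec _ hρ)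
  have h1 := card_le_card all
  have h2 := hD.card_vertTris_interior hx
  have h3 := card_le_three (a := ({x, a, b} : Finset W)) (b := {x, a, c}) (c := {x, b, c})
  omega

end Local

/-! ### Chains modulo 2 and the homology of a disc -/

section Chains

variable {W : Type*}

/-- The `1`-chain (with coefficients in `ZMod 2`) of the edge `{a, b}`. -/
def edgeChain (a b : W) : Finset W → ZMod 2 := Pi.single {a, b} 1

lemma edgeChain_comm (a b : W) : edgeChain a b = edgeChain b a := by
  rw [edgeChain, edgeChain, pair_comm]

/-- The boundary of a set of triangles. -/
def bd (C : Finset (Finset W)) : Finset W → ZMod 2 :=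
  ∑ τ ∈ C, ∑ e ∈ powersetCard 2 τ, Pi.single e 1

lemma bd_empty : bd (∅ : Finset (Finset W)) = 0 := by simp [bd]

lemma bd_apply (C : Finset (Finset W)) {e : Finset W} (he : e.card = 2) :
    bd C e = (#(C.filter fun τ => e ⊆ τ) : ZMod 2) := by
  simp only [bd, Finset.sum_apply, Pi.single_apply]
  rw [card_filter, Nat.cast_sum]
  refine sum_congr rfl fun τ _ => ?_
  rw [sum_ite_eq]
  simp [mem_powersetCard, he]

lemma bd_apply_of_card_ne (C : Finset (Finset W)) {e : Finset W} (he : e.card ≠ 2) :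
    bd C e = 0 := by
  simp only [bd, Finset.sum_apply, Pi.single_apply]
  refine sum_eq_zero fun τ _ => ?_
  rw [sum_ite_eq]
  simp [mem_powersetCard, he]

lemma bd_pair (C : Finset (Finset W)) {a b : W} (h : a ≠ b) :
    bd C {a, b} = (#(edgeTris C a b) : ZMod 2) := by
  rw [bd_apply C (card_pair h)]
  simp only [edgeTris, insert_subset_iff, singleton_subset_iff]

lemma bd_singleton {a b c : W} (hab : a ≠ b) (hac : a ≠ c) (hbc : b ≠ c) :
    bd {{a, b, c}} = edgeChain a b + edgeChain b c + edgeChain a c := by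
  have h : powersetCard 2 ({a, b, c} : Finset W) = {{a, b}, {b, c}, {a, c}} := by
    ext e
    simp only [mem_powersetCard, mem_insert, mem_singleton]
    constructor
    · rintro ⟨hs, h2⟩
      obtain ⟨x, y, hxy, rfl⟩ := card_eq_two.1 h2
      have hx := hs (mem_insert_self x _)
      have hy := hs (mem_insert_of_mem (mem_singleton_self y))
      simp only [mem_insert, mem_singleton] at hx hy
      rcases hx with rfl | rfl | rfl <;> rcases hy with rfl | rfl | rfl <;>
        simp_all [pair_comm]
    · rintro (rfl | rfl | rfl)
      · exact ⟨by simp [insert_subset_iff], card_pair hab⟩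
      · exact ⟨by simp, card_pair hbc⟩
      · exact ⟨by simp [insert_subset_iff], card_pair hac⟩
  have n1 : ({a, b} : Finset W) ≠ {b, c} := fun h => by
    have : a ∈ ({b, c} : Finset W) := h ▸ mem_insert_self a _
    simp [hab, hac] at this
  have n2 : ({a, b} : Finset W) ≠ {a, c} := fun h => by
    have : b ∈ ({a, c} : Finset W) := h ▸ mem_insert_of_mem (mem_singleton_self b)
    simp [hab.symm, hbc] at this
  have n3 : ({b, c} : Finset W) ≠ {a, c} := fun h => by
    have : b ∈ ({a, c} : Finset W) := h ▸ mem_insert_self b _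
    simp [hab.symm, hbc] at this
  rw [bd, sum_singleton, h, sum_insert (by simp [n1, n2]), sum_insert (by simp [n3]),
    sum_singleton, ← add_assoc]
  rfl

lemma chain_add_self {X : Type*} (z : X → ZMod 2) : z + z = 0 := by
  ext x; exact CharTwo.add_self_eq_zero _

variable [Fintype W]

/-- Modulo 2, sets of triangles add by symmetric difference. -/
lemma bd_symmDiff (C C' : Finset (Finset W)) : bd (symmDiff C C') = bd C + bd C' := by
  have h : ∀ C : Finset (Finset W), bd C =
      ∑ τ, if τ ∈ C then ∑ e ∈ powersetCard 2 τ, Pi.single e (1 : ZMod 2) else 0 := by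
    intro C; rw [bd, sum_ite_mem, univ_inter]
  rw [h, h, h, ← sum_add_distrib]
  refine sum_congr rfl fun τ _ => ?_
  by_cases h1 : τ ∈ C <;> by_cases h2 : τ ∈ C' <;> simp [mem_symmDiff, h1, h2, chain_add_self]

/-- The boundary of a `1`-chain. -/
def bdOne : (Finset W → ZMod 2) →ₗ[ZMod 2] (W → ZMod 2) where
  toFun z x := ∑ e ∈ univ.filter (x ∈ ·), z e
  map_add' z z' := by ext x; simp [sum_add_distrib]
  map_smul' a z := by ext x; simp [mul_sum]

lemma bdOne_apply (z : Finset W → ZMod 2) (x : W) :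
    bdOne z x = ∑ e ∈ univ.filter (x ∈ ·), z e := rfl

lemma bdOne_single (e : Finset W) (x : W) :
    bdOne (Pi.single e 1) x = if x ∈ e then 1 else 0 := by
  simp [bdOne_apply, Pi.single_apply]

lemma bdOne_edgeChain {a b : W} (h : a ≠ b) :
    bdOne (edgeChain a b) = Pi.single a 1 + Pi.single b 1 := by
  ext x
  rw [edgeChain, bdOne_single]
  simp only [mem_insert, mem_singleton, Pi.add_apply, Pi.single_apply]
  by_cases h1 : x = a <;> by_cases h2 : x = b <;> simp_all

lemma bdOne_bd {C : Finset (Finset W)} (hC : ∀ τ ∈ C, τ.card = 3) : bdOne (bd C) = 0 := by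
  have h : ∀ τ ∈ C, bdOne (bd {τ}) = 0 := by
    intro τ hτ
    obtain ⟨a, b, c, hab, hac, hbc, rfl⟩ := card_eq_three.1 (hC τ hτ)
    rw [bd_singleton hab hac hbc, map_add, map_add, bdOne_edgeChain hab, bdOne_edgeChain hbc,
      bdOne_edgeChain hac]
    have := chain_add_self (Pi.single a 1 : W → ZMod 2)
    have := chain_add_self (Pi.single b 1 : W → ZMod 2)
    have := chain_add_self (Pi.single c 1 : W → ZMod 2)
    grind
  have h2 : bd C = ∑ τ ∈ C, bd {τ} := by simp [bd]
  rw [h2, map_sum]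
  exact sum_eq_zero h

variable {D : AbstractSimplicialComplex W}

/-- The `1`-chains that bound a set of triangles. -/
def boundaries (D : AbstractSimplicialComplex W) : AddSubmonoid (Finset W → ZMod 2) where
  carrier := {z | ∃ C, C ⊆ tris D ∧ bd C = z}
  zero_mem' := ⟨∅, by simp, bd_empty⟩
  add_mem' := by
    rintro _ _ ⟨C, hC, rfl⟩ ⟨C', hC', rfl⟩
    exact ⟨symmDiff C C', fun τ hτ => by
      rcases mem_symmDiff.1 hτ with h | h
      · exact hC h.1
      · exact hC' h.1, bd_symmDiff C C'⟩

/-- The `1`-chain of an edge path. -/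
def walkChain : {a b : W} → (skeleton D).Walk a b → Finset W → ZMod 2
  | _, _, .nil => 0
  | a, _, .cons (v := b) _ p => edgeChain a b + walkChain p

lemma walkChain_append {a b c : W} (p : (skeleton D).Walk a b) (q : (skeleton D).Walk b c) :
    walkChain (p.append q) = walkChain p + walkChain q := by
  induction p with
  | nil => simp [walkChain]
  | cons h p ih => simp [walkChain, ih, add_assoc]

lemma walkChain_reverse {a b : W} (p : (skeleton D).Walk a b) :
    walkChain p.reverse = walkChain p := by
  induction p with
  | nil => simp [walkChain]
  | cons h p ih =>
    simp only [SimpleGraph.Walk.reverse_cons, walkChain_append, walkChain, ih, add_zero]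
    rw [edgeChain_comm, add_comm]

/-- Each elementary homotopy changes the chain by nothing or by the boundary of one triangle, so a
null-homotopic path has a chain that bounds. -/
lemma walkChain_homotopic {a b : W} {p q : (skeleton D).Walk a b} (h : Homotopic D p q) :
    walkChain p + walkChain q ∈ boundaries D := by
  induction h with
  | refl p => rw [chain_add_self]; exact zero_mem _
  | symm _ ih => rwa [add_comm]
  | @trans a b p q r _ _ ih1 ih2 =>
    have := add_mem ih1 ih2
    have e := chain_add_self (walkChain q)
    have : walkChain p + walkChain r =
      walkChain p + walkChain q + (walkChain q + walkChain r) := by grind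
    rwa [this]
  | @cons a b c h p q _ ih =>
    have e := chain_add_self (edgeChain a b)
    have : walkChain (.cons h p) + walkChain (.cons h q) = walkChain p + walkChain q := by
      simp only [walkChain]; grind
    rwa [this]
  | @backtrack a b c h h' p =>
    have e := chain_add_self (edgeChain a b)
    have e' := chain_add_self (walkChain p)
    have : walkChain (.cons h (.cons h' p)) + walkChain p = 0 := by
      simp only [walkChain]; rw [edgeChain_comm b a]; grind
    rw [this]; exact zero_mem _
  | @triangle a b c d hab hbc hac hface p =>
    have e' := chain_add_self (walkChain p)
    have : walkChain (.cons hab (.cons hbc p)) + walkChain (.cons hac p) =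
        edgeChain a b + edgeChain b c + edgeChain a c := by
      simp only [walkChain]; grind
    rw [this]
    exact ⟨{{a, b, c}}, by
      simpa [mem_tris] using ⟨hface, card_triple hab.1 hac.1 hbc.1⟩,
      bd_singleton hab.1 hac.1 hbc.1⟩

/-- In a simply connected complex every `1`-cycle with coefficients in `ZMod 2` is a boundary. -/
lemma IsSimplyConnected.mem_boundaries (hD : IsSimplyConnected D) {z : Finset W → ZMod 2}
    (hz : ∀ e, z e ≠ 0 → e ∈ D.faces ∧ e.card = 2) (hbd : bdOne z = 0) :
    z ∈ boundaries D := by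
  obtain ⟨v⟩ := hD.connected.nonempty
  let P : ∀ w, (skeleton D).Walk v w := fun w => (hD.connected.preconnected v w).some
  -- Coning to the base point `v`: a vertex goes to the chain of a fixed path from `v` to it. An
  -- edge `{a, b}` plus `H` of its boundary is then the chain of a closed path at `v`, which bounds.
  -- Summing over the edges of `z` shows that `z + H (bdOne z)`, which is `z`, bounds.
  let H : (W → ZMod 2) →ₗ[ZMod 2] (Finset W → ZMod 2) :=
    { toFun := fun g => ∑ w, g w • walkChain (P w)
      map_add' := by intro g g'; simp [add_smul, sum_add_distrib]
      map_smul' := by intro a g; simp [mul_smul, smul_sum] }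
  have hH : ∀ w, H (Pi.single w 1) = walkChain (P w) := by
    intro w
    change ∑ x, (Pi.single w 1 : W → ZMod 2) x • walkChain (P x) = _
    simp [Pi.single_apply]
  have hsum : z = ∑ e ∈ univ.filter (z · ≠ 0), Pi.single e 1 := by
    ext e
    simp only [Finset.sum_apply, Pi.single_apply, sum_ite_eq, mem_filter, mem_univ, true_and]
    have : ∀ a : ZMod 2, a = if a ≠ 0 then 1 else 0 := by decide
    exact this _
  have hkey : z + H (bdOne z) ∈ boundaries D := by
    rw [hsum, map_sum, map_sum, ← sum_add_distrib]
    refine sum_mem fun e he => ?_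
    obtain ⟨he, h2⟩ := hz e (mem_filter.1 he).2
    obtain ⟨a, b, hab, rfl⟩ := card_eq_two.1 h2
    have hadj : (skeleton D).Adj a b := ⟨hab, he⟩
    change edgeChain a b + H (bdOne (edgeChain a b)) ∈ _
    rw [bdOne_edgeChain hab, map_add, hH, hH]
    have := walkChain_homotopic
      (hD.null_homotopic v ((P a).append ((SimpleGraph.Walk.cons hadj .nil).append (P b).reverse)))
    simp only [walkChain_append, walkChain_reverse, walkChain, add_zero] at this
    convert this using 1
    abel
  simpa [hbd] using hkey

/-- A set of triangles in a disc is determined by its boundary. -/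
lemma IsDisc.eq_empty_of_bd_eq_zero (hD : IsDisc D) {C : Finset (Finset W)} (hC : C ⊆ tris D)
    (h : bd C = 0) : C = ∅ := by
  by_contra hne
  obtain ⟨τ₀, hτ₀⟩ := nonempty_iff_ne_empty.2 hne
  -- The number of triangles of `C` at an edge is even and at most `2`; if positive, it is `2` and
  -- `C` contains all triangles of `D` at that edge.
  have edge : ∀ x y, y ≠ x → ∀ σ ∈ edgeTris C x y, edgeTris C x y = edgeTris (tris D) x y ∧
      #(edgeTris (tris D) x y) = 2 := by
    intro x y hxy σ hσ
    have h0 : (#(edgeTris C x y) : ZMod 2) = 0 := by rw [← bd_pair C hxy.symm, h]; rfl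
    rw [ZMod.natCast_eq_zero_iff] at h0
    have h1 : 0 < #(edgeTris C x y) := card_pos.2 ⟨σ, hσ⟩
    have h2 := hD.card_edgeTris_le_two hxy.symm
    have h3 := card_le_card (edgeTris_mono hC x y)
    exact ⟨eq_of_subset_of_card_le (edgeTris_mono hC x y) (by omega), by omega⟩
  have vert : ∀ x, ∀ σ ∈ vertTris C x, ∀ τ ∈ vertTris (tris D) x, τ ∈ C := by
    intro x σ hσ τ hτ
    rw [mem_vertTris] at hσ
    refine hD.vertTris_closure x (· ∈ C) ?_ (mem_vertTris.2 ⟨hC hσ.1, hσ.2⟩) hτ hσ.1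
    intro y ρ ρ' hy hρ hρ' hmem
    rw [← (edge x y hy ρ (mem_edgeTris.2 ⟨hmem, (mem_edgeTris.1 hρ).2⟩)).1] at hρ'
    exact (mem_edgeTris.1 hρ').1
  have nbr : ∀ x y, (skeleton D).Adj x y → (vertTris C x).Nonempty → (vertTris C y).Nonempty := by
    rintro x y hxy ⟨σ, hσ⟩
    obtain ⟨τ, hτ⟩ := card_pos.1 (hD.one_le_card_edgeTris hxy)
    rw [mem_edgeTris] at hτ
    exact ⟨τ, mem_vertTris.2 ⟨vert x σ hσ τ (mem_vertTris.2 ⟨hτ.1, hτ.2.1⟩), hτ.2.2⟩⟩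
  have all : ∀ {x y}, (skeleton D).Walk x y → (vertTris C x).Nonempty →
      (vertTris C y).Nonempty := by
    intro x y p
    induction p with
    | nil => exact id
    | cons h p ih => exact fun hx => ih (nbr _ _ h hx)
  obtain ⟨x₀, hx₀⟩ : τ₀.Nonempty := card_pos.1 (by rw [(mem_tris.1 (hC hτ₀)).2]; norm_num)
  -- A nonempty `C` spreads over whole stars, hence along walks, until it reaches the boundary edge
  -- `e`. There it would need two triangles, but only one exists.
  obtain ⟨v, e, ⟨he, h2, τ, ⟨hτ, hsub⟩, huniq⟩, hv⟩ := hD.boundary_nonempty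
  obtain ⟨p⟩ := hD.simplyConnected.connected.preconnected x₀ v
  obtain ⟨σ, hσ⟩ := all p ⟨τ₀, mem_vertTris.2 ⟨hτ₀, hx₀⟩⟩
  obtain ⟨w, hw, hwv⟩ := exists_mem_ne (show 1 < #e by omega) v
  have hτC := vert v σ hσ τ (mem_vertTris.2 ⟨mem_tris.2 hτ, hsub hv⟩)
  have hcard := (edge v w hwv τ (mem_edgeTris.2 ⟨hτC, hsub hv, hsub hw⟩)).2
  have hevw : e = {v, w} := (eq_of_subset_of_card_le (by simp [insert_subset_iff, hv, hw])
    (by rw [card_pair hwv.symm, h2])).symm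
  have : edgeTris (tris D) v w ⊆ {τ} := by
    intro ρ hρ
    rw [mem_edgeTris, mem_tris] at hρ
    rw [mem_singleton]
    exact huniq ρ ⟨hρ.1, by rw [hevw]; simp [insert_subset_iff, hρ.2]⟩
  have := card_le_card this
  simp at this
  omega

end Chains

/-! ### Euler's inequality and combinatorial Gauss–Bonnet -/

section GaussBonnet

variable {W : Type*}

/-- A simple closed edge path bounding the set of triangles `C`. -/
structure IsFilledCycle (D : AbstractSimplicialComplex W) [Fintype W] {n : ℕ} [NeZero n]
    (c : ZMod n → W) (C : Finset (Finset W)) : Prop where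
  three_le : 3 ≤ n
  inj : Function.Injective c
  adj : ∀ i, (skeleton D).Adj (c i) (c (i + 1))
  subset : C ⊆ tris D
  bd_eq : bd C = ∑ i, edgeChain (c i) (c (i + 1))

/-- The vertices of a set of triangles. -/
def verts (C : Finset (Finset W)) : Finset W := C.biUnion id

/-- The edges of a set of triangles. -/
def edges (C : Finset (Finset W)) : Finset (Finset W) := C.biUnion (powersetCard 2)

lemma mem_verts {C : Finset (Finset W)} {x : W} : x ∈ verts C ↔ ∃ τ ∈ C, x ∈ τ := by
  simp [verts]

lemma mem_edges {C : Finset (Finset W)} {e : Finset W} :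
    e ∈ edges C ↔ e.card = 2 ∧ ∃ τ ∈ C, e ⊆ τ := by
  simp [edges, mem_powersetCard]; grind

variable [Fintype W] {D : AbstractSimplicialComplex W} {n : ℕ} [NeZero n] {c : ZMod n → W}
  {C : Finset (Finset W)}

/-- Euler's inequality for a set of triangles in which every cycle bounds. -/
lemma card_edges_lt (hne : C.Nonempty) (h3 : ∀ τ ∈ C, τ.card = 3)
    (hbound : ∀ z : Finset W → ZMod 2, (∀ e, z e ≠ 0 → e ∈ edges C) → bdOne z = 0 →
      ∃ C' ⊆ C, bd C' = z) :
    #(edges C) + 1 ≤ #(verts C) + #C := by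
  let ext0 : (edges C → ZMod 2) → Finset W → ZMod 2 := fun g e =>
    if h : e ∈ edges C then g ⟨e, h⟩ else 0
  let K : (edges C → ZMod 2) →ₗ[ZMod 2] (verts C → ZMod 2) :=
    { toFun := fun g x => ∑ e : edges C, if x.1 ∈ e.1 then g e else 0
      map_add' := by
        intro g g'; ext x; simp only [Pi.add_apply, ← sum_add_distrib]
        exact sum_congr rfl fun e _ => by split_ifs <;> simp
      map_smul' := by
        intro a g; ext x; simp only [Pi.smul_apply, smul_eq_mul, RingHom.id_apply, mul_sum]
        exact sum_congr rfl fun e _ => by split_ifs <;> simp }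
  let A : (C → ZMod 2) →ₗ[ZMod 2] (edges C → ZMod 2) :=
    { toFun := fun f e => ∑ τ : C, if e.1 ⊆ τ.1 then f τ else 0
      map_add' := by
        intro g g'; ext x; simp only [Pi.add_apply, ← sum_add_distrib]
        exact sum_congr rfl fun e _ => by split_ifs <;> simp
      map_smul' := by
        intro a g; ext x; simp only [Pi.smul_apply, smul_eq_mul, RingHom.id_apply, mul_sum]
        exact sum_congr rfl fun e _ => by split_ifs <;> simp }
  let tot : (verts C → ZMod 2) →ₗ[ZMod 2] ZMod 2 :=
    { toFun := fun g => ∑ x, g x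
      map_add' := by intro g g'; simp [sum_add_distrib]
      map_smul' := by intro a g; simp [mul_sum] }
  have hsum0 : LinearMap.range K ≤ LinearMap.ker tot := by
    rintro _ ⟨g, rfl⟩
    rw [LinearMap.mem_ker]
    change ∑ x : verts C, ∑ e : edges C, (if x.1 ∈ e.1 then g e else 0) = 0
    rw [sum_comm]
    refine sum_eq_zero fun e _ => ?_
    obtain ⟨h2, τ, hτ, hsub⟩ := mem_edges.1 e.2
    rw [← sum_filter, sum_const]
    have : #(univ.filter fun x : verts C => x.1 ∈ e.1) = 2 := by
      rw [← h2, ← card_map (Function.Embedding.subtype (· ∈ verts C))]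
      congr 1
      ext x
      simp only [mem_map, mem_filter, mem_univ, true_and, Function.Embedding.subtype_apply,
        Subtype.exists, exists_and_left, exists_prop, exists_eq_right_right]
      exact ⟨fun h => h.1, fun h => ⟨h, mem_verts.2 ⟨τ, hτ, hsub h⟩⟩⟩
    rw [this, two_nsmul]
    exact CharTwo.add_self_eq_zero _
  have hker : LinearMap.ker K ≤ LinearMap.range A := by
    intro g hg
    rw [LinearMap.mem_ker] at hg
    obtain ⟨C', hC', hbd⟩ := hbound (ext0 g)
      (fun e he => by by_contra h; simp [ext0, h] at he) (by
        ext x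
        rw [bdOne_apply]
        change _ = (0 : ZMod 2)
        have e1 : ∑ e ∈ univ.filter (x ∈ ·), ext0 g e =
            ∑ e ∈ edges C, if x ∈ e then ext0 g e else 0 := by
          rw [sum_filter]
          refine (sum_subset (subset_univ _) fun e _ he => ?_).symm
          simp [ext0, he]
        rw [e1, ← sum_coe_sort]
        by_cases hx : x ∈ verts C
        · have := congrFun hg ⟨x, hx⟩
          change (∑ e : edges C, if x ∈ e.1 then g e else 0) = 0 at this
          refine Eq.trans ?_ this
          refine sum_congr rfl fun e _ => ?_
          simp [ext0]
        · refine sum_eq_zero fun e _ => if_neg fun hxe => hx ?_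
          obtain ⟨h2, τ, hτ, hsub⟩ := mem_edges.1 e.2
          exact mem_verts.2 ⟨τ, hτ, hsub hxe⟩)
    refine ⟨fun τ => if τ.1 ∈ C' then 1 else 0, ?_⟩
    ext e
    have h2 := (mem_edges.1 e.2).1
    change (∑ τ : C, if e.1 ⊆ τ.1 then (if τ.1 ∈ C' then 1 else 0) else 0) = g e
    have := congrFun hbd e.1
    rw [bd_apply C' h2] at this
    simp only [ext0, coe_mem, dif_pos] at this
    rw [← this, sum_coe_sort C (fun τ => if e.1 ⊆ τ then (if τ ∈ C' then (1 : ZMod 2) else 0) else 0),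
      card_filter, Nat.cast_sum, ← sum_subset hC']
    · exact sum_congr rfl fun τ hτ => by simp [hτ]
    · intro τ _ hτ; simp [hτ]
  obtain ⟨τ₀, hτ₀⟩ := hne
  obtain ⟨x₀, hx₀⟩ : τ₀.Nonempty := card_pos.1 (by rw [h3 τ₀ hτ₀]; norm_num)
  have hx₀C : x₀ ∈ verts C := mem_verts.2 ⟨τ₀, hτ₀, hx₀⟩
  have hsurj : Function.Surjective tot := fun a => ⟨Pi.single ⟨x₀, hx₀C⟩ a, by
    change ∑ x, (Pi.single ⟨x₀, hx₀C⟩ a : verts C → ZMod 2) x = a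
    simp⟩
  -- `#(edges C)` is the rank plus the nullity of `K`. The rank is at most `#(verts C) - 1`, since
  -- the range lies in the kernel of the surjection `tot`; the nullity is at most the rank of `A`,
  -- hence at most `#C`.
  have r1 := LinearMap.finrank_range_add_finrank_ker K
  have r2 := LinearMap.finrank_range_add_finrank_ker tot
  have r3 := LinearMap.finrank_range_add_finrank_ker A
  have r4 := Submodule.finrank_mono hsum0
  have r5 := Submodule.finrank_mono hker
  rw [LinearMap.range_eq_top.2 hsurj, finrank_top] at r2
  simp only [Module.finrank_fintype_fun_eq_card, Fintype.card_coe, Module.finrank_self] at r1 r2 r3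
  omega

namespace IsFilledCycle

lemma two_ne_zero (h : IsFilledCycle D c C) : (1 + 1 : ZMod n) ≠ 0 := by
  intro h0
  have h2 : ((2 : ℕ) : ZMod n) = 0 := by push_cast; rw [← h0]; norm_num
  rw [ZMod.natCast_eq_zero_iff] at h2
  have := Nat.le_of_dvd (by norm_num) h2
  have := h.three_le
  omega

lemma edge_inj (h : IsFilledCycle D c C) {i k : ZMod n}
    (he : ({c i, c (i + 1)} : Finset W) = {c k, c (k + 1)}) : i = k := by
  have h1 : c i ∈ ({c k, c (k + 1)} : Finset W) := he ▸ mem_insert_self _ _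
  have h2 : c (i + 1) ∈ ({c k, c (k + 1)} : Finset W) :=
    he ▸ mem_insert_of_mem (mem_singleton_self _)
  simp only [mem_insert, mem_singleton, h.inj.eq_iff] at h1 h2
  rcases h1 with h1 | h1
  · exact h1
  rcases h2 with h2 | h2
  · exact absurd (show (1 + 1 : ZMod n) = 0 by
      rw [h1, add_assoc] at h2; simpa using h2) h.two_ne_zero
  · simpa using h2

lemma bd_cycle (h : IsFilledCycle D c C) (i : ZMod n) : bd C {c i, c (i + 1)} = 1 := by
  rw [h.bd_eq, Finset.sum_apply, Finset.sum_eq_single i]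
  · simp [edgeChain]
  · intro k _ hk
    rw [edgeChain, Pi.single_apply, if_neg fun he => hk (h.edge_inj he).symm]
  · simp

lemma bd_other (h : IsFilledCycle D c C) {e : Finset W} (he : ∀ i, e ≠ {c i, c (i + 1)}) :
    bd C e = 0 := by
  rw [h.bd_eq, Finset.sum_apply]
  exact sum_eq_zero fun i _ => by rw [edgeChain, Pi.single_apply, if_neg (he i)]

/-- The number is odd, because the boundary of `C` is `1` on this edge, and it is at most `2`. -/
lemma card_edgeTris_cycle (hD : IsDisc D) (h : IsFilledCycle D c C) (i : ZMod n) :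
    #(edgeTris C (c i) (c (i + 1))) = 1 := by
  have h1 := h.bd_cycle i
  rw [bd_pair C (h.adj i).1] at h1
  have h2 := hD.card_edgeTris_le_two (h.adj i).1
  have h3 := card_le_card (edgeTris_mono h.subset (c i) (c (i + 1)))
  have h4 : #(edgeTris C (c i) (c (i + 1))) ≤ 2 := h3.trans h2
  interval_cases #(edgeTris C (c i) (c (i + 1)))
  · exact absurd h1 (by decide)
  · rfl
  · exact absurd h1 (by decide)

/-- Off the cycle the number of triangles of `C` at an edge is even; being positive and at most `2`,
it exhausts the triangles of `D` there. This lets membership in `C` propagate across every edge not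
on the cycle. -/
lemma edgeTris_other (hD : IsDisc D) (h : IsFilledCycle D c C) {x y : W} (hxy : x ≠ y)
    (he : ∀ i, ({x, y} : Finset W) ≠ {c i, c (i + 1)}) {σ : Finset W}
    (hσ : σ ∈ edgeTris C x y) :
    edgeTris C x y = edgeTris (tris D) x y ∧ #(edgeTris C x y) = 2 := by
  have h1 := h.bd_other he
  rw [bd_pair C hxy, ZMod.natCast_eq_zero_iff] at h1
  have h2 := hD.card_edgeTris_le_two hxy
  have h3 := card_le_card (edgeTris_mono h.subset x y)
  have h4 : 0 < #(edgeTris C x y) := card_pos.2 ⟨σ, hσ⟩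
  exact ⟨eq_of_subset_of_card_le (edgeTris_mono h.subset x y) (by omega), by omega⟩

lemma nonempty (h : IsFilledCycle D c C) : C.Nonempty := by
  rw [nonempty_iff_ne_empty]
  rintro rfl
  have := h.bd_cycle 0
  rw [bd_empty, Pi.zero_apply] at this
  exact absurd this (by decide)

/-- A vertex of `C` off the cycle is an interior vertex all of whose triangles are in `C`. -/
lemma vertTris_off_cycle (hD : IsDisc D) (h : IsFilledCycle D c C) {x : W}
    (hx : x ∉ Set.range c) (hxC : x ∈ verts C) :
    IsInteriorVertex D x ∧ vertTris C x = vertTris (tris D) x := by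
  obtain ⟨σ, hσ, hxσ⟩ := mem_verts.1 hxC
  have off : ∀ y i, ({x, y} : Finset W) ≠ {c i, c (i + 1)} := by
    intro y i he
    have : x ∈ ({c i, c (i + 1)} : Finset W) := he ▸ mem_insert_self _ _
    simp only [mem_insert, mem_singleton] at this
    rcases this with e | e
    · exact hx ⟨i, e.symm⟩
    · exact hx ⟨i + 1, e.symm⟩
  have all : ∀ τ ∈ vertTris (tris D) x, τ ∈ C := by
    intro τ hτ
    refine hD.vertTris_closure x (· ∈ C) ?_ (mem_vertTris.2 ⟨h.subset hσ, hxσ⟩) hτ hσ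
    intro y ρ ρ' hy hρ hρ' hmem
    rw [← (h.edgeTris_other hD hy.symm (off y)
      (mem_edgeTris.2 ⟨hmem, (mem_edgeTris.1 hρ).2⟩)).1] at hρ'
    exact (mem_edgeTris.1 hρ').1
  constructor
  · rintro ⟨e, ⟨he, h2, τ, ⟨hτ, hsub⟩, huniq⟩, hxe⟩
    obtain ⟨y, hy, hyx⟩ := exists_mem_ne (show 1 < #e by omega) x
    have hτC := all τ (mem_vertTris.2 ⟨mem_tris.2 hτ, hsub hxe⟩)
    have hcard := (h.edgeTris_other hD hyx.symm (off y)
      (mem_edgeTris.2 ⟨hτC, hsub hxe, hsub hy⟩)).2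
    have hexy : e = {x, y} := (eq_of_subset_of_card_le (by simp [insert_subset_iff, hxe, hy])
      (by rw [card_pair hyx.symm, h2])).symm
    have : edgeTris C x y ⊆ {τ} := by
      intro ρ hρ
      rw [mem_edgeTris] at hρ
      rw [mem_singleton]
      exact huniq ρ ⟨mem_tris.1 (h.subset hρ.1), by rw [hexy]; simp [insert_subset_iff, hρ.2]⟩
    have := card_le_card this
    simp at this
    omega
  · ext τ
    refine ⟨fun hτ => ?_, fun hτ => mem_vertTris.2 ⟨all τ hτ, (mem_vertTris.1 hτ).2⟩⟩
    rw [mem_vertTris] at hτ ⊢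
    exact ⟨h.subset hτ.1, hτ.2⟩

/-- Only the two cycle edges at `c (i + 1)` can contribute, so a cycle supported on the edges of `c`
is constant along `c`. -/
lemma bdOne_at (h : IsFilledCycle D c C) {z : Finset W → ZMod 2}
    (hz : ∀ e, (∀ i, e ≠ {c i, c (i + 1)}) → z e = 0) (i : ZMod n) :
    bdOne z (c (i + 1)) = z {c i, c (i + 1)} + z {c (i + 1), c (i + 1 + 1)} := by
  rw [bdOne_apply, ← sum_pair (f := z)]
  · symm
    refine sum_subset ?_ ?_
    · intro e he
      simp only [mem_insert, mem_singleton] at he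
      rcases he with rfl | rfl <;> simp
    · intro e he hne
      refine hz e fun k hk => hne ?_
      subst hk
      simp only [mem_filter, mem_univ, true_and, mem_insert, mem_singleton,
        h.inj.eq_iff] at he ⊢
      rcases he with rfl | he
      · exact Or.inr rfl
      · rw [add_right_cancel he]; exact Or.inl rfl
  · intro he
    have := h.edge_inj he
    have h1 : (1 : ZMod n) = 0 := by simpa using this
    exact h.two_ne_zero (by rw [h1, add_zero])

/-- Every cycle in the closure of `C` bounds a subset of `C`. -/
lemma exists_subset_bd (hD : IsDisc D) (h : IsFilledCycle D c C) {z : Finset W → ZMod 2}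
    (hz : ∀ e, z e ≠ 0 → e ∈ edges C) (hbd : bdOne z = 0) : ∃ C' ⊆ C, bd C' = z := by
  obtain ⟨C₀, hC₀, rfl⟩ := hD.simplyConnected.mem_boundaries (z := z) (by
    intro e he
    obtain ⟨h2, τ, hτ, hsub⟩ := mem_edges.1 (hz e he)
    exact ⟨faces_of_subset (mem_tris.1 (h.subset hτ)).1 hsub (card_pos.1 (by omega)), h2⟩) hbd
  refine ⟨C₀, ?_, rfl⟩
  -- `R` is the part of the filling outside `C`; it must be shown empty. Its boundary is supported
  -- on the cycle `c` and is itself a cycle, so it is either zero or all of `c`.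
  set R := C₀ \ C with hR
  have hRt : R ⊆ tris D := sdiff_subset.trans hC₀
  have hsupp : ∀ e, (∀ i, e ≠ {c i, c (i + 1)}) → bd R e = 0 := by
    intro e he
    by_cases h2 : e.card = 2
    swap
    · exact bd_apply_of_card_ne R h2
    obtain ⟨x, y, hxy, rfl⟩ := card_eq_two.1 h2
    by_cases hmem : ({x, y} : Finset W) ∈ edges C
    · obtain ⟨-, σ, hσ, hsub⟩ := mem_edges.1 hmem
      have heq := (h.edgeTris_other hD hxy he (σ := σ)
        (mem_edgeTris.2 ⟨hσ, hsub (by simp), hsub (by simp)⟩)).1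
      rw [bd_pair R hxy]
      have : edgeTris R x y = ∅ := by
        rw [eq_empty_iff_forall_notMem]
        intro τ hτ
        have h1 : τ ∈ edgeTris C x y := heq ▸ edgeTris_mono hRt x y hτ
        exact (mem_sdiff.1 (mem_edgeTris.1 hτ).1).2 (mem_edgeTris.1 h1).1
      rw [this]; rfl
    · have h0 : bd C₀ {x, y} = 0 := by
        by_contra h0; exact hmem (hz _ h0)
      rw [← h0, bd_pair _ hxy, bd_pair _ hxy]
      congr 2
      ext τ
      simp only [mem_edgeTris, hR, mem_sdiff]
      refine ⟨fun hh => ⟨hh.1.1, hh.2⟩, fun hh => ⟨⟨hh.1, fun hτ => hmem ?_⟩, hh.2⟩⟩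
      exact mem_edges.2 ⟨h2, τ, hτ, by simp [insert_subset_iff, hh.2]⟩
  have hcyc : bdOne (bd R) = 0 := bdOne_bd fun τ hτ => (mem_tris.1 (hRt hτ)).2
  have hstep : ∀ i, bd R {c (i + 1), c (i + 1 + 1)} = bd R {c i, c (i + 1)} := by
    intro i
    have h1 := h.bdOne_at hsupp i
    rw [hcyc] at h1
    have : ∀ a b : ZMod 2, 0 = a + b → b = a := by decide
    exact this _ _ h1
  have hconst : ∀ i : ZMod n, bd R {c i, c (i + 1)} = bd R {c 0, c (0 + 1)} := by
    have : ∀ k : ℕ, bd R {c (k : ZMod n), c ((k : ZMod n) + 1)} = bd R {c 0, c (0 + 1)} := by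
      intro k
      induction k with
      | zero => simp
      | succ k ih => push_cast; rw [hstep, ih]
    intro i
    simpa using this i.val
  have h01 : ∀ a : ZMod 2, a = 0 ∨ a = 1 := by decide
  rcases h01 (bd R {c 0, c (0 + 1)}) with h0 | h1
  · have : bd R = 0 := by
      ext e
      by_cases he : ∀ i, e ≠ {c i, c (i + 1)}
      · exact hsupp e he
      · push Not at he
        obtain ⟨i, rfl⟩ := he
        rw [hconst, h0]; rfl
    exact sdiff_eq_empty_iff_subset.1 (hD.eq_empty_of_bd_eq_zero hRt this)
  -- If `R` bounded all of `c`, then `R` and `C` would be disjoint sets of triangles with the same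
  -- boundary, so their symmetric difference, and with it `C`, would be empty.
  · exfalso
    have : bd (symmDiff R C) = 0 := by
      have : bd R = bd C := by
        ext e
        by_cases he : ∀ i, e ≠ {c i, c (i + 1)}
        · rw [hsupp e he, h.bd_other he]
        · push Not at he
          obtain ⟨i, rfl⟩ := he
          rw [hconst, h1, h.bd_cycle]
      rw [bd_symmDiff, this, chain_add_self]
    have hempty := hD.eq_empty_of_bd_eq_zero (fun τ hτ => by
      rcases mem_symmDiff.1 hτ with hh | hh
      · exact hRt hh.1
      · exact h.subset hh.1) this
    obtain ⟨σ, hσ⟩ := h.nonempty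
    have : σ ∈ symmDiff R C := mem_symmDiff.2 (Or.inr ⟨hσ, fun hh => (mem_sdiff.1 hh).2 hσ⟩)
    simp [hempty] at this

/-- The combinatorial Gauss–Bonnet inequality for a cycle in a disc whose interior vertices have
degree at least `6`. -/
theorem gaussBonnet (hD : IsDisc D)
    (hdeg : ∀ x, IsInteriorVertex D x → 6 ≤ ((skeleton D).neighborSet x).ncard)
    (h : IsFilledCycle D c C) : ∑ i, #(vertTris C (c i)) + 6 ≤ 3 * n := by
  have h3 : ∀ τ ∈ C, τ.card = 3 := fun τ hτ => (mem_tris.1 (h.subset hτ)).2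
  have euler := card_edges_lt h.nonempty h3 fun z hz hbd => h.exists_subset_bd hD hz hbd
  have hvert : ∑ x ∈ verts C, #(vertTris C x) = 3 * #C := by
    have := sum_card_bipartiteAbove_eq_sum_card_bipartiteBelow (s := verts C)
      (t := C) (fun (y : W) (τ : Finset W) => y ∈ τ)
    simp only [bipartiteAbove, bipartiteBelow] at this
    refine this.trans ?_
    rw [mul_comm]
    refine sum_const_nat fun τ hτ => ?_
    rw [← h3 τ hτ]
    congr 1
    ext x
    simp only [mem_filter, and_iff_right_iff_imp]
    exact fun hx => mem_verts.2 ⟨τ, hτ, hx⟩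
  have hedge : ∑ e ∈ edges C, #(C.filter fun τ => e ⊆ τ) = 3 * #C := by
    have := sum_card_bipartiteAbove_eq_sum_card_bipartiteBelow (s := edges C)
      (t := C) (fun (e : Finset W) (τ : Finset W) => e ⊆ τ)
    simp only [bipartiteAbove, bipartiteBelow] at this
    refine this.trans ?_
    rw [mul_comm]
    refine sum_const_nat fun τ hτ => ?_
    have : (edges C).filter (fun e => e ⊆ τ) = powersetCard 2 τ := by
      ext e
      simp only [mem_filter, mem_powersetCard, mem_edges]
      exact ⟨fun hh => ⟨hh.2, hh.1.1⟩, fun hh => ⟨⟨hh.2, τ, hτ, hh.1⟩, hh.1⟩⟩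
    rw [this, card_powersetCard, h3 τ hτ]
    rfl
  set B : Finset (Finset W) := univ.image fun i : ZMod n => ({c i, c (i + 1)} : Finset W) with hB
  have hBcard : #B = n := by
    rw [hB, card_image_of_injective _ fun i k hik => h.edge_inj hik, card_univ, ZMod.card]
  have htri : ∀ {x y : W}, edgeTris C x y = C.filter fun τ => ({x, y} : Finset W) ⊆ τ := by
    intro x y; simp only [edgeTris, insert_subset_iff, singleton_subset_iff]
  have hBE : B ⊆ edges C := by
    intro e he
    simp only [hB, mem_image, mem_univ, true_and] at he
    obtain ⟨i, rfl⟩ := he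
    obtain ⟨σ, hσ⟩ := card_pos.1 (show 0 < #(edgeTris C (c i) (c (i + 1))) by
      rw [h.card_edgeTris_cycle hD]; norm_num)
    rw [htri, mem_filter] at hσ
    exact mem_edges.2 ⟨card_pair (h.adj i).1, σ, hσ⟩
  have hedge2 : ∑ e ∈ edges C, #(C.filter fun τ => e ⊆ τ) + n = 2 * #(edges C) := by
    rw [← sum_sdiff hBE]
    have s1 : ∑ e ∈ B, #(C.filter fun τ => e ⊆ τ) = #B * 1 := by
      refine sum_const_nat fun e he => ?_
      simp only [hB, mem_image, mem_univ, true_and] at he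
      obtain ⟨i, rfl⟩ := he
      rw [← htri, h.card_edgeTris_cycle hD]
    have s2 : ∑ e ∈ edges C \ B, #(C.filter fun τ => e ⊆ τ) = #(edges C \ B) * 2 := by
      refine sum_const_nat fun e he => ?_
      rw [mem_sdiff, mem_edges] at he
      obtain ⟨⟨h2, σ, hσ, hsub⟩, hnB⟩ := he
      obtain ⟨x, y, hxy, rfl⟩ := card_eq_two.1 h2
      rw [← htri]
      refine (h.edgeTris_other hD hxy (fun i hi => hnB ?_) (σ := σ) ?_).2
      · rw [hB, hi]; exact mem_image_of_mem _ (mem_univ i)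
      · rw [htri, mem_filter]; exact ⟨hσ, hsub⟩
    rw [s1, s2, card_sdiff_of_subset hBE, hBcard]
    have := card_le_card hBE
    omega
  set U : Finset W := univ.image c with hU
  have hUcard : #U = n := by rw [hU, card_image_of_injective _ h.inj, card_univ, ZMod.card]
  have hUV : U ⊆ verts C := by
    intro x hx
    simp only [hU, mem_image, mem_univ, true_and] at hx
    obtain ⟨i, rfl⟩ := hx
    obtain ⟨σ, hσ⟩ := card_pos.1 (show 0 < #(edgeTris C (c i) (c (i + 1))) by
      rw [h.card_edgeTris_cycle hD]; norm_num)
    rw [mem_edgeTris] at hσ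
    exact mem_verts.2 ⟨σ, hσ.1, hσ.2.1⟩
  have hv2 : ∑ i, #(vertTris C (c i)) + #(verts C \ U) * 6 ≤ ∑ x ∈ verts C, #(vertTris C x) := by
    rw [← sum_sdiff hUV, hU, sum_image fun i _ k _ hik => h.inj hik, ← hU, add_comm]
    refine Nat.add_le_add_right ?_ _
    rw [← smul_eq_mul]
    refine card_nsmul_le_sum _ _ _ fun x hx => ?_
    rw [mem_sdiff] at hx
    obtain ⟨hint, heq⟩ := h.vertTris_off_cycle hD (x := x) (fun ⟨i, hi⟩ => hx.2 (by
      rw [hU, ← hi]; exact mem_image_of_mem _ (mem_univ i))) hx.1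
    rw [heq, hD.card_vertTris_interior hint]
    exact hdeg x hint
  -- With `V`, `E`, `F` for the numbers of vertices, edges and triangles, and `Σ` for the sum over
  -- the cycle: `3F + n = 2E`, `Σ + 6(V - n) ≤ 3F` and `E + 1 ≤ V + F`. Eliminating `V`, `E`, `F`
  -- leaves `Σ + 6 ≤ 3n`.
  rw [card_sdiff_of_subset hUV, hUcard] at hv2
  have := card_le_card hUV
  omega

end IsFilledCycle

end GaussBonnet

/-! ### Corners of filled polygons and taut fillings -/

section Polygon

variable {W : Type*} [Fintype W] {D : AbstractSimplicialComplex W}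

namespace IsFilledCycle

variable {n : ℕ} [NeZero n] {c : ZMod n → W} {C : Finset (Finset W)}

lemma ne_add_two (h : IsFilledCycle D c C) (i : ZMod n) : c i ≠ c (i + 1 + 1) := by
  intro e
  have := h.inj e
  rw [add_assoc] at this
  exact h.two_ne_zero (by simpa using this)

lemma exists_edgeTris (hD : IsDisc D) (h : IsFilledCycle D c C) (i : ZMod n) :
    ∃ σ ∈ C, c i ∈ σ ∧ c (i + 1) ∈ σ := by
  obtain ⟨σ, hσ⟩ := card_pos.1 (show 0 < #(edgeTris C (c i) (c (i + 1))) by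
    rw [h.card_edgeTris_cycle hD]; norm_num)
  exact ⟨σ, mem_edgeTris.1 hσ⟩

/-- The triangles of `C` on the two cycle edges at the corner must then coincide. -/
lemma mem_of_card_vertTris_eq_one (hD : IsDisc D) (h : IsFilledCycle D c C) {i : ZMod n}
    (h1 : #(vertTris C (c (i + 1))) = 1) : {c i, c (i + 1), c (i + 1 + 1)} ∈ C := by
  obtain ⟨σ, hσ, hi, hi1⟩ := h.exists_edgeTris hD i
  obtain ⟨σ', hσ', hi1', hi2⟩ := h.exists_edgeTris hD (i + 1)
  obtain ⟨ρ, hρ⟩ := card_eq_one.1 h1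
  have e1 : σ ∈ vertTris C (c (i + 1)) := mem_vertTris.2 ⟨hσ, hi1⟩
  have e2 : σ' ∈ vertTris C (c (i + 1)) := mem_vertTris.2 ⟨hσ', hi1'⟩
  rw [hρ, mem_singleton] at e1 e2
  rw [e2, ← e1] at hi2
  have : ({c i, c (i + 1), c (i + 1 + 1)} : Finset W) = σ := by
    refine eq_of_subset_of_card_le (by simp [insert_subset_iff, hi, hi1, hi2]) ?_
    rw [card_triple (h.adj i).1 (h.ne_add_two i) (h.adj (i + 1)).1, (mem_tris.1 (h.subset hσ)).2]
  rwa [this]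

/-- Let `w` be the apex of the triangle on the first cycle edge. The side from `c (i + 1)` to `w` is
not a cycle edge, so both triangles at the corner contain it; one of them lies on the second cycle
edge. -/
lemma exists_of_card_vertTris_eq_two (hD : IsDisc D) (h : IsFilledCycle D c C) {i : ZMod n}
    (h2 : #(vertTris C (c (i + 1))) = 2) (hn : {c i, c (i + 1), c (i + 1 + 1)} ∉ C) :
    ∃ w, {c i, c (i + 1), w} ∈ C ∧ {c (i + 1), c (i + 1 + 1), w} ∈ C := by
  obtain ⟨σ, hσ, hi, hi1⟩ := h.exists_edgeTris hD i
  obtain ⟨σ', hσ', hi1', hi2⟩ := h.exists_edgeTris hD (i + 1)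
  obtain ⟨w, hwi, hwi1, rfl⟩ :=
    exists_eq_triple (mem_tris.1 (h.subset hσ)).2 hi hi1 (h.adj i).1
  refine ⟨w, hσ, ?_⟩
  have hw2 : w ≠ c (i + 1 + 1) := by rintro rfl; exact hn hσ
  have hoff : ∀ k, ({c (i + 1), w} : Finset W) ≠ {c k, c (k + 1)} := by
    intro k hk
    have m1 : c (i + 1) ∈ ({c k, c (k + 1)} : Finset W) := hk ▸ mem_insert_self _ _
    have m2 : w ∈ ({c k, c (k + 1)} : Finset W) :=
      hk ▸ mem_insert_of_mem (mem_singleton_self _)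
    simp only [mem_insert, mem_singleton, h.inj.eq_iff] at m1 m2
    rcases m1 with rfl | m1
    · rcases m2 with m2 | m2
      · exact hwi1 m2
      · exact hw2 m2
    · obtain rfl := add_right_cancel m1
      rcases m2 with m2 | m2
      · exact hwi m2
      · exact hwi1 m2
  have hcard := (h.edgeTris_other hD (Ne.symm hwi1) hoff
    (mem_edgeTris.2 ⟨hσ, by simp, by simp⟩)).2
  have heq : edgeTris C (c (i + 1)) w = vertTris C (c (i + 1)) := by
    refine eq_of_subset_of_card_le (fun τ hτ => ?_) (by omega)
    rw [mem_edgeTris] at hτ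
    exact mem_vertTris.2 ⟨hτ.1, hτ.2.1⟩
  have hmem : σ' ∈ edgeTris C (c (i + 1)) w := heq ▸ mem_vertTris.2 ⟨hσ', hi1'⟩
  have hw := (mem_edgeTris.1 hmem).2.2
  have : ({c (i + 1), c (i + 1 + 1), w} : Finset W) = σ' := by
    refine eq_of_subset_of_card_le (by simp [insert_subset_iff, hi1', hi2, hw]) ?_
    rw [card_triple (h.adj (i + 1)).1 (Ne.symm hwi1) hw2.symm, (mem_tris.1 (h.subset hσ')).2]
  rwa [this]

end IsFilledCycle

/-- A closed edge path of length `n`, parametrized by natural numbers. -/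
structure IsClosedPath (D : AbstractSimplicialComplex W) (n : ℕ) (c : ℕ → W) : Prop where
  closed : c n = c 0
  adj : ∀ i < n, (skeleton D).Adj (c i) (c (i + 1))

/-- A simple closed edge path with a filling, parametrized by natural numbers. -/
structure IsFilledPolygon (D : AbstractSimplicialComplex W) (n : ℕ) (c : ℕ → W)
    (C : Finset (Finset W)) : Prop extends IsClosedPath D n c where
  three_le : 3 ≤ n
  inj : ∀ i < n, ∀ k < n, c i = c k → i = k
  subset : C ⊆ tris D
  bd_eq : bd C = ∑ i ∈ range n, edgeChain (c i) (c (i + 1))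

/-- The boundary of the chain telescopes to zero, so simple connectivity provides a filling. -/
lemma IsClosedPath.exists_bd (hD : IsDisc D) {n : ℕ} {c : ℕ → W} (h : IsClosedPath D n c) :
    ∃ C ⊆ tris D, bd C = ∑ i ∈ range n, edgeChain (c i) (c (i + 1)) := by
  refine hD.simplyConnected.mem_boundaries ?_ ?_
  · intro e he
    rw [Finset.sum_apply] at he
    obtain ⟨i, hi, hne⟩ := exists_ne_zero_of_sum_ne_zero he
    rw [edgeChain, Pi.single_apply] at hne
    have : e = {c i, c (i + 1)} := by by_contra h'; simp [h'] at hne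
    have hadj := h.adj i (mem_range.1 hi)
    exact this ▸ ⟨hadj.2, card_pair hadj.1⟩
  · have key : ∀ m ≤ n, bdOne (∑ i ∈ range m, edgeChain (c i) (c (i + 1))) =
        Pi.single (c 0) 1 + Pi.single (c m) 1 := by
      intro m
      induction m with
      | zero => intro _; simp [chain_add_self]
      | succ m ih =>
        intro hm
        rw [sum_range_succ, map_add, ih (by omega), bdOne_edgeChain (h.adj m hm).1]
        have := chain_add_self (Pi.single (c m) 1 : W → ZMod 2)
        grind
    rw [key n le_rfl, h.closed, chain_add_self]

namespace IsFilledPolygon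

variable {n : ℕ} {c : ℕ → W} {C : Finset (Finset W)}

lemma sum_zmod {M : Type*} [AddCommMonoid M] [NeZero n] (f : ℕ → M) :
    ∑ i : ZMod n, f i.val = ∑ i ∈ range n, f i := by
  obtain ⟨m, rfl⟩ : ∃ m, n = m + 1 := ⟨n - 1, by have := NeZero.ne n; omega⟩
  exact Fin.sum_univ_eq_sum_range f (m + 1)

lemma apply_val_add_one [NeZero n] (h1 : 1 < n) (hc : c n = c 0) (i : ZMod n) :
    c (i + 1).val = c (i.val + 1) := by
  have hlt := ZMod.val_lt i
  have : Fact (1 < n) := ⟨h1⟩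
  rw [ZMod.val_add, ZMod.val_one]
  rcases Nat.lt_or_ge (i.val + 1) n with h | h
  · rw [Nat.mod_eq_of_lt h]
  · rw [show i.val + 1 = n by omega, Nat.mod_self, hc]

lemma toCycle [NeZero n] (h : IsFilledPolygon D n c C) :
    IsFilledCycle D (fun i : ZMod n => c i.val) C where
  three_le := h.three_le
  inj i k hik := ZMod.val_injective n (h.inj _ (ZMod.val_lt i) _ (ZMod.val_lt k) hik)
  adj i := by
    rw [apply_val_add_one (by have := h.three_le; omega) h.closed]
    exact h.adj _ (ZMod.val_lt i)
  subset := h.subset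
  bd_eq := by
    simp_rw [apply_val_add_one (by have := h.three_le; omega) h.closed]
    rw [h.bd_eq, sum_zmod fun i => edgeChain (c i) (c (i + 1))]

lemma gaussBonnet (hD : IsDisc D)
    (hdeg : ∀ x, IsInteriorVertex D x → 6 ≤ ((skeleton D).neighborSet x).ncard)
    (h : IsFilledPolygon D n c C) : ∑ i ∈ range n, #(vertTris C (c i)) + 6 ≤ 3 * n := by
  have : NeZero n := ⟨by have := h.three_le; omega⟩
  rw [← sum_zmod fun i => #(vertTris C (c i))]
  exact h.toCycle.gaussBonnet hD hdeg

lemma cast_vals [NeZero n] (h : IsFilledPolygon D n c C) {i : ℕ} (hi : i + 1 < n) :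
    c ((i : ZMod n).val) = c i ∧ c (((i : ZMod n) + 1).val) = c (i + 1) ∧
      c (((i : ZMod n) + 1 + 1).val) = c (i + 2) := by
  have h1 : 1 < n := by omega
  have e : ∀ k < n, (k : ZMod n).val = k := fun k hk => ZMod.val_cast_of_lt hk
  have e1 : ((i : ZMod n) + 1) = ((i + 1 : ℕ) : ZMod n) := by push_cast; rfl
  refine ⟨by rw [e i (by omega)], by rw [e1, e _ hi], ?_⟩
  rw [apply_val_add_one h1 h.closed, e1, e _ hi]

lemma one_le_card_vertTris (hD : IsDisc D) (h : IsFilledPolygon D n c C) {i : ℕ} (hi : i < n) :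
    1 ≤ #(vertTris C (c i)) := by
  have : NeZero n := ⟨by have := h.three_le; omega⟩
  obtain ⟨σ, hσ, h1, -⟩ := h.toCycle.exists_edgeTris hD (i : ZMod n)
  rw [ZMod.val_cast_of_lt hi] at h1
  exact card_pos.2 ⟨σ, mem_vertTris.2 ⟨hσ, h1⟩⟩

lemma mem_of_card_vertTris_eq_one (hD : IsDisc D) (h : IsFilledPolygon D n c C) {i : ℕ}
    (hi : i + 1 < n) (h1 : #(vertTris C (c (i + 1))) = 1) : {c i, c (i + 1), c (i + 2)} ∈ C := by
  have : NeZero n := ⟨by omega⟩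
  obtain ⟨e0, e1, e2⟩ := h.cast_vals hi
  have := h.toCycle.mem_of_card_vertTris_eq_one hD (i := (i : ZMod n)) (by rwa [e1])
  rwa [e0, e1, e2] at this

lemma exists_of_card_vertTris_eq_two (hD : IsDisc D) (h : IsFilledPolygon D n c C) {i : ℕ}
    (hi : i + 1 < n) (h2 : #(vertTris C (c (i + 1))) = 2)
    (hn : {c i, c (i + 1), c (i + 2)} ∉ C) :
    ∃ w, {c i, c (i + 1), w} ∈ C ∧ {c (i + 1), c (i + 2), w} ∈ C := by
  have : NeZero n := ⟨by omega⟩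
  obtain ⟨e0, e1, e2⟩ := h.cast_vals hi
  have := h.toCycle.exists_of_card_vertTris_eq_two hD (i := (i : ZMod n)) (by rwa [e1])
    (by rwa [e0, e1, e2])
  rwa [e0, e1, e2] at this

end IsFilledPolygon

/-- Moving one vertex to `w` changes the chain by the four sides of a quadrilateral, which is the
boundary of the two triangles that `exists_taut` removes. -/
lemma sum_update_chain (c : ℕ → W) (w : W) {n i : ℕ} (hi : i + 1 < n) :
    ∑ k ∈ range n, edgeChain (Function.update c (i + 1) w k) (Function.update c (i + 1) w (k + 1)) =
      ∑ k ∈ range n, edgeChain (c k) (c (k + 1)) +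
        (edgeChain (c i) (c (i + 1)) + edgeChain (c (i + 1)) (c (i + 2)) +
        (edgeChain (c i) w + edgeChain w (c (i + 2)))) := by
  have split : ∀ f : ℕ → Finset W → ZMod 2, ∑ k ∈ range n, f k =
      ∑ k ∈ (range n \ {i, i + 1}), f k + (f i + f (i + 1)) := by
    intro f
    rw [← sum_pair (show i ≠ i + 1 by omega), sum_sdiff]
    intro k hk
    simp only [mem_insert, mem_singleton] at hk
    rw [mem_range]; omega
  rw [split, split]
  have e : ∑ k ∈ range n \ {i, i + 1}, edgeChain (Function.update c (i + 1) w k)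
      (Function.update c (i + 1) w (k + 1)) =
      ∑ k ∈ range n \ {i, i + 1}, edgeChain (c k) (c (k + 1)) := by
    refine sum_congr rfl fun k hk => ?_
    simp only [mem_sdiff, mem_insert, mem_singleton, not_or] at hk
    rw [Function.update_of_ne (by omega), Function.update_of_ne (by omega)]
  rw [e]
  simp only [Function.update_self]
  rw [Function.update_of_ne (show i ≠ i + 1 by omega),
    Function.update_of_ne (show i + 1 + 1 ≠ i + 1 by omega)]
  have e1 := chain_add_self (edgeChain (c i) (c (i + 1)))
  have e2 := chain_add_self (edgeChain (c (i + 1)) (c (i + 2)))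
  rw [show i + 1 + 1 = i + 2 by omega]
  grind

/-- Among the closed paths that agree with `c₀` away from the movable indices `I` there is one with
a filling that cannot be reduced: it has at least three triangles at each movable vertex. -/
lemma exists_taut (hD : IsDisc D) {n : ℕ} (hn : 3 ≤ n) {c₀ : ℕ → W} (h₀ : IsClosedPath D n c₀)
    (I : ℕ → Prop) (hI : ∀ i, I i → 0 < i ∧ i < n)
    (hinj : ∀ c, IsClosedPath D n c → (∀ i, ¬ I i → c i = c₀ i) →
      ∀ i < n, ∀ k < n, c i = c k → i = k)
    (hnadj : ∀ c, IsClosedPath D n c → (∀ i, ¬ I i → c i = c₀ i) →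
      ∀ i, I (i + 1) → ¬ (skeleton D).Adj (c i) (c (i + 2))) :
    ∃ c C, IsFilledPolygon D n c C ∧ (∀ i, ¬ I i → c i = c₀ i) ∧
      ∀ i, I i → 3 ≤ #(vertTris C (c i)) := by
  -- Tautness is obtained from a filling with the fewest triangles, over all admissible paths at
  -- once. A movable vertex with one triangle contradicts `hnadj`; one with two triangles can be
  -- pushed across them to a smaller filling.
  let Q : ℕ → Prop := fun N => ∃ c C, IsFilledPolygon D n c C ∧ (∀ i, ¬ I i → c i = c₀ i) ∧ #C = N
  have hQ : ∃ N, Q N := by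
    obtain ⟨C, hC, hbd⟩ := h₀.exists_bd hD
    exact ⟨#C, c₀, C, ⟨h₀, hn, hinj c₀ h₀ fun _ _ => rfl, hC, hbd⟩, fun _ _ => rfl, rfl⟩
  obtain ⟨c, C, hc, hfix, hcard⟩ := Nat.find_spec hQ
  refine ⟨c, C, hc, hfix, fun i hi => ?_⟩
  obtain ⟨h0, hlt⟩ := hI i hi
  obtain ⟨i, rfl⟩ : ∃ k, i = k + 1 := ⟨i - 1, by omega⟩
  have hna := hnadj c hc.toIsClosedPath hfix i hi
  have hne : c i ≠ c (i + 2) := by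
    intro e
    rcases Nat.lt_or_ge (i + 2) n with h | h
    · have := hc.inj _ (by omega) _ h e; omega
    · have e2 : i + 2 = n := by omega
      rw [e2, hc.closed] at e
      have := hc.inj _ (by omega) _ (by omega) e; omega
  have hnC : {c i, c (i + 1), c (i + 2)} ∉ C := fun hmem => hna
    (adj_of_mem_face (mem_tris.1 (hc.subset hmem)).1 (by simp) (by simp) hne)
  have h1 := hc.one_le_card_vertTris hD hlt
  have h2 : #(vertTris C (c (i + 1))) ≠ 1 := fun h => hnC (hc.mem_of_card_vertTris_eq_one hD hlt h)
  by_contra hlt3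
  obtain ⟨w, hw1, hw2⟩ := hc.exists_of_card_vertTris_eq_two hD hlt (by omega) hnC
  have a1 := hc.adj i (by omega)
  have a2 := hc.adj (i + 1) hlt
  have t1 := mem_tris.1 (hc.subset hw1)
  have t2 := mem_tris.1 (hc.subset hw2)
  have nw0 : c i ≠ w := by
    intro e
    rw [← e, show ({c i, c (i + 1), c i} : Finset W) = {c i, c (i + 1)} by grind] at t1
    have := card_le_two (a := c i) (b := c (i + 1)); omega
  have nw1 : c (i + 1) ≠ w := by
    intro e
    rw [← e, pair_eq_singleton] at t1
    have := card_le_two (a := c i) (b := c (i + 1)); omega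
  have nw2 : c (i + 2) ≠ w := by
    intro e
    rw [← e, pair_eq_singleton] at t2
    have := card_le_two (a := c (i + 1)) (b := c (i + 2)); omega
  have b1 : (skeleton D).Adj (c i) w := adj_of_mem_face t1.1 (by simp) (by simp) nw0
  have b2 : (skeleton D).Adj w (c (i + 2)) := adj_of_mem_face t2.1 (by simp) (by simp) nw2.symm
  set c' := Function.update c (i + 1) w with hc'
  have hself : c' (i + 1) = w := Function.update_self ..
  have hof : ∀ k, k ≠ i + 1 → c' k = c k := fun k hk => Function.update_of_ne hk ..
  have hpath : IsClosedPath D n c' := by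
    refine ⟨by rw [hof n (by omega), hof 0 (by omega), hc.closed], fun k hk => ?_⟩
    by_cases hk1 : k = i
    · subst hk1; rw [hself, hof _ (by omega)]; exact b1
    by_cases hk2 : k = i + 1
    · subst hk2; rw [hself, hof _ (by omega)]; exact b2
    · rw [hof _ hk2, hof _ (by omega)]; exact hc.adj k hk
  have hfix' : ∀ k, ¬ I k → c' k = c₀ k := by
    intro k hk
    rw [hof k (by rintro rfl; exact hk hi), hfix k hk]
  set σ : Finset W := {c i, c (i + 1), w} with hσ
  set τ : Finset W := {c (i + 1), c (i + 2), w} with hτ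
  have hστ : σ ≠ τ := by
    intro e
    have : c i ∈ τ := e ▸ (by simp [hσ])
    simp only [hτ, mem_insert, mem_singleton] at this
    rcases this with h | h | h
    · exact a1.1 h
    · exact hne h
    · exact nw0 h
  have hsub : ({σ, τ} : Finset (Finset W)) ⊆ C := by
    intro ρ hρ
    rw [mem_insert, mem_singleton] at hρ
    rcases hρ with rfl | rfl
    · exact hw1
    · exact hw2
  have hbdpair : bd {σ, τ} = bd {σ} + bd {τ} := by
    rw [bd, sum_pair hστ]; simp [bd]
  have hbd : bd (C \ {σ, τ}) = ∑ k ∈ range n, edgeChain (c' k) (c' (k + 1)) := by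
    have e1 : bd (C \ {σ, τ}) + bd {σ, τ} = bd C := sum_sdiff hsub
    have e2 : bd (C \ {σ, τ}) = bd C + bd {σ, τ} := by
      rw [← e1, add_assoc, chain_add_self, add_zero]
    rw [e2, hbdpair, hc.bd_eq, hc', sum_update_chain c w hlt, hσ, hτ, bd_singleton a1.1 nw0 nw1,
      bd_singleton a2.1 nw1 nw2, edgeChain_comm w (c (i + 2))]
    have := chain_add_self (edgeChain (c (i + 1)) w)
    rw [show i + 1 + 1 = i + 2 by omega]
    grind
  have hlt' : #(C \ {σ, τ}) < Nat.find hQ := by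
    rw [← hcard, card_sdiff_of_subset hsub, card_pair hστ]
    have := card_le_card hsub
    rw [card_pair hστ] at this
    omega
  exact Nat.find_min hQ hlt' ⟨c', C \ {σ, τ}, ⟨hpath, hn, hinj c' hpath hfix',
    sdiff_subset.trans hc.subset, hbd⟩, hfix', rfl⟩

end Polygon

/-! ### Geodesic bigons and the local shape of balls -/

section Geodesic

variable {W : Type*} [Fintype W] {D : AbstractSimplicialComplex W}

lemma exists_geodesic (hD : (skeleton D).Connected) (z x : W) :
    ∃ p : ℕ → W, p 0 = z ∧ p ((skeleton D).dist z x) = x ∧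
      ∀ i < (skeleton D).dist z x, (skeleton D).Adj (p i) (p (i + 1)) := by
  obtain ⟨p, hp⟩ := hD.exists_walk_length_eq_dist z x
  refine ⟨p.getVert, p.getVert_zero, ?_, fun i hi => p.adj_getVert_succ (by omega)⟩
  rw [← hp, p.getVert_length]

lemma dist_le_of_path (hD : (skeleton D).Connected) {c : ℕ → W} {n : ℕ}
    (h : ∀ i < n, (skeleton D).Adj (c i) (c (i + 1))) {k l : ℕ} (hkl : k ≤ l) (hl : l ≤ n) :
    (skeleton D).dist (c k) (c l) ≤ l - k := by
  induction l, hkl using Nat.le_induction with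
  | base => simp
  | succ l hkl ih =>
    have h1 := ih (by omega)
    have h2 := hD.dist_triangle (u := c k) (v := c l) (w := c (l + 1))
    rw [SimpleGraph.dist_eq_one_iff_adj.2 (h l (by omega))] at h2
    omega

lemma dist_le_dist_add_one (hD : (skeleton D).Connected) {v x y : W}
    (h : (skeleton D).Adj x y) : (skeleton D).dist v y ≤ (skeleton D).dist v x + 1 := by
  have h2 := hD.dist_triangle (u := v) (v := x) (w := y)
  rwa [SimpleGraph.dist_eq_one_iff_adj.2 h] at h2

lemma exists_lower (hD : (skeleton D).Connected) {v x : W} {k : ℕ}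
    (hx : (skeleton D).dist v x = k + 1) :
    ∃ z, (skeleton D).Adj x z ∧ (skeleton D).dist v z = k := by
  obtain ⟨p, h0, h1, hp⟩ := exists_geodesic hD v x
  rw [hx] at h1 hp
  have hadj := hp k (by omega)
  rw [h1] at hadj
  refine ⟨p k, hadj.symm, ?_⟩
  have h2 := dist_le_of_path hD hp (show 0 ≤ k by omega) (by omega)
  have h3 := dist_le_dist_add_one hD (v := v) hadj
  rw [h0] at h2
  omega

/-- Two geodesics from `v` to vertices `a ≠ b` at the same distance from `v`, with `a` and `b`
joined by an edge (`δ = 1`) or by a path of length two through a vertex further away (`δ = 2`):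
after removing their common part they can be chosen so that the filling of the resulting polygon
is not reducible along the geodesics. -/
lemma exists_taut_bigon (hD : IsDisc D) {v a b x : W} {k δ : ℕ}
    (ha : (skeleton D).dist v a = k) (hb : (skeleton D).dist v b = k) (hab : a ≠ b)
    (hδ : (δ = 1 ∧ (skeleton D).Adj a b) ∨ (δ = 2 ∧ (skeleton D).Adj a x ∧ (skeleton D).Adj x b ∧
      (skeleton D).dist v x = k + 1)) :
    ∃ j m c C, j + m = k ∧ 0 < m ∧ IsFilledPolygon D (2 * m + δ) c C ∧ c m = a ∧ c (m + δ) = b ∧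
      (∀ i, m < i → i < m + δ → c i = x) ∧
      (∀ i ≤ m, (skeleton D).dist v (c i) = j + i) ∧
      (∀ i, m + δ ≤ i → i ≤ 2 * m + δ → (skeleton D).dist v (c i) = j + (2 * m + δ - i)) ∧
      (∀ i, 0 < i → i < m → 3 ≤ #(vertTris C (c i))) ∧
      (∀ i, m + δ < i → i < 2 * m + δ → 3 ≤ #(vertTris C (c i))) ∧
      (∀ z i, 0 < i → i ≤ m → (skeleton D).dist v z = j + i → (skeleton D).dist z a ≤ m - i →
        (skeleton D).dist z b ≤ m - i → False) := by
  have hconn := hD.simplyConnected.connected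
  -- Level `i` qualifies if some vertex there lies on geodesics from `v` to both `a` and `b`. The
  -- bigon branches at a vertex of the greatest such level `j`, and its two sides have length `m = k
  -- - j`.
  let Q : ℕ → Prop := fun i => ∃ z, (skeleton D).dist v z = i ∧
    (skeleton D).dist z a ≤ k - i ∧ (skeleton D).dist z b ≤ k - i
  have hQ0 : Q 0 := ⟨v, by simp, by omega, by omega⟩
  set j := Nat.findGreatest Q k with hj
  have hjk : j ≤ k := Nat.findGreatest_le k
  obtain ⟨z₀, hz₀, hza, hzb⟩ := Nat.findGreatest_spec (P := Q) (Nat.zero_le k) hQ0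
  rw [← hj] at hz₀ hza hzb
  have hmaxQ : ∀ i, j < i → i ≤ k → ¬ Q i := fun i h1 h2 => Nat.findGreatest_is_greatest h1 h2
  obtain ⟨m, hm⟩ : ∃ m, j + m = k := ⟨k - j, by omega⟩
  have hza' : (skeleton D).dist z₀ a = m := by
    have := hconn.dist_triangle (u := v) (v := z₀) (w := a); omega
  have hzb' : (skeleton D).dist z₀ b = m := by
    have := hconn.dist_triangle (u := v) (v := z₀) (w := b); omega
  have hm0 : 0 < m := by
    rcases Nat.eq_zero_or_pos m with h | h
    · rw [h, hconn.dist_eq_zero_iff] at hza' hzb'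
      exact absurd (hza'.symm.trans hzb') hab
    · exact h
  have hmax : ∀ z i, 0 < i → i ≤ m → (skeleton D).dist v z = j + i →
      (skeleton D).dist z a ≤ m - i → (skeleton D).dist z b ≤ m - i → False := by
    intro z i h0 hi h1 h2 h3
    exact hmaxQ (j + i) (by omega) (by omega) ⟨z, h1, by omega, by omega⟩
  have hδ1 : 1 ≤ δ ∧ δ ≤ 2 := by omega
  obtain ⟨p, p0, pm, hp⟩ := exists_geodesic hconn z₀ a
  obtain ⟨q, q0, qm, hq⟩ := exists_geodesic hconn z₀ b
  rw [hza'] at pm hp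
  rw [hzb'] at qm hq
  set n := 2 * m + δ with hn
  -- Up one geodesic from `z₀` to `a`, across to `b` (through `x` when `δ = 2`), and down the other
  -- geodesic to `z₀`.
  let c₀ : ℕ → W := fun i => if i ≤ m then p i else if i < m + δ then x else q (n - i)
  have c1 : ∀ i ≤ m, c₀ i = p i := fun i hi => by simp [c₀, hi]
  have c2 : ∀ i, m < i → i < m + δ → c₀ i = x := fun i hi hi' => by simp [c₀, hi.not_ge, hi']
  have c3 : ∀ i, m + δ ≤ i → c₀ i = q (n - i) := fun i hi => by
    have : ¬ i ≤ m := by omega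
    simp [c₀, this, hi.not_gt]
  have h₀ : IsClosedPath D n c₀ := by
    refine ⟨by rw [c1 0 (by omega), c3 n (by omega), Nat.sub_self, p0, q0], fun i hi => ?_⟩
    rcases Nat.lt_or_ge i m with h | h
    · rw [c1 i (by omega), c1 (i + 1) (by omega)]; exact hp i h
    rcases Nat.lt_or_ge i (m + δ) with h' | h'
    · rcases hδ with ⟨rfl, hadj⟩ | ⟨rfl, hax, hxb, -⟩
      · obtain rfl : i = m := by omega
        rw [c1 i le_rfl, c3 (i + 1) le_rfl, pm, show n - (i + 1) = i by omega, qm]; exact hadj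
      · rcases Nat.eq_or_lt_of_le h with rfl | h''
        · rw [c1 m le_rfl, c2 (m + 1) (by omega) (by omega), pm]; exact hax
        · obtain rfl : i = m + 1 := by omega
          rw [c2 (m + 1) (by omega) (by omega), c3 (m + 1 + 1) (by omega),
            show n - (m + 1 + 1) = m by omega, qm]
          exact hxb
    · rw [c3 i h', c3 (i + 1) (by omega)]
      have := hq (n - (i + 1)) (by omega)
      rw [show n - (i + 1) + 1 = n - i by omega] at this
      exact this.symm
  let I : ℕ → Prop := fun i => (0 < i ∧ i < m) ∨ (m + δ < i ∧ i < n)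
  have fix : ∀ c : ℕ → W, (∀ i, ¬ I i → c i = c₀ i) → c 0 = z₀ ∧ c n = z₀ ∧ c m = a ∧ c (m + δ) = b ∧
      (∀ i, m < i → i < m + δ → c i = x) := by
    intro c hc
    refine ⟨?_, ?_, ?_, ?_, fun i h1 h2 => ?_⟩
    · rw [hc 0 (by simp only [I]; omega), c1 0 (by omega), p0]
    · rw [hc n (by simp only [I]; omega), c3 n (by omega), Nat.sub_self, q0]
    · rw [hc m (by simp only [I]; omega), c1 m le_rfl, pm]
    · rw [hc (m + δ) (by simp only [I]; omega), c3 _ le_rfl, show n - (m + δ) = m by omega, qm]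
    · rw [hc i (by simp only [I]; omega), c2 i h1 h2]
  -- The side has exactly as many edges as the distance between its fixed ends, so the levels of its
  -- vertices cannot change when the path does.
  have lev1 : ∀ c, IsClosedPath D n c → (∀ i, ¬ I i → c i = c₀ i) →
      ∀ i ≤ m, (skeleton D).dist v (c i) = j + i := by
    intro c hc hfix i hi
    obtain ⟨f0, fn, fm, fb, -⟩ := fix c hfix
    have d1 := dist_le_of_path hconn hc.adj (show 0 ≤ i by omega) (by omega)
    have d2 := dist_le_of_path hconn hc.adj hi (by omega)
    have t1 := hconn.dist_triangle (u := v) (v := z₀) (w := c i)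
    have t2 := hconn.dist_triangle (u := v) (v := c i) (w := a)
    rw [f0] at d1
    rw [fm] at d2
    omega
  have lev2 : ∀ c, IsClosedPath D n c → (∀ i, ¬ I i → c i = c₀ i) →
      ∀ i, m + δ ≤ i → i ≤ n → (skeleton D).dist v (c i) = j + (n - i) := by
    intro c hc hfix i hi hi'
    obtain ⟨f0, fn, fm, fb, -⟩ := fix c hfix
    have d1 := dist_le_of_path hconn hc.adj hi' le_rfl
    have d2 := dist_le_of_path hconn hc.adj hi hi'
    have t1 := hconn.dist_triangle (u := v) (v := z₀) (w := c i)
    have t2 := hconn.dist_triangle (u := v) (v := c i) (w := b)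
    rw [fn, SimpleGraph.dist_comm] at d1
    rw [fb, SimpleGraph.dist_comm] at d2
    omega
  have inj : ∀ c, IsClosedPath D n c → (∀ i, ¬ I i → c i = c₀ i) →
      ∀ i < n, ∀ l < n, i < l → c i ≠ c l := by
    intro c hc hfix i hi l hl hil e
    obtain ⟨f0, fn, fm, fb, fx⟩ := fix c hfix
    have l1 := lev1 c hc hfix
    have l2 := lev2 c hc hfix
    have lx : ∀ i, m < i → i < m + δ → (skeleton D).dist v (c i) = k + 1 := by
      intro i h1 h2
      rw [fx i h1 h2]
      rcases hδ with h | h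
      · omega
      · exact h.2.2.2
    have e' := congrArg ((skeleton D).dist v) e
    rcases Nat.lt_or_ge m i with h1 | h1
    · rcases Nat.lt_or_ge i (m + δ) with h2 | h2
      · rcases Nat.lt_or_ge l (m + δ) with h3 | h3
        · omega
        · rw [lx i h1 h2, l2 l h3 hl.le] at e'; omega
      · rw [l2 i h2 hi.le, l2 l (by omega) hl.le] at e'; omega
    · rcases Nat.lt_or_ge m l with h2 | h2
      · rcases Nat.lt_or_ge l (m + δ) with h3 | h3
        · rw [l1 i h1, lx l h2 h3] at e'; omega
        · rw [l1 i h1, l2 l h3 hl.le] at e'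
          have d1 := dist_le_of_path hconn hc.adj h1 (by omega)
          have d2 := dist_le_of_path hconn hc.adj h3 hl.le
          rw [fm] at d1
          rw [fb, SimpleGraph.dist_comm, ← e] at d2
          -- A vertex common to the two sides would lie on geodesics to both `a` and `b` beyond the
          -- branch vertex, against the choice of `j`.
          exact hmax (c i) i (by omega) h1 (l1 i h1) d1 (by omega)
      · rw [l1 i h1, l1 l h2] at e'; omega
  obtain ⟨c, C, hc, hfix, htri⟩ := exists_taut hD (n := n) (by omega) h₀ I
    (fun i hi => by simp only [I] at hi; omega)
    (fun c hc hfix i hi l hl e => by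
      rcases Nat.lt_trichotomy i l with h | h | h
      · exact absurd e (inj c hc hfix i hi l hl h)
      · exact h
      · exact absurd e.symm (inj c hc hfix l hl i hi h))
    (fun c hc hfix i hi hadj => by
      have g1 := dist_le_dist_add_one hconn (v := v) hadj
      have g2 := dist_le_dist_add_one hconn (v := v) hadj.symm
      simp only [I] at hi
      rcases hi with hi | hi
      · rw [lev1 c hc hfix i (by omega), lev1 c hc hfix (i + 2) (by omega)] at g1
        omega
      · rw [lev2 c hc hfix i (by omega) (by omega),
          lev2 c hc hfix (i + 2) (by omega) (by omega)] at g2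
        omega)
  obtain ⟨f0, fn, fm, fb, fx⟩ := fix c hfix
  exact ⟨j, m, c, C, hm, hm0, hc, fm, fb, fx, lev1 c hc.toIsClosedPath hfix,
    lev2 c hc.toIsClosedPath hfix, fun i h1 h2 => htri i (Or.inl ⟨h1, h2⟩),
    fun i h1 h2 => htri i (Or.inr ⟨h1, h2⟩), hmax⟩

/-- The branch vertex counts at least `1`, the `2(m - 1)` inner vertices of the sides at least `3`
each, and `g` bounds the `δ + 1` vertices at the far end. Gauss–Bonnet caps the total at `3(2m + δ)
- 6`. -/
lemma sum_lower_bound {m δ : ℕ} (hm : 0 < m) (f g : ℕ → ℕ) (h0 : 1 ≤ f 0)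
    (h1 : ∀ i, 0 < i → i < m → 3 ≤ f i) (h2 : ∀ i, m + δ < i → i < 2 * m + δ → 3 ≤ f i)
    (hg : ∀ i ≤ δ, g i ≤ f (m + i)) :
    1 + 6 * (m - 1) + ∑ i ∈ range (δ + 1), g i ≤ ∑ i ∈ range (2 * m + δ), f i := by
  obtain ⟨m, rfl⟩ : ∃ l, m = l + 1 := ⟨m - 1, by omega⟩
  have e : ∑ i ∈ range (2 * (m + 1) + δ), f i = f 0 + ∑ i ∈ range m, f (i + 1) +
      ∑ i ∈ range (δ + 1), f (m + 1 + i) + ∑ i ∈ range m, f (m + 1 + (δ + 1) + i) := by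
    rw [show 2 * (m + 1) + δ = m + 1 + (δ + 1) + m by omega, sum_range_add, sum_range_add,
      sum_range_succ', add_comm (f 0)]
  rw [e]
  have s1 : m * 3 ≤ ∑ i ∈ range m, f (i + 1) := by
    have := card_nsmul_le_sum (range m) (fun i => f (i + 1)) 3
      (fun i hi => h1 _ (by omega) (by rw [mem_range] at hi; omega))
    simpa using this
  have s2 : m * 3 ≤ ∑ i ∈ range m, f (m + 1 + (δ + 1) + i) := by
    have := card_nsmul_le_sum (range m) (fun i => f (m + 1 + (δ + 1) + i)) 3
      (fun i hi => h2 _ (by omega) (by rw [mem_range] at hi; omega))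
    simpa using this
  have s3 : ∑ i ∈ range (δ + 1), g i ≤ ∑ i ∈ range (δ + 1), f (m + 1 + i) :=
    sum_le_sum fun i hi => hg i (by rw [mem_range] at hi; omega)
  omega

/-- Adjacent vertices at the same distance from `v` have a common neighbour closer to `v`. -/
theorem exists_common_lower (hD : IsDisc D)
    (hdeg : ∀ x, IsInteriorVertex D x → 6 ≤ ((skeleton D).neighborSet x).ncard)
    {v x y : W} {k : ℕ} (hx : (skeleton D).dist v x = k + 1)
    (hy : (skeleton D).dist v y = k + 1) (hxy : (skeleton D).Adj x y) :
    ∃ z, (skeleton D).dist v z = k ∧ (skeleton D).Adj z x ∧ (skeleton D).Adj z y := by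
  have hconn := hD.simplyConnected.connected
  obtain ⟨j, m, c, C, hjm, hm, hc, hca, hcb, -, l1, l2, t1, t2, hmax⟩ :=
    exists_taut_bigon hD (x := x) hx hy hxy.1 (Or.inl ⟨rfl, hxy⟩)
  rcases Nat.eq_or_lt_of_le (show 1 ≤ m from hm) with rfl | hm2
  · have a0 := hc.adj 0 (by omega)
    have a2 := hc.adj 2 (by omega)
    rw [zero_add, hca] at a0
    rw [show (2 : ℕ) + 1 = 2 * 1 + 1 by norm_num, hc.closed, show (2 : ℕ) = 1 + 1 by norm_num,
      hcb] at a2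
    exact ⟨c 0, by rw [l1 0 (by omega)]; omega, a0, a2.symm⟩
  exfalso
  have gb := hc.gaussBonnet hD hdeg
  -- A single triangle at `x` would make the preceding vertex of the side a common lower neighbour
  -- of `x` and `y` beyond the branch vertex.
  have hx2 : 2 ≤ #(vertTris C (c m)) := by
    have h1 := hc.one_le_card_vertTris hD (show m < 2 * m + 1 by omega)
    by_contra hlt
    obtain ⟨l, rfl⟩ : ∃ l, m = l + 1 := ⟨m - 1, by omega⟩
    have hmem := hc.mem_of_card_vertTris_eq_one hD (i := l) (by omega) (by omega)
    have hl := l1 l (by omega)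
    have hface := (mem_tris.1 (hc.subset hmem)).1
    rw [show l + 2 = l + 1 + 1 by omega, hca, hcb] at hface
    have n1 : c l ≠ x := fun e => by rw [e] at hl; omega
    have n2 : c l ≠ y := fun e => by rw [e] at hl; omega
    refine hmax (c l) l (by omega) (by omega) hl ?_ ?_ <;>
      rw [SimpleGraph.dist_eq_one_iff_adj.2 (adj_of_mem_face hface (by simp) (by simp) ‹_›)] <;>
      omega
  have hy2 : 2 ≤ #(vertTris C (c (m + 1))) := by
    have h1 := hc.one_le_card_vertTris hD (show m + 1 < 2 * m + 1 by omega)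
    by_contra hlt
    have hmem := hc.mem_of_card_vertTris_eq_one hD (i := m) (by omega) (by omega)
    have hl := l2 (m + 2) (by omega) (by omega)
    have hface := (mem_tris.1 (hc.subset hmem)).1
    rw [hca, hcb] at hface
    have n1 : c (m + 2) ≠ x := fun e => by rw [e] at hl; omega
    have n2 : c (m + 2) ≠ y := fun e => by rw [e] at hl; omega
    refine hmax (c (m + 2)) (m - 1) (by omega) (by omega) (by rw [hl]; congr 1; omega) ?_ ?_ <;>
      rw [SimpleGraph.dist_eq_one_iff_adj.2 (adj_of_mem_face hface (by simp) (by simp) ‹_›)] <;>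
      omega
  -- The total is at least `1 + 6(m - 1) + 4 = 6m - 1`, while Gauss–Bonnet allows only `6m - 3`.
  have := sum_lower_bound (δ := 1) hm (fun i => #(vertTris C (c i))) (fun _ => 2)
    (hc.one_le_card_vertTris hD (by omega)) t1 t2 (by
      intro i hi
      interval_cases i
      · exact hx2
      · exact hy2)
  simp at this
  omega

/-- Two neighbours of `x` closer to `v` span a triangle with `x`. -/
theorem lower_triangle (hD : IsDisc D)
    (hdeg : ∀ x, IsInteriorVertex D x → 6 ≤ ((skeleton D).neighborSet x).ncard)
    {v a b x : W} {k : ℕ} (hx : (skeleton D).dist v x = k + 1)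
    (ha : (skeleton D).dist v a = k) (hb : (skeleton D).dist v b = k) (hab : a ≠ b)
    (hxa : (skeleton D).Adj x a) (hxb : (skeleton D).Adj x b) : {x, a, b} ∈ tris D := by
  have hconn := hD.simplyConnected.connected
  obtain ⟨j, m, c, C, hjm, hm, hc, hca, hcb, hcx, l1, l2, t1, t2, hmax⟩ :=
    exists_taut_bigon hD (x := x) ha hb hab (Or.inr ⟨rfl, hxa.symm, hxb, hx⟩)
  have gb := hc.gaussBonnet hD hdeg
  have hcx := hcx (m + 1) (by omega) (by omega)
  have nadj : ∀ y z : W, (skeleton D).dist v y + 2 ≤ (skeleton D).dist v z →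
      ∀ τ ∈ C, y ∈ τ → z ∈ τ → False := by
    intro y z hyz τ hmem hy hz
    have := dist_le_dist_add_one hconn (v := v) (adj_of_mem_face
      (mem_tris.1 (hc.subset hmem)).1 hy hz (by rintro rfl; omega))
    omega
  -- A single triangle at `a` would contain both `x` and the preceding vertex of the side, which are
  -- two levels apart.
  have ha2 : 2 ≤ #(vertTris C (c m)) := by
    have h1 := hc.one_le_card_vertTris hD (show m < 2 * m + 2 by omega)
    by_contra hlt
    obtain ⟨l, rfl⟩ : ∃ l, m = l + 1 := ⟨m - 1, by omega⟩
    have hmem := hc.mem_of_card_vertTris_eq_one hD (i := l) (by omega) (by omega)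
    have hl := l1 l (by omega)
    rw [show l + 2 = l + 1 + 1 by omega, hcx] at hmem
    exact nadj (c l) x (by omega) _ hmem (by simp) (by simp)
  have hb2 : 2 ≤ #(vertTris C (c (m + 2))) := by
    have h1 := hc.one_le_card_vertTris hD (show m + 2 < 2 * m + 2 by omega)
    by_contra hlt
    have hmem := hc.mem_of_card_vertTris_eq_one hD (i := m + 1) (by omega) (by
      rw [show m + 1 + 1 = m + 2 by omega]; omega)
    have hl := l2 (m + 1 + 2) (by omega) (by omega)
    rw [hcx] at hmem
    exact nadj (c (m + 1 + 2)) x (by omega) _ hmem (by simp) (by simp)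
  -- Two triangles at `x` would bring the total to `6m + 1`, one more than Gauss–Bonnet allows.
  have hx1 : #(vertTris C (c (m + 1))) = 1 := by
    have h1 := hc.one_le_card_vertTris hD (show m + 1 < 2 * m + 2 by omega)
    by_contra hne
    have := sum_lower_bound (δ := 2) hm (fun i => #(vertTris C (c i))) (fun _ => 2)
      (hc.one_le_card_vertTris hD (by omega)) t1 t2 (by
        intro i hi
        interval_cases i
        · exact ha2
        · omega
        · exact hb2)
    simp at this
    omega
  have hmem := hc.subset (hc.mem_of_card_vertTris_eq_one hD (by omega) hx1)
  rw [hca, hcx, hcb] at hmem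
  rwa [insert_comm]

/-- Three pairwise adjacent vertices span a triangle. -/
theorem clique_triangle (hD : IsDisc D)
    (hdeg : ∀ x, IsInteriorVertex D x → 6 ≤ ((skeleton D).neighborSet x).ncard)
    {x y z : W} (hxy : (skeleton D).Adj x y) (hxz : (skeleton D).Adj x z)
    (hyz : (skeleton D).Adj y z) : {x, y, z} ∈ tris D := by
  let c : ℕ → W := fun i => if i = 1 then y else if i = 2 then z else x
  have c0 : c 0 = x := rfl
  have c1 : c 1 = y := rfl
  have c2 : c 2 = z := rfl
  have c3 : c 3 = x := rfl
  have hpath : IsClosedPath D 3 c := by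
    refine ⟨rfl, fun i hi => ?_⟩
    interval_cases i
    · exact hxy
    · exact hyz
    · exact hxz.symm
  obtain ⟨C, hC, hbd⟩ := hpath.exists_bd hD
  have hc : IsFilledPolygon D 3 c C := by
    refine ⟨hpath, le_rfl, fun i hi k hk e => ?_, hC, hbd⟩
    have := hxy.1
    have := hxz.1
    have := hyz.1
    interval_cases i <;> interval_cases k <;> simp_all
  -- For a 3-cycle the total is at most `3`, so each corner carries exactly one triangle of the
  -- filling.
  have gb := hc.gaussBonnet hD hdeg
  have h0 := hc.one_le_card_vertTris hD (show 0 < 3 by omega)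
  have h1 := hc.one_le_card_vertTris hD (show 1 < 3 by omega)
  have h2 := hc.one_le_card_vertTris hD (show 2 < 3 by omega)
  rw [sum_range_succ, sum_range_succ, sum_range_succ, sum_range_zero] at gb
  exact hC (hc.mem_of_card_vertTris_eq_one hD (i := 0) (by omega)
    (show #(vertTris C (c 1)) = 1 by omega))

end Geodesic

/-! ### Triangles between consecutive spheres -/

section Counting

variable {W : Type*} [Fintype W] {D : AbstractSimplicialComplex W} {v : W} {n k : ℕ}

/-- A disc whose interior vertices have degree at least `6`, with a ball that is not cut off by the
boundary. -/
structure IsInteriorBall (D : AbstractSimplicialComplex W) (v : W) (n : ℕ) : Prop where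
  disc : IsDisc D
  six_le : ∀ x, IsInteriorVertex D x → 6 ≤ ((skeleton D).neighborSet x).ncard
  interior : ∀ x, (skeleton D).dist v x < n → IsInteriorVertex D x

lemma IsInteriorBall.mono (h : IsInteriorBall D v n) (hk : k ≤ n) : IsInteriorBall D v k :=
  ⟨h.disc, h.six_le, fun x hx => h.interior x (by omega)⟩

lemma IsInteriorBall.connected (h : IsInteriorBall D v n) : (skeleton D).Connected :=
  h.disc.simplyConnected.connected

/-- The vertices of `σ` at distance `k` from `v`. -/
def atLevel (D : AbstractSimplicialComplex W) (v : W) (k : ℕ) (σ : Finset W) : Finset W :=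
  σ.filter fun x => (skeleton D).dist v x = k

lemma mem_atLevel {σ : Finset W} {x : W} :
    x ∈ atLevel D v k σ ↔ x ∈ σ ∧ (skeleton D).dist v x = k := by simp [atLevel]

/-- The edges of the sphere of radius `k`. -/
def sphereEdges (D : AbstractSimplicialComplex W) (v : W) (k : ℕ) : Finset (Finset W) :=
  univ.filter (· ∈ sphere D v k)

lemma mem_sphereEdges {e : Finset W} : e ∈ sphereEdges D v k ↔
    e ∈ D.faces ∧ e.card = 2 ∧ ∀ x ∈ e, (skeleton D).dist v x = k := by
  rw [sphereEdges, mem_filter]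
  exact ⟨fun h => h.2, fun h => ⟨mem_univ _, h⟩⟩

lemma card_sphereEdges : #(sphereEdges D v k) = sphereLength D v k := by
  rw [sphereLength, ← Set.ncard_coe_finset]
  congr 1
  ext e
  simp [sphereEdges]

lemma pair_mem_sphereEdges {x y : W} (h : (skeleton D).Adj x y)
    (hx : (skeleton D).dist v x = k) (hy : (skeleton D).dist v y = k) :
    {x, y} ∈ sphereEdges D v k := by
  rw [mem_sphereEdges]
  refine ⟨h.2, card_pair h.1, fun z hz => ?_⟩
  rw [mem_insert, mem_singleton] at hz
  rcases hz with rfl | rfl <;> assumption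

lemma triple_eq (x y z : W) : ({x, y} : Finset W) ∪ {z} = {x, y, z} := by
  ext; simp

/-- The triangles with two vertices at distance `p` and one at distance `q` from `v`. -/
def levelTris (D : AbstractSimplicialComplex W) (v : W) (p q : ℕ) : Finset (Finset W) :=
  (tris D).filter fun τ => #(atLevel D v p τ) = 2 ∧ #(atLevel D v q τ) = 1

lemma mem_levelTris {p q : ℕ} {τ : Finset W} : τ ∈ levelTris D v p q ↔
    τ ∈ tris D ∧ #(atLevel D v p τ) = 2 ∧ #(atLevel D v q τ) = 1 := by simp [levelTris]

lemma exists_of_mem_levelTris {p q : ℕ} (hpq : p ≠ q) {τ : Finset W}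
    (h : τ ∈ levelTris D v p q) : ∃ x y z, x ≠ y ∧ z ≠ x ∧ z ≠ y ∧ (skeleton D).dist v x = p ∧
      (skeleton D).dist v y = p ∧ (skeleton D).dist v z = q ∧ τ = {x, y, z} ∧
      atLevel D v p τ = {x, y} := by
  obtain ⟨hτ, hp, hq⟩ := mem_levelTris.1 h
  obtain ⟨x, y, hxy, he⟩ := card_eq_two.1 hp
  obtain ⟨z, hz⟩ := card_eq_one.1 hq
  have hx : x ∈ atLevel D v p τ := by rw [he]; simp
  have hy : y ∈ atLevel D v p τ := by rw [he]; simp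
  have hz' : z ∈ atLevel D v q τ := by rw [hz]; simp
  rw [mem_atLevel] at hx hy hz'
  have hzx : z ≠ x := by rintro rfl; exact hpq (hx.2.symm.trans hz'.2)
  have hzy : z ≠ y := by rintro rfl; exact hpq (hy.2.symm.trans hz'.2)
  refine ⟨x, y, z, hxy, hzx, hzy, hx.2, hy.2, hz'.2, ?_, he⟩
  refine (eq_of_subset_of_card_le (by simp [insert_subset_iff, hx.1, hy.1, hz'.1]) ?_).symm
  rw [card_triple hxy hzx.symm hzy.symm, (mem_tris.1 hτ).2]

lemma triple_mem_levelTris {p q : ℕ} (hpq : p ≠ q) {x y z : W} (h : {x, y, z} ∈ tris D)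
    (hxy : x ≠ y) (hx : (skeleton D).dist v x = p) (hy : (skeleton D).dist v y = p)
    (hz : (skeleton D).dist v z = q) :
    {x, y, z} ∈ levelTris D v p q ∧ atLevel D v p {x, y, z} = {x, y} := by
  have e1 : atLevel D v p {x, y, z} = {x, y} := by
    ext w
    simp only [mem_atLevel, mem_insert, mem_singleton]
    constructor
    · rintro ⟨rfl | rfl | rfl, hw⟩
      · simp
      · simp
      · exact absurd (hw.symm.trans hz) hpq
    · rintro (rfl | rfl) <;> simp [hx, hy]
  have e2 : atLevel D v q {x, y, z} = {z} := by
    ext w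
    simp only [mem_atLevel, mem_insert, mem_singleton]
    constructor
    · rintro ⟨rfl | rfl | rfl, hw⟩
      · exact absurd (hx.symm.trans hw) hpq
      · exact absurd (hy.symm.trans hw) hpq
      · rfl
    · rintro rfl; simp [hz]
  exact ⟨mem_levelTris.2 ⟨h, by rw [e1, card_pair hxy], by rw [e2, card_singleton]⟩, e1⟩

lemma atLevel_mem_sphereEdges {p q : ℕ} {τ : Finset W} (h : τ ∈ levelTris D v p q) :
    atLevel D v p τ ∈ sphereEdges D v p := by
  obtain ⟨hτ, hp, -⟩ := mem_levelTris.1 h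
  exact mem_sphereEdges.2 ⟨faces_of_subset (mem_tris.1 hτ).1 (filter_subset _ _)
    (card_pos.1 (by omega)), hp, fun x hx => (mem_atLevel.1 hx).2⟩

namespace IsInteriorBall

lemma no_link_triangle (h : IsInteriorBall D v n) {x a b c : W}
    (hx : (skeleton D).dist v x < n) (hab : {x, a, b} ∈ tris D) (hac : {x, a, c} ∈ tris D)
    (hbc : {x, b, c} ∈ tris D) : False :=
  h.disc.no_link_triangle (h.interior x hx)
    (le_trans (by norm_num) (h.six_le x (h.interior x hx))) hab hac hbc

/-- The common neighbour of an edge that is closer to `v` is unique. -/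
lemma lower_unique (h : IsInteriorBall D v n) (hk : k < n) {x y z z' : W}
    (hx : (skeleton D).dist v x = k + 1) (hy : (skeleton D).dist v y = k + 1)
    (hz : (skeleton D).dist v z = k) (hz' : (skeleton D).dist v z' = k)
    (hτ : {x, y, z} ∈ tris D) (hτ' : {x, y, z'} ∈ tris D) : z = z' := by
  by_contra hne
  have nzx : x ≠ z := by rintro rfl; omega
  have nzy : y ≠ z := by rintro rfl; omega
  have nzx' : x ≠ z' := by rintro rfl; omega
  have nzy' : y ≠ z' := by rintro rfl; omega
  have f := (mem_tris.1 hτ).1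
  have f' := (mem_tris.1 hτ').1
  have a1 := adj_of_mem_face f (show x ∈ _ by simp) (show z ∈ _ by simp) nzx
  have a2 := adj_of_mem_face f (show y ∈ _ by simp) (show z ∈ _ by simp) nzy
  have a3 := adj_of_mem_face f' (show x ∈ _ by simp) (show z' ∈ _ by simp) nzx'
  have a4 := adj_of_mem_face f' (show y ∈ _ by simp) (show z' ∈ _ by simp) nzy'
  -- If `z ≠ z'`, then `x`, `y`, `z'` form a triangle in the link of `z`, an interior vertex of
  -- degree at least `6`.
  have t1 := lower_triangle h.disc h.six_le hx hz hz' hne a1 a3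
  have t2 := lower_triangle h.disc h.six_le hy hz hz' hne a2 a4
  refine h.no_link_triangle (x := z) (a := x) (b := y) (c := z') (by omega) ?_ ?_ ?_
  · rwa [insert_comm, pair_comm z y]
  · rwa [insert_comm]
  · rwa [insert_comm]

lemma exists_lower_tri (h : IsInteriorBall D v n) {x y : W}
    (hx : (skeleton D).dist v x = k + 1) (hy : (skeleton D).dist v y = k + 1)
    (hxy : (skeleton D).Adj x y) : ∃ z, (skeleton D).dist v z = k ∧ {x, y, z} ∈ tris D := by
  obtain ⟨z, hz, h1, h2⟩ := exists_common_lower h.disc h.six_le hx hy hxy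
  exact ⟨z, hz, clique_triangle h.disc h.six_le hxy h1.symm h2.symm⟩

/-- No triangle has all its vertices at the same distance from `v`. -/
lemma no_flat (h : IsInteriorBall D v n) : ∀ k ≤ n, ∀ x y z : W,
    (skeleton D).dist v x = k → (skeleton D).dist v y = k → (skeleton D).dist v z = k →
    (skeleton D).Adj x y → (skeleton D).Adj x z → (skeleton D).Adj y z → False := by
  intro k
  induction k with
  | zero =>
    intro _ x y z hx hy _ hxy _ _
    rw [h.connected.dist_eq_zero_iff] at hx hy
    exact hxy.1 (hx.symm.trans hy)
  | succ k ih =>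
    intro hk x y z hx hy hz hxy hxz hyz
    obtain ⟨a, ha, ta⟩ := h.exists_lower_tri hx hy hxy
    obtain ⟨b, hb, tb⟩ := h.exists_lower_tri hx hz hxz
    obtain ⟨c, hc, tc⟩ := h.exists_lower_tri hy hz hyz
    have nadj : ∀ {p q r : W}, (skeleton D).dist v p = k + 1 → (skeleton D).dist v q = k + 1 →
        (skeleton D).dist v r = k → {p, q, r} ∈ tris D →
        (skeleton D).Adj p r ∧ (skeleton D).Adj q r := by
      intro p q r hp hq hr ht
      have f := (mem_tris.1 ht).1
      exact ⟨adj_of_mem_face f (by simp) (by simp) (by rintro rfl; omega),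
        adj_of_mem_face f (by simp) (by simp) (by rintro rfl; omega)⟩
    obtain ⟨xa, ya⟩ := nadj hx hy ha ta
    obtain ⟨xb, zb⟩ := nadj hx hz hb tb
    obtain ⟨yc, zc⟩ := nadj hy hz hc tc
    -- A lower vertex adjacent to all of `x`, `y`, `z` would have a triangle in its link. So `a`,
    -- `b`, `c` are distinct and, by `lower_triangle`, pairwise adjacent: a flat triangle one level
    -- down.
    have four : ∀ w, (skeleton D).dist v w = k → (skeleton D).Adj x w → (skeleton D).Adj y w →
        (skeleton D).Adj z w → False := by
      intro w hw h1 h2 h3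
      exact h.no_link_triangle (x := w) (by omega)
        (clique_triangle h.disc h.six_le h1.symm h2.symm hxy)
        (clique_triangle h.disc h.six_le h1.symm h3.symm hxz)
        (clique_triangle h.disc h.six_le h2.symm h3.symm hyz)
    have nab : a ≠ b := by rintro rfl; exact four a ha xa ya zb
    have nac : a ≠ c := by rintro rfl; exact four a ha xa ya zc
    have nbc : b ≠ c := by rintro rfl; exact four b hb xb yc zb
    have adj3 : ∀ {p q r : W}, q ≠ r → {p, q, r} ∈ tris D → (skeleton D).Adj q r :=
      fun hqr ht => adj_of_mem_face (mem_tris.1 ht).1 (by simp) (by simp) hqr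
    exact ih (by omega) a b c ha hb hc
      (adj3 nab (lower_triangle h.disc h.six_le hx ha hb nab xa xb))
      (adj3 nac (lower_triangle h.disc h.six_le hy ha hc nac ya yc))
      (adj3 nbc (lower_triangle h.disc h.six_le hz hb hc nbc zb zc))

/-- Every sphere edge is the base of exactly one inward triangle. Only the apex has to be interior,
so this reaches the outermost radius `n`. -/
lemma sum_lower (h : IsInteriorBall D v n) (hk : k < n) (g : Finset W → ℤ) :
    ∑ τ ∈ levelTris D v (k + 1) k, g (atLevel D v (k + 1) τ) =
      ∑ e ∈ sphereEdges D v (k + 1), g e := by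
  refine sum_bij (fun τ _ => atLevel D v (k + 1) τ) (fun τ hτ => atLevel_mem_sphereEdges hτ)
    ?_ ?_ (fun _ _ => rfl)
  · intro τ hτ τ' hτ' he
    obtain ⟨x, y, z, hxy, hzx, hzy, hx, hy, hz, hτe, hl⟩ :=
      exists_of_mem_levelTris (by omega) hτ
    obtain ⟨x', y', z', hxy', hzx', hzy', hx', hy', hz', hτe', hl'⟩ :=
      exists_of_mem_levelTris (by omega) hτ'
    have e1 : ({x', y'} : Finset W) = {x, y} := by rw [← hl', ← hl]; exact he.symm
    have hτe'' : τ' = {x, y, z'} := by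
      rw [hτe', ← triple_eq, e1, triple_eq]
    have t := (mem_levelTris.1 hτ).1
    have t' := (mem_levelTris.1 hτ').1
    rw [hτe] at t
    rw [hτe''] at t'
    rw [hτe, hτe'', h.lower_unique hk hx hy hz hz' t t']
  · intro e he
    obtain ⟨hf, h2, hlev⟩ := mem_sphereEdges.1 he
    obtain ⟨x, y, hxy, rfl⟩ := card_eq_two.1 h2
    have hx := hlev x (by simp)
    have hy := hlev y (by simp)
    obtain ⟨z, hz, ht⟩ := h.exists_lower_tri hx hy ⟨hxy, hf⟩
    obtain ⟨m1, m2⟩ := triple_mem_levelTris (by omega) ht hxy hx hy hz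
    exact ⟨_, m1, m2⟩

end IsInteriorBall

end Counting

/-! ### Outward triangles and cyclic structure of the spheres -/

section Recurrence

variable {W : Type*} [Fintype W] {D : AbstractSimplicialComplex W} {v : W} {n k : ℕ}

lemma triple_injective {x y z z' : W} (hzx : z ≠ x) (hzy : z ≠ y)
    (h : ({x, y, z} : Finset W) = {x, y, z'}) : z = z' := by
  have : z ∈ ({x, y, z'} : Finset W) := h ▸ (by simp)
  simp only [mem_insert, mem_singleton, hzx, hzy, false_or] at this
  exact this

lemma exists_third_of_edgeTris {x y : W} (hxy : x ≠ y) {τ : Finset W}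
    (hτ : τ ∈ edgeTris (tris D) x y) : ∃ z, z ≠ x ∧ z ≠ y ∧ τ = {x, y, z} ∧
      (skeleton D).Adj x z ∧ (skeleton D).Adj y z := by
  rw [mem_edgeTris, mem_tris] at hτ
  obtain ⟨z, hzx, hzy, rfl⟩ := exists_eq_triple hτ.1.2 hτ.2.1 hτ.2.2 hxy
  exact ⟨z, hzx, hzy, rfl, adj_of_mem_face hτ.1.1 (by simp) (by simp) hzx.symm,
    adj_of_mem_face hτ.1.1 (by simp) (by simp) hzy.symm⟩

/-- The two triangles at an edge with an interior endpoint. -/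
lemma IsDisc.exists_two_tris (hD : IsDisc D) {x y : W} (hxy : (skeleton D).Adj x y)
    (hx : IsInteriorVertex D x) : ∃ p q, p ≠ q ∧ {x, y, p} ∈ tris D ∧ {x, y, q} ∈ tris D ∧
      ∀ r, {x, y, r} ∈ tris D → r = p ∨ r = q := by
  obtain ⟨σ, τ, hne, he⟩ := card_eq_two.1 (hD.card_edgeTris_interior hxy hx)
  have hσ : σ ∈ edgeTris (tris D) x y := by rw [he]; simp
  have hτ : τ ∈ edgeTris (tris D) x y := by rw [he]; simp
  obtain ⟨p, hpx, hpy, rfl, -⟩ := exists_third_of_edgeTris hxy.1 hσ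
  obtain ⟨q, hqx, hqy, rfl, -⟩ := exists_third_of_edgeTris hxy.1 hτ
  refine ⟨p, q, by rintro rfl; exact hne rfl, (mem_edgeTris.1 hσ).1, (mem_edgeTris.1 hτ).1, ?_⟩
  intro r hr
  have hmem : {x, y, r} ∈ edgeTris (tris D) x y := mem_edgeTris.2 ⟨hr, by simp, by simp⟩
  rw [he, mem_insert, mem_singleton] at hmem
  exact hmem.imp (fun e => (triple_injective hpx hpy e.symm).symm)
    fun e => (triple_injective hqx hqy e.symm).symm

/-- The sum of the weights of the endpoints of the edges of a sphere. -/
def edgeWeight (D : AbstractSimplicialComplex W) (v : W) (w : W → ℤ) (k : ℕ) : ℤ :=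
  ∑ e ∈ sphereEdges D v k, ∑ x ∈ e, w x

namespace IsInteriorBall

lemma sphereEdges_zero (h : IsInteriorBall D v n) : sphereEdges D v 0 = ∅ := by
  rw [eq_empty_iff_forall_notMem]
  intro e he
  obtain ⟨-, h2, hlev⟩ := mem_sphereEdges.1 he
  obtain ⟨x, y, hxy, rfl⟩ := card_eq_two.1 h2
  have hx := hlev x (by simp)
  have hy := hlev y (by simp)
  rw [h.connected.dist_eq_zero_iff] at hx hy
  exact hxy (hx.symm.trans hy)

lemma dist_cases (h : IsInteriorBall D v n) {x y : W} (hxy : (skeleton D).Adj x y) :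
    (skeleton D).dist v y ≤ (skeleton D).dist v x + 1 ∧
      (skeleton D).dist v x ≤ (skeleton D).dist v y + 1 :=
  ⟨dist_le_dist_add_one h.connected hxy, dist_le_dist_add_one h.connected hxy.symm⟩

/-- An edge with an interior endpoint lies in two triangles. One points inwards; the other can
neither point inwards, by uniqueness, nor be flat. -/
lemma exists_upper_tri (h : IsInteriorBall D v n) (hk : k + 1 < n) {x y : W}
    (hx : (skeleton D).dist v x = k + 1) (hy : (skeleton D).dist v y = k + 1)
    (hxy : (skeleton D).Adj x y) :
    ∃ z z₀, (skeleton D).dist v z = k + 2 ∧ (skeleton D).dist v z₀ = k ∧ {x, y, z} ∈ tris D ∧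
      ∀ r, {x, y, r} ∈ tris D → r = z ∨ r = z₀ := by
  obtain ⟨z₀, hz₀, t₀⟩ := h.exists_lower_tri hx hy hxy
  obtain ⟨p, q, hpq, tp, tq, hall⟩ := h.disc.exists_two_tris hxy (h.interior x (by omega))
  have key : ∀ r, r ≠ z₀ → {x, y, r} ∈ tris D → (skeleton D).dist v r = k + 2 := by
    intro r hr tr
    obtain ⟨r', h1, h2, h3, a1, a2⟩ := exists_third_of_edgeTris hxy.1
      (mem_edgeTris.2 ⟨tr, by simp, by simp⟩)
    obtain rfl : r' = r := triple_injective h1 h2 h3.symm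
    have d1 := h.dist_cases a1
    rcases (show (skeleton D).dist v r' = k ∨ (skeleton D).dist v r' = k + 1 ∨
      (skeleton D).dist v r' = k + 2 by omega) with e | e | e
    · exact absurd (h.lower_unique (by omega) hx hy e hz₀ tr t₀) hr
    · exact (h.no_flat (k + 1) (by omega) x y r' hx hy e hxy a1 a2).elim
    · exact e
  rcases hall z₀ t₀ with rfl | rfl
  · exact ⟨q, z₀, key q hpq.symm tq, hz₀, tq, fun r hr => (hall r hr).symm⟩
  · exact ⟨p, z₀, key p hpq tp, hz₀, tp, hall⟩

lemma sum_upper (h : IsInteriorBall D v n) (hk : k < n) (g : Finset W → ℤ) :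
    ∑ τ ∈ levelTris D v k (k + 1), g (atLevel D v k τ) = ∑ e ∈ sphereEdges D v k, g e := by
  rcases k with _ | k
  · rw [h.sphereEdges_zero, sum_empty]
    refine sum_eq_zero fun τ hτ => ?_
    have := atLevel_mem_sphereEdges hτ
    rw [h.sphereEdges_zero] at this
    exact absurd this (notMem_empty _)
  refine sum_bij (fun τ _ => atLevel D v (k + 1) τ) (fun τ hτ => atLevel_mem_sphereEdges hτ)
    ?_ ?_ (fun _ _ => rfl)
  · intro τ hτ τ' hτ' he
    obtain ⟨x, y, z, hxy, hzx, hzy, hx, hy, hz, hτe, hl⟩ :=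
      exists_of_mem_levelTris (by omega) hτ
    obtain ⟨x', y', z', hxy', hzx', hzy', hx', hy', hz', hτe', hl'⟩ :=
      exists_of_mem_levelTris (by omega) hτ'
    have e1 : ({x', y'} : Finset W) = {x, y} := by rw [← hl', ← hl]; exact he.symm
    have hτe'' : τ' = {x, y, z'} := by rw [hτe', ← triple_eq, e1, triple_eq]
    have t := (mem_levelTris.1 hτ).1
    have t' := (mem_levelTris.1 hτ').1
    rw [hτe] at t
    rw [hτe''] at t'
    obtain ⟨u, u₀, -, hu₀, -, hall⟩ := h.exists_upper_tri hk hx hy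
      (adj_of_mem_face (mem_tris.1 t).1 (by simp) (by simp) hxy)
    have key : ∀ r, (skeleton D).dist v r = k + 1 + 1 → {x, y, r} ∈ tris D → r = u := by
      intro r hr tr
      rcases hall r tr with e | e
      · exact e
      · rw [e] at hr; omega
    rw [hτe, hτe'', key z hz t, key z' hz' t']
  · intro e he
    obtain ⟨hf, h2, hlev⟩ := mem_sphereEdges.1 he
    obtain ⟨x, y, hxy, rfl⟩ := card_eq_two.1 h2
    have hx := hlev x (by simp)
    have hy := hlev y (by simp)
    obtain ⟨z, -, hz, -, ht, -⟩ := h.exists_upper_tri hk hx hy ⟨hxy, hf⟩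
    obtain ⟨m1, m2⟩ := triple_mem_levelTris (by omega) ht hxy hx hy hz
    exact ⟨_, m1, m2⟩

/-- A vertex of an interior sphere has exactly two neighbours on the sphere. -/
lemma exists_two_neighbours (h : IsInteriorBall D v n) (hk : k + 1 < n) {x : W}
    (hx : (skeleton D).dist v x = k + 1) : ∃ p q, p ≠ q ∧
      ∀ y, ((skeleton D).Adj x y ∧ (skeleton D).dist v y = k + 1) ↔ y = p ∨ y = q := by
  have hint := h.interior x (by omega)
  have perm : ∀ {p q r : W}, ({p, q, r} : Finset W) ∈ tris D → {p, r, q} ∈ tris D := by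
    intro p q r ht; rwa [pair_comm]
  have adj : ∀ {p q : W}, (skeleton D).Adj x p → {x, p, q} ∈ tris D →
      (skeleton D).Adj x q ∧ (skeleton D).Adj p q := by
    intro p q hp ht
    obtain ⟨q', h1, h2, h3, a1, a2⟩ := exists_third_of_edgeTris hp.1
      (mem_edgeTris.2 ⟨ht, by simp, by simp⟩)
    obtain rfl : q' = q := triple_injective h1 h2 h3.symm
    exact ⟨a1, a2⟩
  obtain ⟨a, xa, ha⟩ := exists_lower h.connected hx
  obtain ⟨p, q, hpq, tp, tq, hall⟩ := h.disc.exists_two_tris xa hint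
  have lev : ∀ {a p : W}, (skeleton D).dist v a = k → (skeleton D).Adj x a → {x, a, p} ∈ tris D →
      (skeleton D).dist v p = k ∨ (skeleton D).dist v p = k + 1 := by
    intro a p ha xa tp
    obtain ⟨xp, ap⟩ := adj xa tp
    have := h.dist_cases xp
    have := h.dist_cases ap
    omega
  -- Here `x` has two lower neighbours `a`, `b`, and no third one, since it would close a triangle
  -- in the link of `x`. The sphere neighbours are the apexes of the other triangles on the edges
  -- from `x` to `a` and to `b`.
  have case2 : ∀ a b p : W, (skeleton D).dist v a = k → (skeleton D).Adj x a →
      (skeleton D).dist v b = k → (skeleton D).Adj x b → {x, a, b} ∈ tris D →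
      {x, a, p} ∈ tris D → p ≠ b → (∀ r, {x, a, r} ∈ tris D → r = b ∨ r = p) →
      ∃ p q, p ≠ q ∧
      ∀ y, ((skeleton D).Adj x y ∧ (skeleton D).dist v y = k + 1) ↔ y = p ∨ y = q := by
    intro a b p ha xa hb xb tab tp hpb hall
    have low : ∀ c, (skeleton D).Adj x c → (skeleton D).dist v c = k → c = a ∨ c = b := by
      intro c xc hc
      by_contra! hne
      exact h.no_link_triangle (x := x) (by omega) tab
        (lower_triangle h.disc h.six_le hx ha hc hne.1.symm xa xc)
        (lower_triangle h.disc h.six_le hx hb hc hne.2.symm xb xc)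
    obtain ⟨q, hqa, tq, hall'⟩ : ∃ q, q ≠ a ∧ {x, b, q} ∈ tris D ∧
        ∀ r, {x, b, r} ∈ tris D → r = a ∨ r = q := by
      obtain ⟨q₁, q₂, hne, t1, t2, hal⟩ := h.disc.exists_two_tris xb hint
      rcases hal a (perm tab) with rfl | rfl
      · exact ⟨q₂, hne.symm, t2, hal⟩
      · exact ⟨q₁, hne, t1, fun r hr => (hal r hr).symm⟩
    have hp : (skeleton D).dist v p = k + 1 := by
      rcases lev ha xa tp with e | e
      · rcases low p (adj xa tp).1 e with rfl | rfl
        · exact absurd rfl (adj xa tp).2.1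
        · exact absurd rfl hpb
      · exact e
    have hq : (skeleton D).dist v q = k + 1 := by
      rcases lev hb xb tq with e | e
      · rcases low q (adj xb tq).1 e with rfl | rfl
        · exact absurd rfl hqa
        · exact absurd rfl (adj xb tq).2.1
      · exact e
    refine ⟨p, q, ?_, fun y => ⟨?_, ?_⟩⟩
    · rintro rfl
      exact h.no_link_triangle (x := x) (by omega) tab tp tq
    · rintro ⟨xy, hy⟩
      obtain ⟨c, hc, tc⟩ := h.exists_lower_tri hx hy xy
      rcases low c (adj xy tc).1 hc with rfl | rfl
      · rcases hall y (perm tc) with rfl | rfl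
        · omega
        · exact Or.inl rfl
      · rcases hall' y (perm tc) with rfl | rfl
        · omega
        · exact Or.inr rfl
    · rintro (rfl | rfl)
      · exact ⟨(adj xa tp).1, hp⟩
      · exact ⟨(adj xb tq).1, hq⟩
  rcases lev ha xa tp with hp | hp
  · exact case2 a p q ha xa hp (adj xa tp).1 tp tq hpq.symm hall
  rcases lev ha xa tq with hq | hq
  · exact case2 a q p ha xa hq (adj xa tq).1 tq tp hpq fun r hr => (hall r hr).symm
  -- Here `a` is the only lower neighbour: another one would span a triangle with `x` and `a`, hence
  -- be `p` or `q`, which lie on the sphere.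
  refine ⟨p, q, hpq, fun y => ⟨?_, ?_⟩⟩
  · rintro ⟨xy, hy⟩
    obtain ⟨c, hc, tc⟩ := h.exists_lower_tri hx hy xy
    by_cases hca : c = a
    · rw [hca] at tc
      exact hall y (perm tc)
    · have := hall c (lower_triangle h.disc h.six_le hx ha hc (Ne.symm hca) xa (adj xy tc).1)
      rcases this with rfl | rfl <;> omega
  · rintro (rfl | rfl)
    · exact ⟨(adj xa tp).1, hp⟩
    · exact ⟨(adj xa tq).1, hq⟩

lemma card_sphereEdges_at (h : IsInteriorBall D v n) (hk : k + 1 < n) {x : W}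
    (hx : (skeleton D).dist v x = k + 1) :
    #((sphereEdges D v (k + 1)).filter (x ∈ ·)) = 2 := by
  obtain ⟨p, q, hpq, hall⟩ := h.exists_two_neighbours hk hx
  obtain ⟨xp, hp⟩ := (hall p).2 (Or.inl rfl)
  obtain ⟨xq, hq⟩ := (hall q).2 (Or.inr rfl)
  have : (sphereEdges D v (k + 1)).filter (x ∈ ·) = {{x, p}, {x, q}} := by
    ext e
    rw [mem_filter, mem_insert, mem_singleton]
    constructor
    · rintro ⟨he, hxe⟩
      obtain ⟨hf, h2, hlev⟩ := mem_sphereEdges.1 he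
      obtain ⟨y, hy, hyx⟩ := exists_mem_ne (show 1 < #e by omega) x
      have hexy : e = {x, y} := (eq_of_subset_of_card_le (by simp [insert_subset_iff, hxe, hy])
        (by rw [card_pair hyx.symm, h2])).symm
      rcases (hall y).1 ⟨adj_of_mem_face hf hxe hy hyx.symm, hlev y hy⟩ with rfl | rfl
      · exact Or.inl hexy
      · exact Or.inr hexy
    · rintro (rfl | rfl)
      · exact ⟨pair_mem_sphereEdges xp hx hp, by simp⟩
      · exact ⟨pair_mem_sphereEdges xq hx hq, by simp⟩
  rw [this, card_pair]
  intro e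
  have : p ∈ ({x, q} : Finset W) := e ▸ (by simp)
  simp only [mem_insert, mem_singleton, xp.1.symm, hpq, or_self] at this

/-- Each vertex of an interior sphere lies on exactly two of its edges. This fails to apply at
radius `n`, where vertices may be on the boundary; there only edge sums are used. -/
lemma edgeWeight_eq (h : IsInteriorBall D v n) (w : W → ℤ) (hk : k + 1 < n) :
    edgeWeight D v w (k + 1) = 2 * ∑ x ∈ atLevel D v (k + 1) univ, w x := by
  have e1 : edgeWeight D v w (k + 1) = ∑ e ∈ sphereEdges D v (k + 1),
      ∑ x ∈ atLevel D v (k + 1) univ, if x ∈ e then w x else 0 := by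
    refine sum_congr rfl fun e he => ?_
    rw [← sum_filter]
    refine sum_congr ?_ fun _ _ => rfl
    ext x
    simp only [mem_filter, mem_atLevel, mem_univ, true_and]
    exact ⟨fun hx => ⟨(mem_sphereEdges.1 he).2.2 x hx, hx⟩, fun hx => hx.2⟩
  rw [e1, sum_comm, mul_sum]
  refine sum_congr rfl fun x hx => ?_
  rw [← sum_filter, sum_const, h.card_sphereEdges_at hk (mem_atLevel.1 hx).2]
  simp

end IsInteriorBall

end Recurrence

/-! ### Weighted degree sums and the area formula -/

section Weights

variable {W : Type*} [Fintype W] {D : AbstractSimplicialComplex W} {v : W} {n k : ℕ}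

lemma sum_atLevel_add {p q : ℕ} (hpq : p ≠ q) {τ : Finset W} (h : τ ∈ levelTris D v p q)
    (w : W → ℤ) : ∑ x ∈ atLevel D v p τ, w x + ∑ x ∈ atLevel D v q τ, w x = ∑ x ∈ τ, w x := by
  obtain ⟨hτ, hp, hq⟩ := mem_levelTris.1 h
  have hdisj : Disjoint (atLevel D v p τ) (atLevel D v q τ) := by
    rw [disjoint_left]
    intro x h1 h2
    exact hpq ((mem_atLevel.1 h1).2.symm.trans (mem_atLevel.1 h2).2)
  rw [← sum_union hdisj]
  refine sum_congr (eq_of_subset_of_card_le (union_subset (filter_subset _ _)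
    (filter_subset _ _)) ?_) fun _ _ => rfl
  rw [card_union_of_disjoint hdisj, hp, hq, (mem_tris.1 hτ).2]

lemma dist_le_of_mem_levelTris {p q : ℕ} (hpq : p ≠ q) {τ : Finset W}
    (h : τ ∈ levelTris D v p q) {x : W} (hx : x ∈ τ) :
    (skeleton D).dist v x = p ∨ (skeleton D).dist v x = q := by
  obtain ⟨a, b, c, -, -, -, ha, hb, hc, rfl, -⟩ := exists_of_mem_levelTris hpq h
  simp only [mem_insert, mem_singleton] at hx
  rcases hx with rfl | rfl | rfl
  · exact Or.inl ha
  · exact Or.inl hb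
  · exact Or.inr hc

namespace IsInteriorBall

lemma adj_of_mem_tris {τ : Finset W} (hτ : τ ∈ tris D) {x y : W} (hx : x ∈ τ) (hy : y ∈ τ)
    (hxy : x ≠ y) : (skeleton D).Adj x y := adj_of_mem_face (mem_tris.1 hτ).1 hx hy hxy

lemma dist_le_of_mem_tris (h : IsInteriorBall D v n) {τ : Finset W} (hτ : τ ∈ tris D) {x y : W}
    (hx : x ∈ τ) (hy : y ∈ τ) : (skeleton D).dist v y ≤ (skeleton D).dist v x + 1 := by
  by_cases hxy : x = y
  · subst hxy; omega
  · exact (h.dist_cases (adj_of_mem_tris hτ hx hy hxy)).1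

lemma exists_level_ne (h : IsInteriorBall D v n) (hk : k ≤ n) {τ : Finset W} (hτ : τ ∈ tris D) :
    #(atLevel D v k τ) ≠ 3 := by
  intro h3
  have heq : atLevel D v k τ = τ :=
    eq_of_subset_of_card_le (filter_subset _ _) (by rw [(mem_tris.1 hτ).2]; omega)
  obtain ⟨x, y, z, hxy, hxz, hyz, rfl⟩ := card_eq_three.1 (mem_tris.1 hτ).2
  have lev : ∀ w ∈ ({x, y, z} : Finset W), (skeleton D).dist v w = k := by
    intro w hw
    rw [← heq] at hw
    exact (mem_atLevel.1 hw).2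
  exact h.no_flat k hk x y z (lev x (by simp)) (lev y (by simp)) (lev z (by simp))
    (adj_of_mem_tris hτ (by simp) (by simp) hxy) (adj_of_mem_tris hτ (by simp) (by simp) hxz)
    (adj_of_mem_tris hτ (by simp) (by simp) hyz)

/-- The distribution of the vertices of a triangle that meets the sphere of radius `k + 1`. -/
lemma level_cards (h : IsInteriorBall D v n) (hk : k + 1 ≤ n) {τ : Finset W} (hτ : τ ∈ tris D)
    {x : W} (hx : x ∈ atLevel D v (k + 1) τ) :
    #(atLevel D v k τ) + #(atLevel D v (k + 1) τ) + #(atLevel D v (k + 2) τ) = 3 ∧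
      0 < #(atLevel D v (k + 1) τ) ∧ #(atLevel D v (k + 1) τ) ≠ 3 ∧
      (#(atLevel D v k τ) = 0 ∨ #(atLevel D v (k + 2) τ) = 0) := by
  obtain ⟨hxτ, hxl⟩ := mem_atLevel.1 hx
  refine ⟨?_, card_pos.2 ⟨x, hx⟩, h.exists_level_ne hk hτ, ?_⟩
  · have := card_eq_sum_card_fiberwise (s := τ) (t := ({k, k + 1, k + 2} : Finset ℕ))
      (f := (skeleton D).dist v) (by
        intro y hy
        have h1 := h.dist_le_of_mem_tris hτ hxτ hy
        have h2 := h.dist_le_of_mem_tris hτ hy hxτ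
        simp only [coe_insert, coe_singleton, Set.mem_insert_iff, Set.mem_singleton_iff]
        omega)
    rw [(mem_tris.1 hτ).2, sum_insert (by simp), sum_insert (by simp), sum_singleton] at this
    rw [this, add_assoc]
    rfl
  · by_contra! hne
    obtain ⟨y, hy⟩ := card_pos.1 (Nat.pos_of_ne_zero hne.1)
    obtain ⟨z, hz⟩ := card_pos.1 (Nat.pos_of_ne_zero hne.2)
    rw [mem_atLevel] at hy hz
    have := h.dist_le_of_mem_tris hτ hy.1 hz.1
    omega

lemma sum_vertTris (w : W → ℤ) (l : ℕ) :
    ∑ x ∈ atLevel D v l univ, w x * #(vertTris (tris D) x) =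
      ∑ τ ∈ tris D, ∑ x ∈ atLevel D v l τ, w x := by
  have e1 : ∀ x ∈ atLevel D v l univ, w x * #(vertTris (tris D) x) =
      ∑ τ ∈ tris D, if x ∈ τ then w x else 0 := by
    intro x _
    rw [← sum_filter, sum_const, nsmul_eq_mul, mul_comm]
    rfl
  rw [sum_congr rfl e1, sum_comm]
  refine sum_congr rfl fun τ _ => ?_
  rw [← sum_filter]
  refine sum_congr ?_ fun _ _ => rfl
  ext x
  simp [mem_atLevel, and_comm]

/-- The levels in a triangle differ by at most one and no triangle of the ball is flat, so a
triangle meeting level `k + 1` has its vertices split two and one between this level and an adjacent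
one: four types. -/
lemma sum_tris_level (h : IsInteriorBall D v n) (hk : k + 1 < n) (w : W → ℤ) :
    ∑ τ ∈ tris D, ∑ x ∈ atLevel D v (k + 1) τ, w x =
      ∑ τ ∈ levelTris D v (k + 2) (k + 1), ∑ x ∈ atLevel D v (k + 1) τ, w x +
      ∑ τ ∈ levelTris D v (k + 1) (k + 2), ∑ x ∈ atLevel D v (k + 1) τ, w x +
      ∑ τ ∈ levelTris D v (k + 1) k, ∑ x ∈ atLevel D v (k + 1) τ, w x +
      ∑ τ ∈ levelTris D v k (k + 1), ∑ x ∈ atLevel D v (k + 1) τ, w x := by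
  simp only [levelTris, sum_filter, ← sum_add_distrib]
  refine sum_congr rfl fun τ hτ => ?_
  rcases (atLevel D v (k + 1) τ).eq_empty_or_nonempty with h0 | ⟨x, hx⟩
  · simp [h0]
  obtain ⟨h1, h2, h3, h4⟩ := h.level_cards (by omega) hτ hx
  generalize #(atLevel D v k τ) = a at *
  generalize #(atLevel D v (k + 1) τ) = b at *
  generalize #(atLevel D v (k + 2) τ) = c at *
  generalize ∑ x ∈ atLevel D v (k + 1) τ, w x = f
  have : b = 1 ∨ b = 2 := by omega
  rcases h4 with rfl | rfl <;> rcases this with rfl | rfl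
  · obtain rfl : c = 2 := by omega
    simp
  · obtain rfl : c = 1 := by omega
    simp
  · obtain rfl : a = 2 := by omega
    simp
  · obtain rfl : a = 1 := by omega
    simp

lemma card_lower (h : IsInteriorBall D v n) (hk : k < n) :
    #(levelTris D v (k + 1) k) = sphereLength D v (k + 1) := by
  have := h.sum_lower hk (fun _ => 1)
  rw [sum_const, sum_const, card_sphereEdges] at this
  simpa using this

lemma card_upper (h : IsInteriorBall D v n) (hk : k < n) :
    #(levelTris D v k (k + 1)) = sphereLength D v k := by
  have := h.sum_upper hk (fun _ => 1)
  rw [sum_const, sum_const, card_sphereEdges] at this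
  simpa using this

/-- The weight of the apex is the constant `c` minus the weight of the base, and the bases run once
through the sphere edges. -/
lemma sum_apex_lower (h : IsInteriorBall D v n) (hk : k < n) (w : W → ℤ) (c : ℤ)
    (hw : ∀ τ ∈ tris D, (∀ x ∈ τ, (skeleton D).dist v x ≤ k + 1) → ∑ x ∈ τ, w x = c) :
    ∑ τ ∈ levelTris D v (k + 1) k, ∑ x ∈ atLevel D v k τ, w x =
      c * sphereLength D v (k + 1) - edgeWeight D v w (k + 1) := by
  rw [edgeWeight, ← h.sum_lower hk (fun e => ∑ x ∈ e, w x), ← h.card_lower hk, mul_comm,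
    ← nsmul_eq_mul, ← sum_const, ← sum_sub_distrib]
  refine sum_congr rfl fun τ hτ => ?_
  rw [← hw τ (mem_levelTris.1 hτ).1 fun x hx => ?_, ← sum_atLevel_add (by omega) hτ w]
  · ring
  · have := dist_le_of_mem_levelTris (by omega) hτ hx; omega

lemma sum_apex_upper (h : IsInteriorBall D v n) (hk : k < n) (w : W → ℤ) (c : ℤ)
    (hw : ∀ τ ∈ tris D, (∀ x ∈ τ, (skeleton D).dist v x ≤ k + 1) → ∑ x ∈ τ, w x = c) :
    ∑ τ ∈ levelTris D v k (k + 1), ∑ x ∈ atLevel D v (k + 1) τ, w x =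
      c * sphereLength D v k - edgeWeight D v w k := by
  rw [edgeWeight, ← h.sum_upper hk (fun e => ∑ x ∈ e, w x), ← h.card_upper hk, mul_comm,
    ← nsmul_eq_mul, ← sum_const, ← sum_sub_distrib]
  refine sum_congr rfl fun τ hτ => ?_
  rw [← hw τ (mem_levelTris.1 hτ).1 fun x hx => ?_, ← sum_atLevel_add (by omega) hτ w]
  · ring
  · have := dist_le_of_mem_levelTris (by omega) hτ hx; omega

/-- The weighted sum of the degrees of the vertices of an interior sphere, for a weight that has
the same sum over all triangles. -/
theorem sum_weight_degree (h : IsInteriorBall D v n) (hk : k + 1 < n) (w : W → ℤ) (c : ℤ)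
    (hw : ∀ τ ∈ tris D, (∀ x ∈ τ, (skeleton D).dist v x ≤ k + 2) → ∑ x ∈ τ, w x = c) :
    ∑ x ∈ atLevel D v (k + 1) univ, w x * ((skeleton D).neighborSet x).ncard =
      c * (sphereLength D v (k + 2) + sphereLength D v k) - edgeWeight D v w (k + 2) -
        edgeWeight D v w k + 2 * edgeWeight D v w (k + 1) := by
  have e0 : ∑ x ∈ atLevel D v (k + 1) univ, w x * ((skeleton D).neighborSet x).ncard =
      ∑ x ∈ atLevel D v (k + 1) univ, w x * #(vertTris (tris D) x) := by
    refine sum_congr rfl fun x hx => ?_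
    rw [h.disc.card_vertTris_interior (h.interior x (by rw [(mem_atLevel.1 hx).2]; omega))]
  -- Triangles based on the two neighbouring spheres contribute their apexes; those based on this
  -- sphere, one on each side of every edge, contribute `edgeWeight` twice.
  rw [e0, sum_vertTris, h.sum_tris_level hk, h.sum_apex_lower hk w c hw,
    h.sum_apex_upper (by omega) w c fun τ hτ hx => hw τ hτ fun x hxτ => by
      have := hx x hxτ; omega,
    h.sum_upper hk (fun e => ∑ x ∈ e, w x), h.sum_lower (by omega) (fun e => ∑ x ∈ e, w x)]
  simp only [edgeWeight]
  ring

/-- Radius zero: every triangle at `v` is an inward triangle over an edge of the unit sphere. -/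
theorem weight_degree_center (h : IsInteriorBall D v n) (hn : 0 < n) (w : W → ℤ) (c : ℤ)
    (hw : ∀ τ ∈ tris D, (∀ x ∈ τ, (skeleton D).dist v x ≤ 1) → ∑ x ∈ τ, w x = c) :
    w v * ((skeleton D).neighborSet v).ncard =
      c * sphereLength D v 1 - edgeWeight D v w 1 := by
  have hv : atLevel D v 0 univ = {v} := by
    ext x
    simp only [mem_atLevel, mem_univ, true_and, mem_singleton, h.connected.dist_eq_zero_iff]
    exact eq_comm
  rw [← h.sum_apex_lower hn w c hw, ← h.disc.card_vertTris_interior (h.interior v (by simpa))]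
  have := sum_vertTris (D := D) (v := v) w 0
  rw [hv, sum_singleton] at this
  rw [this, levelTris, sum_filter]
  refine sum_congr rfl fun τ hτ => ?_
  rcases (atLevel D v 0 τ).eq_empty_or_nonempty with h0 | ⟨x, hx⟩
  · simp [h0]
  have hsing : atLevel D v 0 τ = {x} := by
    ext y
    rw [mem_singleton]
    refine ⟨fun hy => ?_, fun hy => hy ▸ hx⟩
    have h1 := (mem_atLevel.1 hx).2
    have h2 := (mem_atLevel.1 hy).2
    rw [h.connected.dist_eq_zero_iff] at h1 h2
    exact h2.symm.trans h1
  have hone : #(atLevel D v (0 + 1) τ) = 2 := by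
    have : atLevel D v (0 + 1) τ = τ.erase x := by
      ext y
      rw [mem_atLevel, mem_erase]
      obtain ⟨hxτ, hx0⟩ := mem_atLevel.1 hx
      constructor
      · rintro ⟨hy, hy1⟩
        exact ⟨by rintro rfl; omega, hy⟩
      · rintro ⟨hyx, hy⟩
        refine ⟨hy, ?_⟩
        have h1 := h.dist_le_of_mem_tris hτ hxτ hy
        have h2 : (skeleton D).dist v y ≠ 0 := by
          intro h2
          rw [h.connected.dist_eq_zero_iff] at hx0 h2
          exact hyx (h2.symm.trans hx0)
        omega
    rw [this, card_erase_of_mem (mem_atLevel.1 hx).1, (mem_tris.1 hτ).2]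
  rw [if_pos ⟨hone, by rw [hsing, card_singleton]⟩]

/-- The area of a sphere that is not cut off by the boundary. -/
theorem sphereArea_eq : ∀ n, IsInteriorBall D v n →
    sphereArea D v n = ∑ k ∈ range n, (sphereLength D v k + sphereLength D v (k + 1)) := by
  have fin : ∀ n, sphereArea D v n =
      #((tris D).filter fun τ => ∀ x ∈ τ, (skeleton D).dist v x ≤ n) := by
    intro n
    rw [sphereArea, ← Set.ncard_coe_finset]
    congr 1
    ext τ
    simp [tris]
  intro n
  induction n with
  | zero =>
    intro h
    rw [fin, range_zero, sum_empty, card_eq_zero, eq_empty_iff_forall_notMem]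
    intro τ hτ
    obtain ⟨hτ, hlev⟩ := mem_filter.1 hτ
    refine h.exists_level_ne le_rfl hτ ?_
    rw [← (mem_tris.1 hτ).2]
    congr 1
    exact filter_true_of_mem fun x hx => Nat.le_zero.1 (hlev x hx)
  | succ n ih =>
    intro h
    -- The triangles added between radii `n` and `n + 1` are those based on either sphere, one for
    -- each edge.
    rw [sum_range_succ, ← ih (h.mono (by omega)), ← h.card_lower (Nat.lt_succ_self n),
      ← h.card_upper (Nat.lt_succ_self n), fin, fin]
    have hd1 : Disjoint (levelTris D v n (n + 1)) (levelTris D v (n + 1) n) := by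
      rw [disjoint_left]
      intro τ h1 h2
      have := (mem_levelTris.1 h1).2.1
      have := (mem_levelTris.1 h2).2.2
      omega
    have hd2 : Disjoint ((tris D).filter fun τ => ∀ x ∈ τ, (skeleton D).dist v x ≤ n)
        (levelTris D v n (n + 1) ∪ levelTris D v (n + 1) n) := by
      rw [disjoint_left]
      intro τ h1 h2
      have hlev := (mem_filter.1 h1).2
      have hpos : 0 < #(atLevel D v (n + 1) τ) := by
        rcases mem_union.1 h2 with h2 | h2
        · rw [(mem_levelTris.1 h2).2.2]; norm_num
        · rw [(mem_levelTris.1 h2).2.1]; norm_num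
      obtain ⟨x, hx⟩ := card_pos.1 hpos
      have := hlev x (mem_atLevel.1 hx).1
      have := (mem_atLevel.1 hx).2
      omega
    rw [← card_union_of_disjoint hd1, ← card_union_of_disjoint hd2]
    congr 1
    ext τ
    rw [mem_filter, mem_union, mem_union, mem_filter]
    constructor
    · rintro ⟨hτ, hlev⟩
      by_cases hall : ∀ x ∈ τ, (skeleton D).dist v x ≤ n
      · exact Or.inl ⟨hτ, hall⟩
      · right
        push Not at hall
        obtain ⟨x, hx, hxn⟩ := hall
        have hxl : (skeleton D).dist v x = n + 1 := le_antisymm (hlev x hx) hxn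
        obtain ⟨h1, h2, h3, -⟩ := h.level_cards le_rfl hτ (mem_atLevel.2 ⟨hx, hxl⟩)
        have h5 : #(atLevel D v (n + 2) τ) = 0 := by
          rw [card_eq_zero, eq_empty_iff_forall_notMem]
          intro y hy
          have := hlev y (mem_atLevel.1 hy).1
          have := (mem_atLevel.1 hy).2
          omega
        rw [mem_levelTris, mem_levelTris]
        have : #(atLevel D v (n + 1) τ) = 1 ∨ #(atLevel D v (n + 1) τ) = 2 := by omega
        rcases this with e | e
        · exact Or.inl ⟨hτ, by omega, e⟩
        · exact Or.inr ⟨hτ, e, by omega⟩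
    · rintro (⟨hτ, hlev⟩ | hτ | hτ)
      · exact ⟨hτ, fun x hx => (hlev x hx).trans (Nat.le_succ n)⟩
      · refine ⟨(mem_levelTris.1 hτ).1, fun x hx => ?_⟩
        have := dist_le_of_mem_levelTris (by omega) hτ hx; omega
      · refine ⟨(mem_levelTris.1 hτ).1, fun x hx => ?_⟩
        have := dist_le_of_mem_levelTris (by omega) hτ hx; omega

end IsInteriorBall

end Weights

/-! ### The recurrences for an `(s,t)`-uniform disc -/

section Uniform

variable {W : Type*} {D : AbstractSimplicialComplex W} {v : W} {n k s t : ℕ}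

/-- The indicator function of the `s`-vertices. -/
def kIndicator (D : AbstractSimplicialComplex W) (s : ℕ) (x : W) : ℤ :=
  if IsKVertex D s x then 1 else 0

lemma IsUniformDisc.six_le (hU : IsUniformDisc D s t) (hs : 6 ≤ s) (ht : 6 ≤ t) {x : W}
    (hx : IsInteriorVertex D x) : 6 ≤ ((skeleton D).neighborSet x).ncard := by
  by_cases hst : s = t
  · rw [(hU.1 hst x hx).2]; exact ht
  · rcases (hU.2 hst x hx).1 with h | h <;> rw [h.2] <;> assumption

/-- Consecutive indices have opposite parity; evenness of `t` is what makes this hold across the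
wrap-around from `t - 1` to `0`. -/
lemma odd_add_of_cycleGraph_adj (ht : Even t) {i j : Fin t}
    (h : (SimpleGraph.cycleGraph t).Adj i j) : Odd (i.val + j.val) := by
  have key : ∀ a b : Fin t, (a - b).val = 1 → Odd (a.val + b.val) := by
    intro a b hab
    rw [Fin.val_sub] at hab
    have ha := a.2
    have hb := b.2
    obtain ⟨r, hr⟩ := ht
    rcases Nat.lt_or_ge (t - b.val + a.val) t with h | h
    · rw [Nat.mod_eq_of_lt h] at hab
      exact ⟨b.val - r + a.val + (r - b.val), by omega⟩
    · rw [Nat.mod_eq_sub_mod h, Nat.mod_eq_of_lt (by omega)] at hab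
      exact ⟨b.val, by omega⟩
  rw [SimpleGraph.cycleGraph_adj'] at h
  rcases h with h | h
  · exact key _ _ h
  · rw [add_comm]; exact key _ _ h

lemma IsKVertex.unique {x : W} (hs : IsKVertex D s x) (ht : IsKVertex D t x) : s = t :=
  hs.2.symm.trans ht.2

/-- A triangle with interior vertices has exactly one `s`-vertex. -/
lemma IsUniformDisc.sum_kIndicator (hU : IsUniformDisc D s t) (hst : s ≠ t) (ht : Even t)
    {τ : Finset W} (hτ : τ ∈ D.faces) (h3 : τ.card = 3)
    (hint : ∀ x ∈ τ, IsInteriorVertex D x) : ∑ x ∈ τ, kIndicator D s x = 1 := by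
  obtain ⟨x, y, z, hxy, hxz, hyz, rfl⟩ := card_eq_three.1 h3
  have hx := hint x (by simp)
  have hy := hint y (by simp)
  have hz := hint z (by simp)
  have axy : (skeleton D).Adj x y := adj_of_mem_face hτ (by simp) (by simp) hxy
  have axz : (skeleton D).Adj x z := adj_of_mem_face hτ (by simp) (by simp) hxz
  have ayz : (skeleton D).Adj y z := adj_of_mem_face hτ (by simp) (by simp) hyz
  have excl : ∀ {p q : W}, IsInteriorVertex D p → IsInteriorVertex D q → (skeleton D).Adj p q →
      IsKVertex D s p → ¬ IsKVertex D s q := by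
    intro p q hp hq hpq hps hqs
    rcases (hU.2 hst p hp).2.1 hps q hpq with h | h
    · exact hst (hqs.unique h)
    · exact hq h
  -- If `x` is a `t`-vertex, then `y` and `z` are adjacent in its alternating cycle of neighbours,
  -- so one of them has even position, and being interior it is an `s`-vertex.
  have exist : IsKVertex D s x ∨ IsKVertex D s y ∨ IsKVertex D s z := by
    by_cases hxs : IsKVertex D s x
    · exact Or.inl hxs
    right
    have hxt := ((hU.2 hst x hx).1).resolve_left hxs
    obtain ⟨c, -, hrange, hadj, -, heven⟩ := (hU.2 hst x hx).2.2 hxt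
    obtain ⟨i, rfl⟩ : y ∈ Set.range c := hrange ▸ axy
    obtain ⟨j, rfl⟩ : z ∈ Set.range c := hrange ▸ axz
    have hodd := odd_add_of_cycleGraph_adj ht ((hadj i j).1 ayz)
    rcases Nat.even_or_odd i.val with hi | hi
    · exact Or.inr ((heven j (by grind)).resolve_right hz)
    · exact Or.inl ((heven i (by grind)).resolve_right hy)
  rw [sum_insert (by simp [hxy, hxz]), sum_insert (by simp [hyz]), sum_singleton]
  simp only [kIndicator]
  rcases exist with h | h | h
  · rw [if_pos h, if_neg (excl hx hy axy h), if_neg (excl hx hz axz h)]; norm_num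
  · rw [if_pos h, if_neg (excl hy hx axy.symm h), if_neg (excl hy hz ayz h)]; norm_num
  · rw [if_pos h, if_neg (excl hz hx axz.symm h), if_neg (excl hz hy ayz.symm h)]; norm_num

/-- The recurrences for the length `x k` of the spheres and the number `y k` of their `s`-vertices
(`y k = x k / 3` if `s = t`). -/
structure IsSphereSequence (s t n : ℕ) (x y : ℕ → ℝ) : Prop where
  x_zero : x 0 = 0
  y_zero : y 0 = 0
  init : (x 1 = s ∧ y 1 = 0) ∨ (x 1 = t ∧ y 1 = t / 2) ∨ (x 1 = t ∧ y 1 = t / 3)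
  x_rec : ∀ k, k + 1 < n →
    x (k + 2) = ((s : ℝ) - 4) * y (k + 1) + ((t : ℝ) - 4) * (x (k + 1) - y (k + 1)) - x k
  y_rec : ∀ k, k + 2 < n → y (k + 2) = ((t : ℝ) - 4) / 2 * (x (k + 1) - y (k + 1)) - y k

variable [Fintype W]

lemma edgeWeight_one : edgeWeight D v (fun _ => 1) k = 2 * sphereLength D v k := by
  rw [edgeWeight, ← card_sphereEdges, mul_comm, ← nsmul_eq_mul, ← sum_const]
  refine sum_congr rfl fun e he => ?_
  rw [sum_const, (mem_sphereEdges.1 he).2.1]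
  norm_num

lemma sum_one_eq_three {τ : Finset W} (hτ : τ ∈ tris D) : ∑ _x ∈ τ, (1 : ℤ) = 3 := by
  rw [sum_const, (mem_tris.1 hτ).2]; norm_num

namespace IsInteriorBall

lemma sphereLength_zero (h : IsInteriorBall D v n) : sphereLength D v 0 = 0 := by
  rw [← card_sphereEdges, h.sphereEdges_zero, card_empty]

lemma sphereLength_one (h : IsInteriorBall D v n) (hn : 0 < n) :
    (sphereLength D v 1 : ℤ) = ((skeleton D).neighborSet v).ncard := by
  have := h.weight_degree_center hn (fun _ => 1) 3 fun τ hτ _ => sum_one_eq_three hτ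
  rw [edgeWeight_one] at this
  linarith

lemma sum_degree (h : IsInteriorBall D v n) (hk : k + 1 < n) :
    ∑ x ∈ atLevel D v (k + 1) univ, (((skeleton D).neighborSet x).ncard : ℤ) =
      sphereLength D v (k + 2) + sphereLength D v k + 4 * sphereLength D v (k + 1) := by
  have := h.sum_weight_degree hk (fun _ => 1) 3 fun τ hτ _ => sum_one_eq_three hτ
  simp only [edgeWeight_one, one_mul] at this
  rw [this]; ring

lemma card_atLevel (h : IsInteriorBall D v n) (hk : k + 1 < n) :
    ∑ _x ∈ atLevel D v (k + 1) univ, (1 : ℤ) = sphereLength D v (k + 1) := by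
  have := h.edgeWeight_eq (fun _ => 1) hk
  rw [edgeWeight_one] at this
  linarith

/-- The lengths of the spheres satisfy the recurrences of a sphere sequence. -/
theorem isSphereSequence (h : IsInteriorBall D v n) (hn : 2 ≤ n) (hU : IsUniformDisc D s t)
    (ht : Even t) : ∃ y, IsSphereSequence s t n (fun k => (sphereLength D v k : ℝ)) y := by
  have hv : IsInteriorVertex D v := h.interior v (by simp; omega)
  have hx1 := h.sphereLength_one (by omega)
  by_cases hst : s = t
  · subst hst
    have hrec : ∀ k, k + 1 < n → (sphereLength D v (k + 2) : ℝ) =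
        ((s : ℝ) - 4) * sphereLength D v (k + 1) - sphereLength D v k := by
      intro k hk
      have e1 := h.sum_degree hk
      have e2 := h.card_atLevel hk
      have e3 : ∑ x ∈ atLevel D v (k + 1) univ, (((skeleton D).neighborSet x).ncard : ℤ) =
          s * ∑ _x ∈ atLevel D v (k + 1) univ, (1 : ℤ) := by
        rw [mul_sum]
        refine sum_congr rfl fun x hx => ?_
        rw [(hU.1 rfl x (h.interior x (by rw [(mem_atLevel.1 hx).2]; omega))).2, mul_one]
      rw [e3, e2] at e1
      have e4 : (s : ℝ) * sphereLength D v (k + 1) = sphereLength D v (k + 2) +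
        sphereLength D v k + 4 * sphereLength D v (k + 1) := by exact_mod_cast e1
      linarith
    have hdeg := (hU.1 rfl v hv).2
    rw [hdeg] at hx1
    have hx1' : (sphereLength D v 1 : ℝ) = s := by exact_mod_cast hx1
    -- For `s = t` nothing distinguishes two kinds of vertices; one third is the ratio for which the
    -- recurrence for `y` reduces to the one for `x`.
    refine ⟨fun k => sphereLength D v k / 3, ⟨by simp [h.sphereLength_zero],
      by simp [h.sphereLength_zero], Or.inr (Or.inr ⟨hx1', by simp only [hx1']⟩), ?_, ?_⟩⟩
    · intro k hk
      simp only [hrec k hk]; ring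
    · intro k hk
      simp only [hrec k (by omega)]; ring
  · set w := kIndicator D s with hw
    have hsum : ∀ m, m < n → ∀ τ ∈ tris D, (∀ x ∈ τ, (skeleton D).dist v x ≤ m) →
        ∑ x ∈ τ, w x = 1 := by
      intro m hm τ hτ hlev
      exact hU.sum_kIndicator hst ht (mem_tris.1 hτ).1 (mem_tris.1 hτ).2 fun x hx =>
        h.interior x ((hlev x hx).trans_lt hm)
    have hdeg : ∀ x, IsInteriorVertex D x → (((skeleton D).neighborSet x).ncard : ℤ) =
        t + ((s : ℤ) - t) * w x := by
      intro x hx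
      by_cases hs : IsKVertex D s x
      · rw [hw, kIndicator, if_pos hs, hs.2]; ring
      · rw [hw, kIndicator, if_neg hs, (((hU.2 hst x hx).1).resolve_left hs).2]; ring
    have hwdeg : ∀ x, w x * (((skeleton D).neighborSet x).ncard : ℤ) = s * w x := by
      intro x
      by_cases hs : IsKVertex D s x
      · rw [hw, kIndicator, if_pos hs, hs.2]; ring
      · rw [hw, kIndicator, if_neg hs]; ring
    have hxrec : ∀ k, k + 1 < n → (sphereLength D v (k + 2) : ℝ) =
        ((s : ℝ) - 4) * (edgeWeight D v w (k + 1) / 2) + ((t : ℝ) - 4) *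
          (sphereLength D v (k + 1) - edgeWeight D v w (k + 1) / 2) - sphereLength D v k := by
      intro k hk
      have e1 := h.sum_degree hk
      have e2 := h.card_atLevel hk
      have e3 : ∑ x ∈ atLevel D v (k + 1) univ, (((skeleton D).neighborSet x).ncard : ℤ) =
          t * ∑ _x ∈ atLevel D v (k + 1) univ, (1 : ℤ) +
            ((s : ℤ) - t) * ∑ x ∈ atLevel D v (k + 1) univ, w x := by
        rw [mul_sum, mul_sum, ← sum_add_distrib]
        refine sum_congr rfl fun x hx => ?_
        rw [hdeg x (h.interior x (by rw [(mem_atLevel.1 hx).2]; omega)), mul_one]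
      have e4 := h.edgeWeight_eq w hk
      rw [e3, e2] at e1
      have e5 : (2 : ℤ) * (t * sphereLength D v (k + 1)) +
          ((s : ℤ) - t) * edgeWeight D v w (k + 1) = 2 * (sphereLength D v (k + 2) +
          sphereLength D v k + 4 * sphereLength D v (k + 1)) := by
        rw [e4, ← e1]; ring
      have e6 : (2 : ℝ) * (t * sphereLength D v (k + 1)) +
          ((s : ℝ) - t) * edgeWeight D v w (k + 1) = 2 * (sphereLength D v (k + 2) +
          sphereLength D v k + 4 * sphereLength D v (k + 1)) := by exact_mod_cast e5
      linarith
    -- Half the edge weight counts the `s`-vertices on spheres of positive radius below `n`. Its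
    -- value at radius `n` does not enter the recurrences.
    refine ⟨fun k => edgeWeight D v w k / 2, ⟨by simp [h.sphereLength_zero],
      by simp [edgeWeight, h.sphereEdges_zero], ?_, hxrec, ?_⟩⟩
    · have e1 := h.weight_degree_center (by omega) w 1 (hsum 1 (by omega))
      rw [hwdeg, one_mul] at e1
      have e2 := hdeg v hv
      by_cases hs : IsKVertex D s v
      · left
        have hwv : w v = 1 := by rw [hw, kIndicator, if_pos hs]
        rw [hwv] at e1 e2
        have e3 : (sphereLength D v 1 : ℤ) = s := by linarith
        have e4 : edgeWeight D v w 1 = 0 := by linarith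
        exact ⟨by exact_mod_cast e3, by simp [e4]⟩
      · right; left
        have hwv : w v = 0 := by rw [hw, kIndicator, if_neg hs]
        rw [hwv] at e1 e2
        have e3 : (sphereLength D v 1 : ℤ) = t := by linarith
        have e4 : edgeWeight D v w 1 = (t : ℤ) := by linarith
        exact ⟨by exact_mod_cast e3, by simp [e4]⟩
    · intro k hk
      have e1 := h.sum_weight_degree (by omega) w 1 (hsum (k + 2) hk)
      rw [sum_congr rfl fun x _ => hwdeg x, ← mul_sum] at e1
      have e4 := h.edgeWeight_eq w (show k + 1 < n by omega)
      have e5 : (s : ℤ) * edgeWeight D v w (k + 1) = 2 * (sphereLength D v (k + 2) +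
          sphereLength D v k - edgeWeight D v w (k + 2) -
          edgeWeight D v w k + 2 * edgeWeight D v w (k + 1)) := by
        have : (s : ℤ) * edgeWeight D v w (k + 1) =
          2 * (s * ∑ x ∈ atLevel D v (k + 1) univ, w x) := by rw [e4]; ring
        rw [this, e1]; ring
      have e6 : (s : ℝ) * edgeWeight D v w (k + 1) = 2 * (sphereLength D v (k + 2) +
          sphereLength D v k - edgeWeight D v w (k + 2) -
          edgeWeight D v w k + 2 * edgeWeight D v w (k + 1)) := by exact_mod_cast e5
      -- `e6` relates the new `y` to the new `x`; substituting the recurrence for `x` cancels the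
      -- term with `s`.
      have e7 := hxrec k (by omega)
      linarith

end IsInteriorBall

end Uniform

end SimplicialDisc

end

noncomputable section

namespace SimplicialDisc

open Finset Filter Topology

/-! ### Growth of solutions of `f (k + 2) = c * f (k + 1) - f k` -/

section LinearRecurrence

variable {f : ℕ → ℝ} {c l : ℝ}

/-- The sum telescopes, so the area is governed by two consecutive terms and a constant. -/
lemma sum_of_recurrence (h0 : f 0 = 0) (hf : ∀ k, f (k + 2) = c * f (k + 1) - f k) (n : ℕ) :
    (c - 2) * ∑ k ∈ range n, (f k + f (k + 1)) = 2 * f (n + 1) - c * f n - 2 * f 1 := by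
  induction n with
  | zero => simp [h0]
  | succ n ih => rw [sum_range_succ, mul_add, ih, hf]; ring

/-- The characteristic roots are `l` and `l⁻¹`, so `f n` is `f 1 / (l - l⁻¹)` times `l ^ n - l⁻¹ ^
n`. -/
lemma tendsto_of_recurrence (h0 : f 0 = 0) (hf : ∀ k, f (k + 2) = c * f (k + 1) - f k)
    (hl : 1 < l) (hc : c = l + l⁻¹) :
    Tendsto (fun n => f n / l ^ n) atTop (𝓝 (f 1 / (l - l⁻¹))) := by
  have hl0 : l ≠ 0 := by positivity
  have hinv : l⁻¹ < 1 := inv_lt_one_of_one_lt₀ hl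
  have hd : l - l⁻¹ ≠ 0 := by linarith
  have closed : ∀ n, f n = f 1 / (l - l⁻¹) * (l ^ n - l⁻¹ ^ n) ∧
      f (n + 1) = f 1 / (l - l⁻¹) * (l ^ (n + 1) - l⁻¹ ^ (n + 1)) := by
    intro n
    induction n with
    | zero => exact ⟨by simp [h0], by simp [hd]⟩
    | succ n ih =>
      refine ⟨ih.2, ?_⟩
      rw [hf n, ih.1, ih.2, hc]
      have : l * l⁻¹ = 1 := mul_inv_cancel₀ hl0
      linear_combination (f 1 / (l - l⁻¹)) * (l ^ n - l⁻¹ ^ n) * this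
  have hlim : Tendsto (fun n : ℕ => f 1 / (l - l⁻¹) * (1 - (l⁻¹ * l⁻¹) ^ n)) atTop
      (𝓝 (f 1 / (l - l⁻¹) * (1 - 0))) := by
    refine Tendsto.const_mul _ (Tendsto.const_sub _ (tendsto_pow_atTop_nhds_zero_of_lt_one
      (by positivity) ?_))
    have : 0 < l⁻¹ := by positivity
    nlinarith
  rw [sub_zero, mul_one] at hlim
  refine hlim.congr fun n => ?_
  rw [(closed n).1, mul_pow, inv_pow]
  field_simp

/-- The solutions for the smaller eigenvalue grow more slowly. -/
lemma tendsto_zero_of_recurrence {r : ℝ} (h0 : f 0 = 0)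
    (hf : ∀ k, f (k + 2) = -r * f (k + 1) - f k) (hr : 0 ≤ r) (hl : 1 < l) (hrl : r < l + l⁻¹) :
    Tendsto (fun n => f n / l ^ n) atTop (𝓝 0) := by
  have hl0 : 0 < l := by positivity
  rcases lt_or_ge r 2 with h2 | h2
  -- For `r < 2` the characteristic roots lie on the unit circle: the recurrence preserves a
  -- quadratic form, positive definite in this range, so `f` is bounded.
  · have energy : ∀ n, f (n + 1) ^ 2 + r * f (n + 1) * f n + f n ^ 2 = f 1 ^ 2 := by
      intro n
      induction n with
      | zero => simp [h0]
      | succ n ih => rw [← ih, hf]; ring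
    have bound : ∀ n, (f n) ^ 2 ≤ f 1 ^ 2 / (1 - r / 2) := by
      intro n
      rw [le_div_iff₀ (by linarith)]
      have := energy n
      nlinarith [sq_nonneg (f (n + 1) + f n), sq_nonneg (f (n + 1)),
        mul_nonneg hr (sq_nonneg (f (n + 1) + f n)),
        mul_nonneg (show 0 ≤ 1 - r / 2 by linarith) (sq_nonneg (f (n + 1)))]
    have bound' : ∀ n, |f n| ≤ √(f 1 ^ 2 / (1 - r / 2)) := fun n => Real.abs_le_sqrt (bound n)
    have hpow : Tendsto (fun n : ℕ => (l⁻¹) ^ n) atTop (𝓝 0) :=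
      tendsto_pow_atTop_nhds_zero_of_lt_one (by positivity) (inv_lt_one_of_one_lt₀ hl)
    refine squeeze_zero_norm (fun n => ?_) (by simpa using hpow.const_mul √(f 1 ^ 2 / (1 - r / 2)))
    rw [Real.norm_eq_abs, abs_div, abs_of_pos (pow_pos hl0 n), div_eq_mul_inv]
    exact mul_le_mul_of_nonneg_right (bound' n) (by positivity)
  -- For `2 ≤ r` the characteristic roots are `-m` and `-m⁻¹` with `1 ≤ m < l`. The factor `n` in
  -- the bound `n * m ^ n` also covers the double root at `r = 2`.
  · set m := (r + √(r ^ 2 - 4)) / 2 with hm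
    have hsq : √(r ^ 2 - 4) ^ 2 = r ^ 2 - 4 := Real.sq_sqrt (by nlinarith)
    have hm1 : 1 ≤ m := by
      have := Real.sqrt_nonneg (r ^ 2 - 4)
      rw [hm]; linarith
    have hm0 : 0 < m := by linarith
    have hmr : m * m + 1 = r * m := by rw [hm]; nlinarith
    have hmr' : m + m⁻¹ = r := by field_simp; linarith
    have hml : m < l := by
      by_contra! hle
      have : l + l⁻¹ ≤ m + m⁻¹ := by
        have e : m + m⁻¹ - (l + l⁻¹) = (m - l) * (m * l - 1) / (m * l) := by field_simp; ring
        have : 0 ≤ (m - l) * (m * l - 1) / (m * l) :=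
          div_nonneg (mul_nonneg (by linarith) (by nlinarith)) (by positivity)
        linarith
      linarith
    have step : ∀ n, f (n + 1) + m * f n = (-m⁻¹) ^ n * f 1 := by
      intro n
      induction n with
      | zero => simp [h0]
      | succ n ih =>
        have h1 : m⁻¹ * m = 1 := inv_mul_cancel₀ hm0.ne'
        rw [pow_succ, hf, ← hmr']
        linear_combination (-m⁻¹) * ih + f n * h1
    have bound : ∀ n : ℕ, |f n| ≤ n * m ^ n * |f 1| := by
      intro n
      induction n with
      | zero => simp [h0]
      | succ n ih =>
        have e : f (n + 1) = (-m⁻¹) ^ n * f 1 - m * f n := by linarith [step n]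
        have h1 : |(-m⁻¹) ^ n * f 1| ≤ m ^ (n + 1) * |f 1| := by
          rw [abs_mul, abs_pow, abs_neg, abs_of_pos (inv_pos.2 hm0)]
          refine mul_le_mul_of_nonneg_right ?_ (abs_nonneg _)
          exact (pow_le_one₀ (by positivity) (inv_le_one_of_one_le₀ hm1)).trans
            (one_le_pow₀ hm1)
        have h2 : |m * f n| ≤ n * m ^ (n + 1) * |f 1| := by
          rw [abs_mul, abs_of_pos hm0, pow_succ]
          calc m * |f n| ≤ m * (n * m ^ n * |f 1|) := by gcongr
            _ = n * (m ^ n * m) * |f 1| := by ring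
        calc |f (n + 1)| ≤ |(-m⁻¹) ^ n * f 1| + |m * f n| := by rw [e]; exact abs_sub _ _
          _ ≤ m ^ (n + 1) * |f 1| + n * m ^ (n + 1) * |f 1| := add_le_add h1 h2
          _ = ((n + 1 : ℕ) : ℝ) * m ^ (n + 1) * |f 1| := by push_cast; ring
    have hlim : Tendsto (fun n : ℕ => (n : ℝ) * (m / l) ^ n * |f 1|) atTop (𝓝 (0 * |f 1|)) := by
      refine Tendsto.mul_const _ (tendsto_self_mul_const_pow_of_lt_one (by positivity) ?_)
      rw [div_lt_one hl0]; exact hml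
    rw [zero_mul] at hlim
    refine squeeze_zero_norm (fun n => ?_) hlim
    rw [Real.norm_eq_abs, abs_div, abs_of_pos (pow_pos hl0 n), div_pow, div_le_iff₀ (pow_pos hl0 n)]
    refine (bound n).trans (le_of_eq ?_)
    field_simp

end LinearRecurrence

/-! ### Eigenvalues of the recurrence and the limit of the ratio -/

section Asymptotics

/-- The solution of the recurrences for the spheres with initial values `a` and `b`. -/
def sphereSolution (S T a b : ℝ) : ℕ → ℝ × ℝ
  | 0 => (0, 0)
  | 1 => (a, b)
  | k + 2 =>
    (S * (sphereSolution S T a b (k + 1)).2 + T * ((sphereSolution S T a b (k + 1)).1 -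
      (sphereSolution S T a b (k + 1)).2) - (sphereSolution S T a b k).1,
    T / 2 * ((sphereSolution S T a b (k + 1)).1 - (sphereSolution S T a b (k + 1)).2) -
      (sphereSolution S T a b k).2)

/-- The recurrences determine `x` up to radius `n` and `y` only below it. Thus a finite disc follows
an infinite solution that depends only on `s`, `t` and the initial values, for which limits make
sense. -/
lemma IsSphereSequence.eq_sphereSolution {s t n : ℕ} {x y : ℕ → ℝ}
    (h : IsSphereSequence s t n x y) (k : ℕ) :
    (k ≤ n → x k = (sphereSolution ((s : ℝ) - 4) ((t : ℝ) - 4) (x 1) (y 1) k).1) ∧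
    (k < n → y k = (sphereSolution ((s : ℝ) - 4) ((t : ℝ) - 4) (x 1) (y 1) k).2) := by
  induction k using Nat.twoStepInduction with
  | zero => exact ⟨fun _ => h.x_zero, fun _ => h.y_zero⟩
  | one => exact ⟨fun _ => rfl, fun _ => rfl⟩
  | more k ih0 ih1 =>
    constructor
    · intro hk
      rw [h.x_rec k (by omega), sphereSolution, ← ih1.1 (by omega), ← ih1.2 (by omega),
        ← ih0.1 (by omega)]
    · intro hk
      rw [h.y_rec k hk, sphereSolution, ← ih1.1 (by omega), ← ih1.2 (by omega),
        ← ih0.2 (by omega)]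

theorem tendsto_sphereSolution {S T P a b : ℝ} (hS : 0 < S) (hT : 0 < T) (hP : 2 < P)
    (hPST : 2 * P ^ 2 = T * P + S * T) (hb : 0 ≤ b) (hba : b ≤ a) (ha : 0 < a) :
    Tendsto (fun n => (∑ k ∈ range n, ((sphereSolution S T a b k).1 +
      (sphereSolution S T a b (k + 1)).1)) / (sphereSolution S T a b n).1) atTop
      (𝓝 √((P + 2) / (P - 2))) := by
  set X : ℕ → ℝ := fun k => (sphereSolution S T a b k).1 with hX
  set Y : ℕ → ℝ := fun k => (sphereSolution S T a b k).2 with hY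
  have X0 : X 0 = 0 := rfl
  have Y0 : Y 0 = 0 := rfl
  have X1 : X 1 = a := rfl
  have Y1 : Y 1 = b := rfl
  have X2 : ∀ k, X (k + 2) = S * Y (k + 1) + T * (X (k + 1) - Y (k + 1)) - X k := fun _ => rfl
  have Y2 : ∀ k, Y (k + 2) = T / 2 * (X (k + 1) - Y (k + 1)) - Y k := fun _ => rfl
  -- The roots of `2z² = Tz + ST` are `P` and `-r`: their sum is `T / 2`.
  set r := P - T / 2 with hr
  have hrpos : 0 < r := by
    have : 0 < P * (2 * P - T) := by nlinarith [mul_pos hS hT]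
    have := pos_of_mul_pos_right this (by linarith)
    linarith
  have hrP : r < P := by linarith
  have hrST : 2 * r ^ 2 = -T * r + S * T := by rw [hr]; nlinarith
  set l := (P + √(P ^ 2 - 4)) / 2 with hl
  have hsq : √(P ^ 2 - 4) ^ 2 = P ^ 2 - 4 := Real.sq_sqrt (by nlinarith)
  have hsqpos : 0 < √(P ^ 2 - 4) := Real.sqrt_pos.2 (by nlinarith)
  have hl1 : 1 < l := by rw [hl]; linarith
  have hl0 : 0 < l := by linarith
  have hlP : P = l + l⁻¹ := by
    have : l * l + 1 = P * l := by rw [hl]; nlinarith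
    field_simp; linarith
  have hsub : l - l⁻¹ = √(P ^ 2 - 4) := by
    have : l⁻¹ = P - l := by linarith
    rw [this, hl]; ring
  -- In the coordinates `Y` and `X - Y`, these are the left eigenvectors for `P` and `-r`; they
  -- decouple the system into two scalar recurrences.
  let φ : ℕ → ℝ := fun k => S * Y k + P * (X k - Y k)
  let ψ : ℕ → ℝ := fun k => S * Y k - r * (X k - Y k)
  have φ0 : φ 0 = 0 := by simp [φ, X0, Y0]
  have ψ0 : ψ 0 = 0 := by simp [ψ, X0, Y0]
  have φ2 : ∀ k, φ (k + 2) = P * φ (k + 1) - φ k := by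
    intro k
    simp only [φ, X2, Y2]
    linear_combination (-(X (k + 1) - Y (k + 1)) / 2) * hPST
  have ψ2 : ∀ k, ψ (k + 2) = -r * ψ (k + 1) - ψ k := by
    intro k
    simp only [ψ, X2, Y2]
    linear_combination (-(X (k + 1) - Y (k + 1)) / 2) * hrST
  have limφ := tendsto_of_recurrence φ0 φ2 hl1 hlP
  have limψ := tendsto_zero_of_recurrence ψ0 ψ2 hrpos.le hl1 (by linarith)
  set K := φ 1 / (l - l⁻¹) with hK
  -- The leading coefficient must not vanish; this is where `0 ≤ b ≤ a` and `0 < a` are needed.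
  have hKpos : 0 < K := by
    rw [hK, hsub]
    refine div_pos ?_ hsqpos
    simp only [φ, X1, Y1]
    rcases hb.eq_or_lt with rfl | hb'
    · have : 0 < P * (a - 0) := by rw [sub_zero]; exact mul_pos (by linarith) ha
      linarith
    · have := mul_pos hS hb'
      have := mul_nonneg (show 0 ≤ P by linarith) (sub_nonneg.2 hba)
      linarith
  set α := (1 + r / S) / (P + r) with hα
  set β := (P / S - 1) / (P + r) with hβ
  have hPr : P + r ≠ 0 := by linarith
  have hαpos : 0 < α := by rw [hα]; positivity
  have hXφ : ∀ k, X k = α * φ k + β * ψ k := by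
    intro k
    simp only [hα, hβ, φ, ψ]
    field_simp
    ring
  have limX : Tendsto (fun n => X n / l ^ n) atTop (𝓝 (α * K)) := by
    have := (limφ.const_mul α).add (limψ.const_mul β)
    rw [mul_zero, add_zero] at this
    refine this.congr fun n => ?_
    rw [hXφ]; ring
  have hinvpow : Tendsto (fun n : ℕ => (l⁻¹) ^ n) atTop (𝓝 0) :=
    tendsto_pow_atTop_nhds_zero_of_lt_one (by positivity) (inv_lt_one_of_one_lt₀ hl1)
  have shift : ∀ {f : ℕ → ℝ} {L : ℝ}, Tendsto (fun n => f n / l ^ n) atTop (𝓝 L) →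
      Tendsto (fun n => f (n + 1) / l ^ n) atTop (𝓝 (l * L)) := by
    intro f L hf
    refine (((tendsto_add_atTop_iff_nat 1).2 hf).const_mul l).congr fun n => ?_
    rw [pow_succ]
    field_simp
  have limSum : ∀ {f : ℕ → ℝ} {c L : ℝ}, f 0 = 0 → (∀ k, f (k + 2) = c * f (k + 1) - f k) →
      c ≠ 2 → Tendsto (fun n => f n / l ^ n) atTop (𝓝 L) →
      Tendsto (fun n => (∑ k ∈ range n, (f k + f (k + 1))) / l ^ n) atTop
        (𝓝 ((2 * l - c) / (c - 2) * L)) := by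
    intro f c L h0 h2 hc hf
    have hc' : c - 2 ≠ 0 := sub_ne_zero.2 hc
    have := ((((shift hf).const_mul 2).sub (hf.const_mul c)).sub
      (hinvpow.const_mul (2 * f 1))).div_const (c - 2)
    rw [show (2 * (l * L) - c * L - 2 * f 1 * 0) / (c - 2) = (2 * l - c) / (c - 2) * L by ring]
      at this
    refine this.congr fun n => ?_
    have hs := sum_of_recurrence h0 h2 n
    have hs' : ∑ k ∈ range n, (f k + f (k + 1)) =
        (2 * f (n + 1) - c * f n - 2 * f 1) / (c - 2) := by
      rw [eq_div_iff hc', ← hs]; ring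
    rw [hs', inv_pow]
    ring
  have limA : Tendsto (fun n => (∑ k ∈ range n, (X k + X (k + 1))) / l ^ n) atTop
      (𝓝 (α * ((2 * l - P) / (P - 2) * K))) := by
    have := ((limSum φ0 φ2 (by linarith) limφ).const_mul α).add
      ((limSum ψ0 ψ2 (by linarith) limψ).const_mul β)
    rw [mul_zero, mul_zero, add_zero] at this
    refine this.congr fun n => ?_
    have e : ∑ k ∈ range n, (X k + X (k + 1)) = α * ∑ k ∈ range n, (φ k + φ (k + 1)) +
        β * ∑ k ∈ range n, (ψ k + ψ (k + 1)) := by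
      rw [mul_sum, mul_sum, ← sum_add_distrib]
      refine sum_congr rfl fun k _ => ?_
      rw [hXφ k, hXφ (k + 1)]; ring
    rw [e]; ring
  -- The factor `α * K`, the only trace of the initial values, cancels; and `2 * l - P = √(P ^ 2 -
  -- 4)`.
  have hlim : √((P + 2) / (P - 2)) = α * ((2 * l - P) / (P - 2) * K) / (α * K) := by
    have e1 : α * ((2 * l - P) / (P - 2) * K) / (α * K) = (2 * l - P) / (P - 2) := by
      field_simp
    have e2 : 2 * l - P = √(P ^ 2 - 4) := by rw [hl]; ring
    rw [e1, e2, Real.sqrt_eq_iff_mul_self_eq (div_nonneg (by linarith) (by linarith))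
      (div_nonneg hsqpos.le (by linarith))]
    have hP2 : P - 2 ≠ 0 := by linarith
    rw [div_mul_div_comm, ← sq, hsq]
    field_simp
    ring
  rw [hlim]
  refine (limA.div limX (mul_pos hαpos hKpos).ne').congr fun n => ?_
  rw [Pi.div_apply, div_div_div_cancel_right₀ (pow_pos hl0 n).ne']

end Asymptotics

theorem sphereRatioTendsto {s t : ℕ} (hs : 6 ≤ s) (ht : 6 ≤ t) (ht_even : Even t) {P : ℝ}
    (hP : 2 < P) (hPst : 2 * P ^ 2 = ((t : ℝ) - 4) * P + ((s : ℝ) - 4) * ((t : ℝ) - 4)) :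
    SphereRatioTendsto.{u} s t (√((P + 2) / (P - 2))) := by
  intro ε hε
  have hs' : (6 : ℝ) ≤ s := by exact_mod_cast hs
  have ht' : (6 : ℝ) ≤ t := by exact_mod_cast ht
  have bound : ∀ a b : ℝ, 0 ≤ b → b ≤ a → 0 < a → ∃ N, ∀ n ≥ N,
      dist ((∑ k ∈ range n, ((sphereSolution ((s : ℝ) - 4) ((t : ℝ) - 4) a b k).1 +
        (sphereSolution ((s : ℝ) - 4) ((t : ℝ) - 4) a b (k + 1)).1)) /
        (sphereSolution ((s : ℝ) - 4) ((t : ℝ) - 4) a b n).1) √((P + 2) / (P - 2)) < ε :=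
    fun a b hb hba ha => Metric.tendsto_atTop.1
      (tendsto_sphereSolution (by linarith) (by linarith) hP hPst hb hba ha) ε hε
  obtain ⟨N₁, h₁⟩ := bound s 0 le_rfl (by linarith) (by linarith)
  obtain ⟨N₂, h₂⟩ := bound t (t / 2) (by linarith) (by linarith) (by linarith)
  obtain ⟨N₃, h₃⟩ := bound t (t / 3) (by linarith) (by linarith) (by linarith)
  -- Three solutions cover all cases: centre an `s`-vertex, centre a `t`-vertex, and `s = t`. The
  -- bound `2` makes the neighbours of the centre interior, as the initial values require.
  refine ⟨max 2 (max N₁ (max N₂ N₃)), fun n hn V X hX γ hγ W D f hmin v _ hv => ?_⟩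
  simp only [max_le_iff] at hn
  obtain ⟨hn2, hn₁, hn₂, hn₃⟩ := hn
  have hU := hX.uniform γ hγ W D f hmin
  have hD := hmin.filling.disc
  have := hD.finite
  let _ := Fintype.ofFinite W
  have hball : IsInteriorBall D v n := ⟨hD, fun x hx => hU.six_le hs ht hx, hv⟩
  obtain ⟨y, hy⟩ := hball.isSphereSequence hn2 hU ht_even
  have area : (sphereArea D v n : ℝ) =
      ∑ k ∈ range n, ((sphereLength D v k : ℝ) + (sphereLength D v (k + 1) : ℝ)) := by
    exact_mod_cast IsInteriorBall.sphereArea_eq n hball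
  have area' : (sphereArea D v n : ℝ) = ∑ k ∈ range n,
      ((sphereSolution ((s : ℝ) - 4) ((t : ℝ) - 4) (sphereLength D v 1) (y 1) k).1 +
      (sphereSolution ((s : ℝ) - 4) ((t : ℝ) - 4) (sphereLength D v 1) (y 1) (k + 1)).1) := by
    rw [area]
    refine sum_congr rfl fun k hk => ?_
    rw [← (hy.eq_sphereSolution k).1 (mem_range.1 hk).le,
      ← (hy.eq_sphereSolution (k + 1)).1 (mem_range.1 hk)]
  rw [area', (hy.eq_sphereSolution n).1 le_rfl, ← Real.dist_eq]
  rcases hy.init with ⟨hx, hy1⟩ | ⟨hx, hy1⟩ | ⟨hx, hy1⟩ <;> simp only [hx, hy1]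
  · exact h₁ n hn₁
  · exact h₂ n hn₂
  · exact h₃ n hn₃

end SimplicialDisc

end

theorem theorem3p3 (s t : ℕ) (hs : 6 ≤ s) (ht : 6 ≤ t) (ht_even : Even t)
    (hst : ¬ (s = 6 ∧ t = 6)) (S T P : ℝ) (hS : S = (s : ℝ) - 4) (hT : T = (t : ℝ) - 4)
    (hP : P = (T + √(T ^ 2 + 8 * S * T)) / 4) :
    SimplicialDisc.SphereRatioTendsto.{u} s t
      (√((T + 8 + √(T ^ 2 + 8 * S * T)) / (T - 8 + √(T ^ 2 + 8 * S * T)))) ∧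
    SimplicialDisc.SphereRatioTendsto.{u} s t (√((P + 2) / (P - 2))) := by
  have hs' : (6 : ℝ) ≤ s := by exact_mod_cast hs
  have ht' : (6 : ℝ) ≤ t := by exact_mod_cast ht
  have hS2 : 2 ≤ S := by linarith
  have hT2 : 2 ≤ T := by linarith
  have hST : 5 ≤ S + T := by
    have : 13 ≤ s + t := by omega
    have : (13 : ℝ) ≤ s + t := by exact_mod_cast this
    linarith
  have hroot : √(T ^ 2 + 8 * S * T) = 4 * P - T := by linarith
  have hsq : (4 * P - T) ^ 2 = T ^ 2 + 8 * S * T := by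
    rw [← hroot, Real.sq_sqrt (by positivity)]
  -- This amounts to `T * (S + 2) > 8`, which fails with equality exactly at the excluded pair `S =
  -- T = 2`.
  have hP2 : 2 < P := by
    have : 8 - T < 4 * P - T := by
      rw [← hroot]
      exact Real.lt_sqrt_of_sq_lt (by nlinarith)
    linarith
  have key := SimplicialDisc.sphereRatioTendsto.{u} hs ht ht_even hP2
    (by rw [← hS, ← hT]; linarith)
  have hratio : (T + 8 + √(T ^ 2 + 8 * S * T)) / (T - 8 + √(T ^ 2 + 8 * S * T)) =
      (P + 2) / (P - 2) := by
    rw [hroot, show T + 8 + (4 * P - T) = 4 * (P + 2) by ring,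
      show T - 8 + (4 * P - T) = 4 * (P - 2) by ring, mul_div_mul_left _ _ four_ne_zero]
  exact ⟨hratio ▸ key, key⟩
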